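/- Graphs are finite and may have parallel edges and loops; a loop counts twice in a degree. A circuit is a connected $2$-regular subgraph, and a $k$-cycle is a circuit with $k$ vertices. A circuit double cover of a graph $H$ is a multiset of circuits of $H$ such that every edge of $H$ is contained in exactly two of its members, counted with multiplicity; $\nu(H)$ denotes the number of circuit double covers of $H$. A graph is cyclically $4$-edge-connected if every edge cut that has a circuit on each of its two sides consists of at least $4$ edges (the empty cut of a disconnected graph included). Let $G$ be a cyclically $4$-edge-connected cubic graph with no $4$-cycle, and let $v_0v_1v_2v_3v_4$ be a $5$-cycle of $G$, with vertices in cyclic order and indices modulo $5$. For each $i$ let $u_i$ be the end, other than $v_i$, of the third edge at $v_i$ (the edge not on the $5$-cycle). For $a \neq b$ let $G_{a,b}$ be the cubic graph obtained from $G$ by deleting $v_0,\dots,v_4$ together with all their edges, adding a new edge joining $u_a$ and $u_b$, and adding a new vertex joined by one edge to each of the three vertices $u_c$ with $c \in \{0,1,2,3,4\} \setminus \{a,b\}$. (The new edge may be parallel to an edge of $G$.) The graphs $G_{i,i+1}$ are the five replacements of the $5$-cycle by a cubic vertex and an edge that are non-crossing when the $5$-cycle is drawn as a face. Then \[ \nu(G)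 \;\ge\; \tfrac{5}{2}\, \min_{0 \le i \le 4} \nu(G_{i,i+1}) \qquad\text{and}\qquad \nu(G) \;\ge\; 3.75 \min_{0 \le a < b \le 4} \nu(G_{a,b}). \] -/

import Mathlib

namespace Graph

variable {α β : Type*}

/-- The degree of a vertex of a multigraph: the number of incident edges, loops counted twice. -/
noncomputable def degree (G : Graph α β) (x : α) : ℕ∞ :=
  (G.incidenceSet x).encard + (G.loopSet x).encard

/-- All vertices have degree three. -/
def IsCubic (G : Graph α β) : Prop := ∀ x ∈ G.vertexSet, G.degree x = 3

/-- A nonempty graph in which any two vertices are joined by a walk. -/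
def IsConnected (G : Graph α β) : Prop :=
  G.vertexSet.Nonempty ∧
    ∀ x ∈ G.vertexSet, ∀ y ∈ G.vertexSet, Relation.ReflTransGen G.Adj x y

/-- A circuit is a finite connected 2-regular graph (a loop and a pair of parallel edges
are the circuits of length one and two). -/
def IsCircuit (C : Graph α β) : Prop :=
  C.vertexSet.Finite ∧ C.IsConnected ∧ ∀ x ∈ C.vertexSet, C.degree x = 2

/-- `G` contains a `k`-cycle, i.e. a circuit of length `k`, as a (not necessarily induced)
subgraph. -/
def HasCycleOfLength (G : Graph α β) (k : ℕ) : Prop :=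
  ∃ C : Graph α β, C ≤ G ∧ C.IsCircuit ∧ C.vertexSet.encard = k

/-- The edge cut between the vertex set `X` and the remaining vertices. -/
def edgeCut (G : Graph α β) (X : Set α) : Set β :=
  {e | ∃ x ∈ X, ∃ y ∈ G.vertexSet \ X, G.IsLink e x y}

/-- Every edge cut with a circuit on each of its two sides has at least `k` edges. (The empty
cut is included, so a cubic graph with this property for some `k ≥ 1` is connected.) -/
def CyclicallyEdgeConnected (G : Graph α β) (k : ℕ) : Prop :=
  ∀ X ⊆ G.vertexSet,
    (∃ C, C ≤ G.induce X ∧ C.IsCircuit) →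
    (∃ C, C ≤ G.induce (G.vertexSet \ X) ∧ C.IsCircuit) →
    (k : ℕ∞) ≤ (G.edgeCut X).encard

open Classical in
/-- A multiset of circuits of `G` in which every edge of `G` lies in exactly two members,
counted with multiplicity. -/
def IsCircuitDoubleCover (G : Graph α β) (𝒞 : Multiset (Graph α β)) : Prop :=
  (∀ C ∈ 𝒞, C ≤ G ∧ C.IsCircuit) ∧
    ∀ e ∈ G.edgeSet, 𝒞.countP (fun C => e ∈ C.edgeSet) = 2

/-- `ν(G)`, the number of circuit double covers of a finite graph. -/
noncomputable def numCircuitDoubleCovers (G : Graph α β) : ℕ :=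
  {𝒞 : Multiset (Graph α β) | G.IsCircuitDoubleCover 𝒞}.ncard

/-- A 5-cycle of `G` with a cyclic labelling `vert 0, …, vert 4` of its vertices; indices are
modulo five. `rim i` is the edge of the cycle from `vert i` to `vert (i + 1)`, and `spoke i` is
an edge at `vert i` outside the cycle, with other end `outer i`. In a cubic graph `spoke i` and
`outer i` exist and are determined by the cycle. -/
structure FiveCycle (G : Graph α β) where
  vert : Fin 5 → α
  rim : Fin 5 → β
  spoke : Fin 5 → β
  outer : Fin 5 → α
  vert_injective : Function.Injective vert
  rim_isLink : ∀ i, G.IsLink (rim i) (vert i) (vert (i + 1))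
  spoke_isLink : ∀ i, G.IsLink (spoke i) (vert i) (outer i)
  spoke_ne_rim : ∀ i j, spoke i ≠ rim j

namespace FiveCycle

variable {G : Graph α β}

open Classical in
/-- Sends the vertices of the 5-cycle to the new vertex `none` and fixes all other vertices. -/
noncomputable def collapse (P : G.FiveCycle) (x : α) : Option α :=
  if x ∈ Set.range P.vert then none else some x

/-- The graph obtained from `G` by replacing the 5-cycle by a cubic vertex and an edge. The new
edge `none` joins `outer a` and `outer b` (and takes the place of the spokes `a` and `b`); the
new vertex `none` is attached to the other three spokes; everything outside the 5-cycle is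
kept. -/
noncomputable def replace (P : G.FiveCycle) (a b : Fin 5) : Graph (Option α) (Option β) where
  vertexSet := P.collapse '' G.vertexSet
  IsLink f x y :=
    (∃ e, f = some e ∧
      ((G.deleteEdges (Set.range P.rim ∪ {P.spoke a, P.spoke b})).map P.collapse).IsLink e x y) ∨
    (f = none ∧ s(x, y) = s(P.collapse (P.outer a), P.collapse (P.outer b)))
  isLink_symm := by
    intro f _
    constructor
    rintro x y (⟨e, rfl, h⟩ | ⟨rfl, h⟩)
    · exact Or.inl ⟨e, rfl, h.symm⟩
    · exact Or.inr ⟨rfl, by rw [Sym2.eq_swap, h]⟩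
  eq_or_eq_of_isLink_of_isLink := by
    rintro f x y z w (⟨e, rfl, h⟩ | ⟨rfl, h⟩) (⟨e', he, h'⟩ | ⟨he, h'⟩)
    · obtain rfl := Option.some.inj he
      exact h.left_eq_or_eq h'
    · cases he
    · cases he
    · have hx : x ∈ s(z, w) := by rw [h', ← h]; exact Sym2.mem_mk_left x y
      exact Sym2.mem_iff.1 hx
  left_mem_of_isLink := by
    rintro f x y (⟨e, rfl, h⟩ | ⟨rfl, h⟩)
    · simpa using h.left_mem
    · have hx : x ∈ s(P.collapse (P.outer a), P.collapse (P.outer b)) := by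
        rw [← h]; exact Sym2.mem_mk_left x y
      rcases Sym2.mem_iff.1 hx with rfl | rfl
      · exact ⟨_, (P.spoke_isLink a).right_mem, rfl⟩
      · exact ⟨_, (P.spoke_isLink b).right_mem, rfl⟩

end FiveCycle

end Graph

/-- The ten two-element subsets `{a, b}` of the five spokes, listed with `a < b`. -/
def spokePairs : Finset (Fin 5 × Fin 5) := Finset.univ.filter fun p => p.1 < p.2

theorem spokePairs_nonempty : spokePairs.Nonempty := ⟨(0, 1), by decide⟩

/-!
In a loopless cubic graph a circuit double cover is the same thing as a transition system that
continues every flag (a vertex with an ordered pair of edges) across its edge, such that the closed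
walks it traces are circuits. Cutting off the 5-cycle leaves an outer transition system with five
paths that join the ten sides of the spokes. Whether a way to reconnect these sides gives circuits
depends only on which sides are joined by the paths and on which pairs of paths are vertex-disjoint.
Up to exchanging the two sides of a spoke this leaves finitely many cases, and in each of them a
count of the completions `N` to `G` and `N a b` to `G_{a,b}` shows
`2 * ∑ i, N i (i + 1) + ∑ i, N i (i + 2) ≤ 4 * N`. Summing over the outer transition systems gives
the same inequality for the numbers of circuit double covers, and both bounds follow from it.

If `G` has a loop or the 5-cycle has a chord, then some vertex of one of the graphs `G_{i,i+1}` is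
incident with a single non-loop edge. That edge lies on no circuit, so this graph has no circuit
double cover.
-/

namespace CircuitDoubleCover

open Graph

/-- The equivalence relation generated by two maps on a type: for two involutions `σ` and `τ`, its
classes are the walks that apply `σ` and `τ` alternately. -/
def Linked {X : Type*} (σ τ : X → X) : X → X → Prop :=
  Relation.EqvGen fun x y => y = σ x ∨ y = τ x

namespace Linked

variable {X : Type*} {σ τ : X → X} {x y z : X}

theorem refl (x : X) : Linked σ τ x x := Relation.EqvGen.refl x

theorem symm (h : Linked σ τ x y) : Linked σ τ y x := Relation.EqvGen.symm _ _ h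

theorem trans (h : Linked σ τ x y) (h' : Linked σ τ y z) : Linked σ τ x z :=
  Relation.EqvGen.trans _ _ _ h h'

theorem equivalence : Equivalence (Linked σ τ) := ⟨refl, symm, trans⟩

theorem fst (x : X) : Linked σ τ x (σ x) := Relation.EqvGen.rel _ _ (Or.inl rfl)

theorem snd (x : X) : Linked σ τ x (τ x) := Relation.EqvGen.rel _ _ (Or.inr rfl)

theorem rel_of_equivalence {r : X → X → Prop} (hr : Equivalence r) (hσ : ∀ x, r x (σ x))
    (hτ : ∀ x, r x (τ x)) (h : Linked σ τ x y) : r x y := by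
  induction h with
  | rel a b h => rcases h with rfl | rfl; exacts [hσ a, hτ a]
  | refl a => exact hr.refl a
  | symm a b _ ih => exact hr.symm ih
  | trans a b c _ _ ih ih' => exact hr.trans ih ih'

theorem map_eq {K : Type*} (f : X → K) (hσ : ∀ x, f (σ x) = f x) (hτ : ∀ x, f (τ x) = f x)
    (h : Linked σ τ x y) : f x = f y :=
  rel_of_equivalence (r := fun a b => f a = f b) ⟨fun _ => rfl, Eq.symm, Eq.trans⟩
    (fun a => (hσ a).symm) (fun a => (hτ a).symm) h

end Linked

/-! ### Circuit double covers as transition systems -/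

variable {α β : Type*} {G : Graph α β}

/-- A flag of a multigraph: a vertex with an ordered pair of distinct incident edges. A walk
through `vtx` that enters along one of the two edges and leaves along the other is represented by
the flag and its `swap`. -/
@[ext] structure Flag (G : Graph α β) where
  vtx : α
  edge : β
  other : β
  inc_edge : G.Inc edge vtx
  inc_other : G.Inc other vtx
  edge_ne_other : edge ≠ other

namespace Flag

/-- The flag with its two edges exchanged. -/
def swap (φ : Flag G) : Flag G where
  vtx := φ.vtx
  edge := φ.other
  other := φ.edge
  inc_edge := φ.inc_other
  inc_other := φ.inc_edge
  edge_ne_other := φ.edge_ne_other.symm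

@[simp] theorem swap_edge (φ : Flag G) : φ.swap.edge = φ.other := rfl
@[simp] theorem swap_swap (φ : Flag G) : φ.swap.swap = φ := rfl

theorem swap_ne (φ : Flag G) : φ.swap ≠ φ := fun h =>
  φ.edge_ne_other (congrArg Flag.other h)

theorem finite (hV : G.vertexSet.Finite) (hE : G.edgeSet.Finite) : Finite (Flag G) := by
  have := hV.to_subtype
  have := hE.to_subtype
  refine Finite.of_injective (β := G.vertexSet × G.edgeSet × G.edgeSet)
    (fun φ => (⟨φ.vtx, φ.inc_edge.vertex_mem⟩, ⟨φ.edge, φ.inc_edge.edge_mem⟩,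
      ⟨φ.other, φ.inc_other.edge_mem⟩)) fun φ ψ h => ?_
  simp only [Prod.mk.injEq, Subtype.mk.injEq] at h
  exact Flag.ext h.1 h.2.1 h.2.2

theorem eq_or_eq_swap_of_mem_pair {φ ψ : Flag G} (hv : ψ.vtx = φ.vtx)
    (he : ψ.edge = φ.edge ∨ ψ.edge = φ.other) (ho : ψ.other = φ.edge ∨ ψ.other = φ.other) :
    ψ = φ ∨ ψ = φ.swap := by
  rcases he with he | he <;> rcases ho with ho | ho
  · exact absurd (he.trans ho.symm) ψ.edge_ne_other
  · exact Or.inl (Flag.ext hv he ho)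
  · exact Or.inr (Flag.ext hv he ho)
  · exact absurd (he.trans ho.symm) ψ.edge_ne_other

end Flag

/-- Every vertex is incident with exactly three edges, and no edge is a loop. -/
structure IsLooplessCubic (G : Graph α β) : Prop where
  not_isLoopAt : ∀ e x, ¬ G.IsLoopAt e x
  encard_incidenceSet : ∀ x ∈ G.vertexSet, (G.incidenceSet x).encard = 3

namespace IsLooplessCubic

theorem loopSet_eq_empty (hG : IsLooplessCubic G) {H : Graph α β} (hH : H ≤ G) (x : α) :
    H.loopSet x = ∅ :=
  Set.eq_empty_iff_forall_notMem.2 fun e he => hG.not_isLoopAt e x (IsLoopAt.mono hH he)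

theorem exists_ne_inc (hG : IsLooplessCubic G) {e : β} {x : α} (he : G.Inc e x) :
    ∃ f, f ≠ e ∧ G.Inc f x := by
  obtain ⟨a, ha, b, hb, hab⟩ := Set.one_lt_encard_iff_nontrivial.1
    (show 1 < (G.incidenceSet x).encard by rw [hG.encard_incidenceSet x he.vertex_mem]; decide)
  rcases eq_or_ne a e with rfl | hne
  · exact ⟨b, hab.symm, hb⟩
  · exact ⟨a, hne, ha⟩

theorem exists_third (hG : IsLooplessCubic G) (φ : Flag G) :
    ∃ g, g ≠ φ.edge ∧ g ≠ φ.other ∧ G.incidenceSet φ.vtx = {φ.edge, φ.other, g} := by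
  have hpair : {φ.edge, φ.other} ⊆ G.incidenceSet φ.vtx :=
    Set.insert_subset φ.inc_edge (Set.singleton_subset_iff.2 φ.inc_other)
  have hcard : (G.incidenceSet φ.vtx \ {φ.edge, φ.other}).encard = 1 := by
    have h := Set.encard_sdiff_add_encard_of_subset hpair
    rw [hG.encard_incidenceSet _ φ.inc_edge.vertex_mem, Set.encard_pair φ.edge_ne_other] at h
    exact WithTop.add_right_cancel (ENat.natCast_ne_top 2) (h.trans rfl)
  obtain ⟨g, hg⟩ := Set.encard_eq_one.1 hcard
  have hgm : g ∉ ({φ.edge, φ.other} : Set β) := (hg.symm.subset rfl).2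
  simp only [Set.mem_insert_iff, Set.mem_singleton_iff, not_or] at hgm
  refine ⟨g, hgm.1, hgm.2, ?_⟩
  rw [← Set.union_sdiff_cancel hpair, hg, Set.insert_union, Set.singleton_union]

end IsLooplessCubic

/-- A transition system: it continues every flag across its edge to a flag at the other end of
that edge. The walks it traces are the classes of `Linked σ Flag.swap`. -/
structure IsTransition (σ : Flag G → Flag G) : Prop where
  involutive : ∀ φ, σ (σ φ) = φ
  edge_eq : ∀ φ, (σ φ).edge = φ.edge
  vtx_ne : ∀ φ, (σ φ).vtx ≠ φ.vtx

/-- The closed walks traced by the transition system pass through every vertex at most once. -/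
def IsSimpleTransition (σ : Flag G → Flag G) : Prop :=
  ∀ φ ψ, Linked σ Flag.swap φ ψ → φ.vtx = ψ.vtx → ψ = φ ∨ ψ = φ.swap

/-- The transition systems whose closed walks are circuits. -/
def circuitTransitions (G : Graph α β) : Set (Flag G → Flag G) :=
  {σ | IsTransition σ ∧ IsSimpleTransition σ}

section TracedGraph

variable {σ : Flag G → Flag G}

theorem IsTransition.isLink (h : IsTransition σ) (φ : Flag G) :
    G.IsLink φ.edge φ.vtx (σ φ).vtx := by
  obtain ⟨y, hy⟩ := φ.inc_edge
  have hσ := (σ φ).inc_edge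
  rw [h.edge_eq] at hσ
  rcases hσ.eq_or_eq_of_isLink hy with heq | heq
  · exact absurd heq (h.vtx_ne φ)
  · rwa [heq]

/-- The subgraph traced by the closed walk through a flag. -/
def tracedGraph (h : IsTransition σ) (φ : Flag G) : Graph α β where
  vertexSet := {x | ∃ ψ, Linked σ Flag.swap φ ψ ∧ ψ.vtx = x}
  IsLink e x y := G.IsLink e x y ∧ ∃ ψ, Linked σ Flag.swap φ ψ ∧ ψ.edge = e
  isLink_symm := fun _ _ => ⟨fun _ _ hxy => ⟨hxy.1.symm, hxy.2⟩⟩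
  eq_or_eq_of_isLink_of_isLink := fun _ _ _ _ _ h h' => h.1.left_eq_or_eq h'.1
  left_mem_of_isLink := by
    rintro e x y ⟨hxy, ψ, hψ, rfl⟩
    rcases hxy.left_eq_or_eq (h.isLink ψ) with rfl | rfl
    · exact ⟨ψ, hψ, rfl⟩
    · exact ⟨σ ψ, hψ.trans (Linked.fst ψ), rfl⟩

variable (h : IsTransition σ) {φ ψ : Flag G}

theorem tracedGraph_le (φ : Flag G) : tracedGraph h φ ≤ G := by
  refine ⟨?_, fun _ _ _ hxy => hxy.1⟩
  rintro x ⟨ψ, -, rfl⟩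
  exact ψ.inc_edge.vertex_mem

theorem mem_edgeSet_tracedGraph {e : β} :
    e ∈ (tracedGraph h φ).edgeSet ↔ ∃ ψ, Linked σ Flag.swap φ ψ ∧ ψ.edge = e := by
  constructor
  · intro he
    obtain ⟨x, y, hxy⟩ := exists_isLink_of_mem_edgeSet he
    exact hxy.2
  · rintro ⟨ψ, hψ, rfl⟩
    exact IsLink.edge_mem (G := tracedGraph h φ) ⟨h.isLink ψ, ψ, hψ, rfl⟩

theorem tracedGraph_congr (hl : Linked σ Flag.swap φ ψ) : tracedGraph h φ = tracedGraph h ψ := by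
  have key : ∀ χ, Linked σ Flag.swap φ χ ↔ Linked σ Flag.swap ψ χ :=
    fun χ => ⟨hl.symm.trans, hl.trans⟩
  refine Graph.ext ?_ fun e x y => ?_
  · ext x
    simp [tracedGraph, key]
  · simp [tracedGraph, key]

theorem exists_flag_of_mem_tracedGraph {e : β} {x : α} (he : e ∈ (tracedGraph h φ).edgeSet)
    (hx : G.Inc e x) : ∃ ψ, Linked σ Flag.swap φ ψ ∧ ψ.vtx = x ∧ ψ.edge = e := by
  obtain ⟨ψ, hψ, rfl⟩ := (mem_edgeSet_tracedGraph h).1 he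
  rcases hx.eq_or_eq_of_isLink (h.isLink ψ) with rfl | rfl
  · exact ⟨ψ, hψ, rfl, rfl⟩
  · exact ⟨σ ψ, hψ.trans (Linked.fst ψ), rfl, h.edge_eq ψ⟩

theorem edge_mem_tracedGraph (hl : Linked σ Flag.swap φ ψ) :
    ψ.edge ∈ (tracedGraph h φ).edgeSet := (mem_edgeSet_tracedGraph h).2 ⟨ψ, hl, rfl⟩

theorem other_mem_tracedGraph (hl : Linked σ Flag.swap φ ψ) :
    ψ.other ∈ (tracedGraph h φ).edgeSet :=
  (mem_edgeSet_tracedGraph h).2 ⟨ψ.swap, hl.trans (Linked.snd ψ), rfl⟩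

theorem reflTransGen_adj_tracedGraph (hl : Linked σ Flag.swap φ ψ) :
    Relation.ReflTransGen (tracedGraph h φ).Adj φ.vtx ψ.vtx := by
  induction hl with
  | rel χ ψ hχ =>
    rcases hχ with rfl | rfl
    · exact .single ⟨χ.edge, h.isLink χ, χ, Linked.refl χ, rfl⟩
    · exact .refl
  | refl χ => exact .refl
  | symm χ ψ hχ ih =>
    have : Std.Symm (tracedGraph h χ).Adj := inferInstance
    rw [← tracedGraph_congr h hχ]
    exact Std.Symm.symm _ _ ih
  | trans χ ψ ω hχ _ ih ih' =>
    rw [← tracedGraph_congr h hχ] at ih'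
    exact ih.trans ih'

variable (hs : IsSimpleTransition σ)
include hs

theorem linked_of_mem_tracedGraph (he : ψ.edge ∈ (tracedGraph h φ).edgeSet)
    (ho : ψ.other ∈ (tracedGraph h φ).edgeSet) : Linked σ Flag.swap φ ψ := by
  obtain ⟨χ, hχ, hv, heq⟩ := exists_flag_of_mem_tracedGraph h he ψ.inc_edge
  obtain ⟨χ', hχ', hv', heq'⟩ := exists_flag_of_mem_tracedGraph h ho ψ.inc_other
  rcases hs χ χ' (hχ.symm.trans hχ') (hv.trans hv'.symm) with rfl | rfl
  · exact absurd (heq.symm.trans heq') ψ.edge_ne_other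
  · rwa [show ψ = χ from Flag.ext hv.symm heq.symm heq'.symm]

theorem incidenceSet_tracedGraph (hl : Linked σ Flag.swap φ ψ) :
    (tracedGraph h φ).incidenceSet ψ.vtx = {ψ.edge, ψ.other} := by
  ext e
  constructor
  · intro he
    obtain ⟨χ, hχ, hv, rfl⟩ := exists_flag_of_mem_tracedGraph h he.edge_mem
      (he.mono (tracedGraph_le h φ))
    rcases hs ψ χ (hl.symm.trans hχ) hv.symm with rfl | rfl <;> simp
  · rintro (rfl | rfl)
    · exact ((tracedGraph_le h φ).inc_congr (edge_mem_tracedGraph h hl)).2 ψ.inc_edge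
    · exact ((tracedGraph_le h φ).inc_congr (other_mem_tracedGraph h hl)).2 ψ.inc_other

theorem isCircuit_tracedGraph (hV : G.vertexSet.Finite) (hG : IsLooplessCubic G) (φ : Flag G) :
    (tracedGraph h φ).IsCircuit := by
  refine ⟨hV.subset (tracedGraph_le h φ).vertexSet_mono, ⟨⟨_, φ, Linked.refl φ, rfl⟩, ?_⟩, ?_⟩
  · rintro x ⟨χ, hχ, rfl⟩ y ⟨ψ, hψ, rfl⟩
    rw [tracedGraph_congr h hχ]
    exact reflTransGen_adj_tracedGraph h (hχ.symm.trans hψ)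
  · rintro x ⟨ψ, hψ, rfl⟩
    rw [degree, hG.loopSet_eq_empty (tracedGraph_le h φ), incidenceSet_tracedGraph h hs hψ,
      Set.encard_pair ψ.edge_ne_other, Set.encard_empty, add_zero]

theorem tracedGraph_ne (hv : φ.vtx = ψ.vtx) (he : ψ.edge = φ.edge) (ho : ψ.other ≠ φ.other) :
    tracedGraph h φ ≠ tracedGraph h ψ := by
  intro heq
  have hl : Linked σ Flag.swap φ ψ := by
    refine linked_of_mem_tracedGraph h hs ?_ ?_ <;> rw [heq]
    exacts [edge_mem_tracedGraph h (Linked.refl ψ), other_mem_tracedGraph h (Linked.refl ψ)]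
  rcases hs φ ψ hl hv with rfl | rfl
  · exact ho rfl
  · exact φ.edge_ne_other he.symm

end TracedGraph

section TracedCover

variable [Finite (Flag G)] {σ σ' : Flag G → Flag G}

/-- The set of subgraphs traced by the closed walks of a transition system. -/
noncomputable def tracedCover (h : IsTransition σ) : Finset (Graph α β) :=
  (Set.finite_range (tracedGraph h)).toFinset

theorem mem_tracedCover (h : IsTransition σ) {C : Graph α β} :
    C ∈ tracedCover h ↔ ∃ φ, tracedGraph h φ = C := by
  simp [tracedCover]

open Classical in
theorem filter_tracedCover_eq_pair (h : IsTransition σ) (φ ψ : Flag G) (hv : ψ.vtx = φ.vtx)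
    (he : ψ.edge = φ.edge) (hi : G.incidenceSet φ.vtx = {φ.edge, φ.other, ψ.other}) :
    (tracedCover h).filter (fun C => φ.edge ∈ C.edgeSet) = {tracedGraph h φ, tracedGraph h ψ} := by
  ext C
  simp only [Finset.mem_filter, mem_tracedCover, Finset.mem_insert, Finset.mem_singleton]
  constructor
  · rintro ⟨⟨χ, rfl⟩, hχ⟩
    obtain ⟨χ', hl, hv', he'⟩ := exists_flag_of_mem_tracedGraph h hχ φ.inc_edge
    rw [tracedGraph_congr h hl]
    have ho : χ'.other ∈ G.incidenceSet φ.vtx := hv' ▸ χ'.inc_other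
    rw [hi] at ho
    rcases ho with ho | ho | ho
    · exact absurd (he'.trans ho.symm) χ'.edge_ne_other
    · exact Or.inl (congrArg _ (Flag.ext hv' he' ho))
    · exact Or.inr (congrArg _ (Flag.ext (hv'.trans hv.symm) (he'.trans he.symm) ho))
  · rintro (rfl | rfl)
    · exact ⟨⟨_, rfl⟩, edge_mem_tracedGraph h (Linked.refl φ)⟩
    · exact ⟨⟨_, rfl⟩, he ▸ edge_mem_tracedGraph h (Linked.refl ψ)⟩

theorem isCircuitDoubleCover_tracedCover (hV : G.vertexSet.Finite) (hG : IsLooplessCubic G)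
    (h : IsTransition σ) (hs : IsSimpleTransition σ) :
    G.IsCircuitDoubleCover (tracedCover h).val := by
  classical
  refine ⟨fun C hC => ?_, fun e he => ?_⟩
  · obtain ⟨φ, rfl⟩ := (mem_tracedCover h).1 hC
    exact ⟨tracedGraph_le h φ, isCircuit_tracedGraph h hs hV hG φ⟩
  · obtain ⟨x, y, hxy⟩ := exists_isLink_of_mem_edgeSet he
    obtain ⟨f, hfe, hf⟩ := hG.exists_ne_inc hxy.inc_left
    let φ : Flag G := ⟨x, e, f, hxy.inc_left, hf, hfe.symm⟩
    obtain ⟨g, hge, hgf, hi⟩ := hG.exists_third φ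
    have hg : G.Inc g x := show g ∈ G.incidenceSet φ.vtx by simp [hi]
    let ψ : Flag G := ⟨x, e, g, hxy.inc_left, hg, hge.symm⟩
    rw [Multiset.countP_eq_card_filter, ← Finset.filter_val, Finset.card_val]
    convert Finset.card_pair (tracedGraph_ne h hs (φ := φ) (ψ := ψ) rfl rfl hgf)
    exact filter_tracedCover_eq_pair h φ ψ rfl rfl hi

theorem eq_of_tracedCover_eq (h : IsTransition σ) (h' : IsTransition σ')
    (hs' : IsSimpleTransition σ') (heq : tracedCover h = tracedCover h') : σ = σ' := by
  funext φ
  obtain ⟨χ, hχ⟩ : ∃ χ, tracedGraph h' χ = tracedGraph h φ := by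
    rw [← mem_tracedCover, ← heq, mem_tracedCover]
    exact ⟨φ, rfl⟩
  have transfer : ∀ {ψ}, Linked σ Flag.swap φ ψ → Linked σ' Flag.swap χ ψ := fun hl => by
    refine linked_of_mem_tracedGraph h' hs' ?_ ?_ <;> rw [hχ]
    exacts [edge_mem_tracedGraph h hl, other_mem_tracedGraph h hl]
  have hl : Linked σ' Flag.swap (σ φ) (σ' φ) :=
    (transfer (Linked.fst φ)).symm.trans ((transfer (Linked.refl φ)).trans (Linked.fst φ))
  have hv : (σ φ).vtx = (σ' φ).vtx := (h.isLink φ).right_unique (h'.isLink φ)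
  rcases hs' _ _ hl hv with heq | heq
  · exact heq.symm
  · have he := congrArg Flag.edge heq
    rw [h'.edge_eq, Flag.swap_edge] at he
    exact absurd ((h.edge_eq φ).trans he) (σ φ).edge_ne_other

end TracedCover

section CircuitInCubic

variable {C : Graph α β} {φ : Flag G}

theorem exists_incidenceSet_eq_pair (hG : IsLooplessCubic G) (hle : C ≤ G) (hC : C.IsCircuit)
    {x : α} (hx : x ∈ C.vertexSet) : ∃ a b, a ≠ b ∧ C.incidenceSet x = {a, b} := by
  have hd := hC.2.2 x hx
  rw [degree, hG.loopSet_eq_empty hle, Set.encard_empty, add_zero] at hd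
  exact Set.encard_eq_two.1 hd

theorem incidenceSet_eq_pair (hG : IsLooplessCubic G) (hle : C ≤ G) (hC : C.IsCircuit)
    (he : φ.edge ∈ C.edgeSet) (ho : φ.other ∈ C.edgeSet) :
    C.incidenceSet φ.vtx = {φ.edge, φ.other} := by
  have hie : C.Inc φ.edge φ.vtx := (hle.inc_congr he).2 φ.inc_edge
  have hio : C.Inc φ.other φ.vtx := (hle.inc_congr ho).2 φ.inc_other
  obtain ⟨a, b, -, hi⟩ := exists_incidenceSet_eq_pair hG hle hC hie.vertex_mem
  rw [← mem_incidenceSet, hi] at hie hio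
  rw [hi]
  rcases hie with hie | hie <;> rcases hio with hio | hio
  · exact absurd (hie.trans hio.symm) φ.edge_ne_other
  · rw [hie, hio]
  · rw [hie, hio, Set.pair_comm]
  · exact absurd (hie.trans hio.symm) φ.edge_ne_other

theorem exists_ne_inc_of_isCircuit (hG : IsLooplessCubic G) (hle : C ≤ G) (hC : C.IsCircuit)
    {e : β} {x : α} (he : C.Inc e x) : ∃ f, f ≠ e ∧ C.Inc f x := by
  obtain ⟨a, b, hab, hi⟩ := exists_incidenceSet_eq_pair hG hle hC he.vertex_mem
  have hmem : ∀ f, C.Inc f x ↔ f ∈ ({a, b} : Set β) := fun f => by rw [← mem_incidenceSet, hi]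
  rcases eq_or_ne a e with rfl | hne
  · exact ⟨b, hab.symm, (hmem b).2 (Or.inr rfl)⟩
  · exact ⟨a, hne, (hmem a).2 (Or.inl rfl)⟩

theorem other_notMem_iff (hG : IsLooplessCubic G) (hle : C ≤ G) (hC : C.IsCircuit) {g : β}
    (hge : g ≠ φ.edge) (hgo : g ≠ φ.other) (hi : G.incidenceSet φ.vtx = {φ.edge, φ.other, g})
    (he : φ.edge ∈ C.edgeSet) : φ.other ∉ C.edgeSet ↔ g ∈ C.edgeSet := by
  constructor
  · intro ho
    obtain ⟨f, hfe, hf⟩ := exists_ne_inc_of_isCircuit hG hle hC ((hle.inc_congr he).2 φ.inc_edge)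
    have hfi : f ∈ G.incidenceSet φ.vtx := hf.mono hle
    rw [hi] at hfi
    rcases hfi with rfl | rfl | rfl
    exacts [absurd rfl hfe, absurd hf.edge_mem ho, hf.edge_mem]
  · intro hg ho
    have hgG : g ∈ G.incidenceSet φ.vtx := by simp [hi]
    have hgi : g ∈ C.incidenceSet φ.vtx := (hle.inc_congr hg).2 hgG
    rw [incidenceSet_eq_pair hG hle hC he ho] at hgi
    rcases hgi with h | h
    exacts [hge h, hgo h]

end CircuitInCubic

section ExistsTransition

variable {𝒞 : Multiset (Graph α β)}

open Classical in
theorem countP_and_add_countP_and (h𝒞 : G.IsCircuitDoubleCover 𝒞) {a b c : β} (ha : a ∈ G.edgeSet)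
    (hbc : ∀ C ∈ 𝒞, a ∈ C.edgeSet → (b ∉ C.edgeSet ↔ c ∈ C.edgeSet)) :
    𝒞.countP (fun C => a ∈ C.edgeSet ∧ b ∈ C.edgeSet) +
      𝒞.countP (fun C => a ∈ C.edgeSet ∧ c ∈ C.edgeSet) = 2 := by
  rw [← h𝒞.2 a ha, Multiset.countP_eq_countP_filter_add 𝒞 (fun C => a ∈ C.edgeSet)
    (fun C => b ∈ C.edgeSet), Multiset.countP_filter, Multiset.countP_filter]
  congr 1
  exact Multiset.countP_congr rfl fun C hC => propext (and_congr_right fun h => (hbc C hC h).symm)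

open Classical in
/-- If `x`, `y`, `z` count the members through the three pairs of edges at a vertex, then double
covering says `x + y = x + z = y + z = 2`. -/
theorem countP_mem_edge_and_mem_other (hG : IsLooplessCubic G) (h𝒞 : G.IsCircuitDoubleCover 𝒞)
    (φ : Flag G) : 𝒞.countP (fun C => φ.edge ∈ C.edgeSet ∧ φ.other ∈ C.edgeSet) = 1 := by
  obtain ⟨g, hge, hgo, hi⟩ := hG.exists_third φ
  have hg : G.Inc g φ.vtx := show g ∈ G.incidenceSet φ.vtx by simp [hi]
  let ψ : Flag G := ⟨φ.vtx, g, φ.edge, hg, φ.inc_edge, hge⟩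
  have hswap : G.incidenceSet φ.vtx = {φ.other, φ.edge, g} := by rw [hi, Set.insert_comm]
  have hψ : G.incidenceSet φ.vtx = {g, φ.edge, φ.other} := by
    rw [hi, Set.pair_comm φ.other g, Set.insert_comm]
  have hcomm : ∀ a b : β, 𝒞.countP (fun C => a ∈ C.edgeSet ∧ b ∈ C.edgeSet) =
      𝒞.countP (fun C => b ∈ C.edgeSet ∧ a ∈ C.edgeSet) :=
    fun a b => Multiset.countP_congr rfl fun C _ => propext and_comm
  have hedge := countP_and_add_countP_and h𝒞 φ.inc_edge.edge_mem fun C hC =>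
    other_notMem_iff hG (h𝒞.1 C hC).1 (h𝒞.1 C hC).2 hge hgo hi
  have hother := countP_and_add_countP_and h𝒞 (b := φ.edge) φ.inc_other.edge_mem fun C hC =>
    other_notMem_iff (φ := φ.swap) hG (h𝒞.1 C hC).1 (h𝒞.1 C hC).2 hgo hge hswap
  have hthird := countP_and_add_countP_and h𝒞 (b := φ.edge) hg.edge_mem fun C hC =>
    other_notMem_iff (φ := ψ) hG (h𝒞.1 C hC).1 (h𝒞.1 C hC).2 hgo.symm φ.edge_ne_other.symm hψ
  have hcomm_edge := hcomm φ.edge g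
  have hcomm_other := hcomm φ.other g
  have hcomm_pair := hcomm φ.edge φ.other
  omega

theorem existsUnique_mem_cover (hG : IsLooplessCubic G) (h𝒞 : G.IsCircuitDoubleCover 𝒞)
    (φ : Flag G) : ∃! C, C ∈ 𝒞 ∧ φ.edge ∈ C.edgeSet ∧ φ.other ∈ C.edgeSet := by
  classical
  have hcard := countP_mem_edge_and_mem_other hG h𝒞 φ
  rw [Multiset.countP_eq_card_filter, Multiset.card_eq_one] at hcard
  obtain ⟨C, hC⟩ := hcard
  have hmem : ∀ C', C' ∈ 𝒞 ∧ φ.edge ∈ C'.edgeSet ∧ φ.other ∈ C'.edgeSet ↔ C' = C := fun C' => by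
    rw [← Multiset.mem_singleton, ← hC, Multiset.mem_filter]
  exact ⟨C, (hmem C).2 rfl, fun C' => (hmem C').1⟩

/-- The member of a circuit double cover that contains both edges of a flag. -/
noncomputable def coverMember (hG : IsLooplessCubic G) (h𝒞 : G.IsCircuitDoubleCover 𝒞)
    (φ : Flag G) : Graph α β :=
  (existsUnique_mem_cover hG h𝒞 φ).choose

variable (hG : IsLooplessCubic G) (h𝒞 : G.IsCircuitDoubleCover 𝒞)

theorem coverMember_mem (φ : Flag G) : coverMember hG h𝒞 φ ∈ 𝒞 :=
  (existsUnique_mem_cover hG h𝒞 φ).choose_spec.1.1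

theorem coverMember_le (φ : Flag G) : coverMember hG h𝒞 φ ≤ G :=
  (h𝒞.1 _ (coverMember_mem hG h𝒞 φ)).1

theorem isCircuit_coverMember (φ : Flag G) : (coverMember hG h𝒞 φ).IsCircuit :=
  (h𝒞.1 _ (coverMember_mem hG h𝒞 φ)).2

theorem edge_mem_coverMember (φ : Flag G) : φ.edge ∈ (coverMember hG h𝒞 φ).edgeSet :=
  (existsUnique_mem_cover hG h𝒞 φ).choose_spec.1.2.1

theorem other_mem_coverMember (φ : Flag G) : φ.other ∈ (coverMember hG h𝒞 φ).edgeSet :=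
  (existsUnique_mem_cover hG h𝒞 φ).choose_spec.1.2.2

theorem coverMember_eq {φ : Flag G} {C : Graph α β} (hC : C ∈ 𝒞) (he : φ.edge ∈ C.edgeSet)
    (ho : φ.other ∈ C.edgeSet) : coverMember hG h𝒞 φ = C :=
  (existsUnique_mem_cover hG h𝒞 φ).unique (existsUnique_mem_cover hG h𝒞 φ).choose_spec.1
    ⟨hC, he, ho⟩

theorem coverMember_swap (φ : Flag G) : coverMember hG h𝒞 φ.swap = coverMember hG h𝒞 φ :=
  coverMember_eq hG h𝒞 (coverMember_mem hG h𝒞 φ) (other_mem_coverMember hG h𝒞 φ)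
    (edge_mem_coverMember hG h𝒞 φ)

theorem incidenceSet_coverMember (φ : Flag G) :
    (coverMember hG h𝒞 φ).incidenceSet φ.vtx = {φ.edge, φ.other} :=
  incidenceSet_eq_pair hG (coverMember_le hG h𝒞 φ) (isCircuit_coverMember hG h𝒞 φ)
    (edge_mem_coverMember hG h𝒞 φ) (other_mem_coverMember hG h𝒞 φ)

theorem vtx_mem_coverMember (φ : Flag G) : φ.vtx ∈ (coverMember hG h𝒞 φ).vertexSet :=
  (((coverMember_le hG h𝒞 φ).inc_congr (edge_mem_coverMember hG h𝒞 φ)).2 φ.inc_edge).vertex_mem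

theorem eq_or_eq_swap_of_coverMember_eq {φ ψ : Flag G}
    (h : coverMember hG h𝒞 φ = coverMember hG h𝒞 ψ) (hv : φ.vtx = ψ.vtx) :
    ψ = φ ∨ ψ = φ.swap := by
  have hpair : ({ψ.edge, ψ.other} : Set β) = {φ.edge, φ.other} := by
    rw [← incidenceSet_coverMember hG h𝒞 φ, h, hv, incidenceSet_coverMember]
  exact Flag.eq_or_eq_swap_of_mem_pair hv.symm (hpair.subset (Or.inl rfl))
    (hpair.subset (Or.inr rfl))

theorem exists_flag_coverMember_eq {C : Graph α β} (hC : C ∈ 𝒞) :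
    ∃ φ, coverMember hG h𝒞 φ = C := by
  have hle := (h𝒞.1 C hC).1
  obtain ⟨x, hx⟩ := (h𝒞.1 C hC).2.2.1.1
  obtain ⟨a, b, hab, hi⟩ := exists_incidenceSet_eq_pair hG hle (h𝒞.1 C hC).2 hx
  have ha : C.Inc a x := hi.symm.subset (Or.inl rfl)
  have hb : C.Inc b x := hi.symm.subset (Or.inr rfl)
  exact ⟨⟨x, a, b, ha.mono hle, hb.mono hle, hab⟩,
    coverMember_eq hG h𝒞 hC ha.edge_mem hb.edge_mem⟩

include hG h𝒞 in
theorem nodup_of_isCircuitDoubleCover : 𝒞.Nodup := by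
  classical
  rw [Multiset.nodup_iff_count_le_one]
  intro C
  by_cases hC : C ∈ 𝒞
  · obtain ⟨φ, rfl⟩ := exists_flag_coverMember_eq hG h𝒞 hC
    rw [← countP_mem_edge_and_mem_other hG h𝒞 φ, Multiset.count, Multiset.countP_eq_card_filter,
      Multiset.countP_eq_card_filter]
    refine Multiset.card_le_card (Multiset.monotone_filter_right _ ?_)
    rintro C' rfl
    exact ⟨edge_mem_coverMember hG h𝒞 φ, other_mem_coverMember hG h𝒞 φ⟩
  · rw [Multiset.count_eq_zero_of_notMem hC]
    exact Nat.zero_le 1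

theorem exists_next_flag (φ : Flag G) : ∃ ψ : Flag G, ψ.vtx ≠ φ.vtx ∧ ψ.edge = φ.edge ∧
    coverMember hG h𝒞 ψ = coverMember hG h𝒞 φ := by
  have hle := coverMember_le hG h𝒞 φ
  have he := edge_mem_coverMember hG h𝒞 φ
  obtain ⟨y, hy⟩ := φ.inc_edge
  have hyx : y ≠ φ.vtx := by
    rintro rfl
    exact hG.not_isLoopAt _ _ hy
  obtain ⟨f, hfe, hf⟩ := exists_ne_inc_of_isCircuit hG hle (isCircuit_coverMember hG h𝒞 φ)
    ((hle.inc_congr he).2 hy.inc_right)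
  exact ⟨⟨y, φ.edge, f, hy.inc_right, hf.mono hle, hfe.symm⟩, hyx, rfl,
    coverMember_eq hG h𝒞 (coverMember_mem hG h𝒞 φ) he hf.edge_mem⟩

variable {σ : Flag G → Flag G}

theorem isTransition_of_coverMember_eq (hv : ∀ φ, (σ φ).vtx ≠ φ.vtx)
    (he : ∀ φ, (σ φ).edge = φ.edge)
    (hσ : ∀ φ, coverMember hG h𝒞 (σ φ) = coverMember hG h𝒞 φ) : IsTransition σ := by
  refine ⟨fun φ => ?_, he, hv⟩
  have hvv : φ.vtx = (σ (σ φ)).vtx := by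
    obtain ⟨y, hy⟩ := φ.inc_edge
    have hinc : G.Inc φ.edge (σ φ).vtx := he φ ▸ (σ φ).inc_edge
    have hinc' : G.Inc φ.edge (σ (σ φ)).vtx := he φ ▸ he (σ φ) ▸ (σ (σ φ)).inc_edge
    rcases hinc'.eq_or_eq_of_isLink hy with h | h
    · exact h.symm
    · exact absurd (h.trans (hinc.eq_of_isLink_of_ne_left hy (hv φ)).symm) (hv (σ φ))
  rcases eq_or_eq_swap_of_coverMember_eq hG h𝒞 ((hσ (σ φ)).trans (hσ φ)).symm hvv with h | h
  · exact h
  · have hedge := congrArg Flag.edge h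
    rw [he, he] at hedge
    exact absurd hedge φ.edge_ne_other

variable (hσ : ∀ φ, coverMember hG h𝒞 (σ φ) = coverMember hG h𝒞 φ)
include hσ

theorem coverMember_eq_of_linked {φ ψ : Flag G} (hl : Linked σ Flag.swap φ ψ) :
    coverMember hG h𝒞 φ = coverMember hG h𝒞 ψ :=
  Linked.map_eq _ hσ (coverMember_swap hG h𝒞) hl

theorem exists_linked_edge_eq {φ ψ : Flag G} (hl : Linked σ Flag.swap φ ψ) {e : β}
    (he : (coverMember hG h𝒞 φ).Inc e ψ.vtx) :
    ∃ χ, Linked σ Flag.swap φ χ ∧ χ.vtx = ψ.vtx ∧ χ.edge = e := by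
  rw [coverMember_eq_of_linked hG h𝒞 hσ hl, ← mem_incidenceSet, incidenceSet_coverMember] at he
  rcases he with rfl | rfl
  · exact ⟨ψ, hl, rfl, rfl⟩
  · exact ⟨ψ.swap, hl.trans (Linked.snd ψ), rfl, rfl⟩

theorem exists_linked_vtx_eq (hT : IsTransition σ) (φ : Flag G) {y : α}
    (hy : y ∈ (coverMember hG h𝒞 φ).vertexSet) : ∃ ψ, Linked σ Flag.swap φ ψ ∧ ψ.vtx = y := by
  have hreach := (isCircuit_coverMember hG h𝒞 φ).2.1.2 _ (vtx_mem_coverMember hG h𝒞 φ) _ hy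
  clear hy
  induction hreach with
  | refl => exact ⟨φ, Linked.refl φ, rfl⟩
  | @tail x y _ hxy ih =>
    obtain ⟨ψ, hψ, rfl⟩ := ih
    obtain ⟨e, he⟩ := hxy
    obtain ⟨χ, hχ, hv, rfl⟩ := exists_linked_edge_eq hG h𝒞 hσ hψ he.inc_left
    refine ⟨σ χ, hχ.trans (Linked.fst χ), ?_⟩
    exact (hv ▸ hT.isLink χ).right_unique (he.mono (coverMember_le hG h𝒞 φ))

theorem tracedGraph_eq_coverMember (hT : IsTransition σ) (φ : Flag G) :
    tracedGraph hT φ = coverMember hG h𝒞 φ := by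
  refine Compatible.ext ?_ ?_
    (Compatible.of_le_le (tracedGraph_le hT φ) (coverMember_le hG h𝒞 φ))
  · ext y
    refine ⟨?_, exists_linked_vtx_eq hG h𝒞 hσ hT φ⟩
    rintro ⟨ψ, hψ, rfl⟩
    rw [coverMember_eq_of_linked hG h𝒞 hσ hψ]
    exact vtx_mem_coverMember hG h𝒞 ψ
  · ext e
    rw [mem_edgeSet_tracedGraph]
    constructor
    · rintro ⟨ψ, hψ, rfl⟩
      rw [coverMember_eq_of_linked hG h𝒞 hσ hψ]
      exact edge_mem_coverMember hG h𝒞 ψ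
    · intro he
      obtain ⟨x, y, hxy⟩ := exists_isLink_of_mem_edgeSet he
      obtain ⟨ψ, hψ, rfl⟩ := exists_linked_vtx_eq hG h𝒞 hσ hT φ hxy.left_mem
      obtain ⟨χ, hχ, -, rfl⟩ := exists_linked_edge_eq hG h𝒞 hσ hψ hxy.inc_left
      exact ⟨χ, hχ, rfl⟩

end ExistsTransition

theorem exists_tracedCover_eq [Finite (Flag G)] (hG : IsLooplessCubic G)
    {𝒞 : Multiset (Graph α β)} (h𝒞 : G.IsCircuitDoubleCover 𝒞) :
    ∃ (σ : Flag G → Flag G) (h : IsTransition σ), IsSimpleTransition σ ∧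
      (tracedCover h).val = 𝒞 := by
  choose σ hv he hσ using exists_next_flag hG h𝒞
  have hT := isTransition_of_coverMember_eq hG h𝒞 hv he hσ
  refine ⟨σ, hT, fun φ ψ hl => eq_or_eq_swap_of_coverMember_eq hG h𝒞
    (coverMember_eq_of_linked hG h𝒞 hσ hl), ?_⟩
  refine (Multiset.Nodup.ext (Finset.nodup _) (nodup_of_isCircuitDoubleCover hG h𝒞)).2 fun C => ?_
  simp only [Finset.mem_val, mem_tracedCover, tracedGraph_eq_coverMember hG h𝒞 hσ hT]
  refine ⟨?_, exists_flag_coverMember_eq hG h𝒞⟩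
  rintro ⟨φ, rfl⟩
  exact coverMember_mem hG h𝒞 φ

theorem IsLooplessCubic.numCircuitDoubleCovers_eq (hV : G.vertexSet.Finite)
    (hE : G.edgeSet.Finite) (hG : IsLooplessCubic G) :
    G.numCircuitDoubleCovers = (circuitTransitions G).ncard := by
  have := Flag.finite hV hE
  symm
  refine Set.ncard_congr (fun σ hσ => (tracedCover hσ.1).val) ?_ ?_ ?_
  · exact fun σ hσ => isCircuitDoubleCover_tracedCover hV hG hσ.1 hσ.2
  · exact fun σ σ' hσ hσ' h => eq_of_tracedCover_eq hσ.1 hσ'.1 hσ'.2 (Finset.val_inj.1 h)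
  · intro 𝒞 h𝒞
    obtain ⟨σ, h, hs, heq⟩ := exists_tracedCover_eq hG h𝒞
    exact ⟨σ, ⟨h, hs⟩, heq⟩

/-- A circuit through `f` would have odd degree at `x`. -/
theorem numCircuitDoubleCovers_eq_zero_of_isNonloopAt {f : β} {x : α} (hf : G.IsNonloopAt f x)
    (hi : ∀ e, G.Inc e x → e = f ∨ G.IsLoopAt e x) : G.numCircuitDoubleCovers = 0 := by
  classical
  suffices h : {𝒞 : Multiset (Graph α β) | G.IsCircuitDoubleCover 𝒞} = ∅ by
    rw [numCircuitDoubleCovers, h, Set.ncard_empty]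
  refine Set.eq_empty_iff_forall_notMem.2 fun 𝒞 h𝒞 => ?_
  have hpos : 0 < 𝒞.countP (fun C => f ∈ C.edgeSet) := by rw [h𝒞.2 f hf.edge_mem]; norm_num
  obtain ⟨C, hC, hfC⟩ := Multiset.countP_pos.1 hpos
  have hle := (h𝒞.1 C hC).1
  have hfx : C.Inc f x := (hle.inc_congr hfC).2 hf.inc
  have hd := (h𝒞.1 C hC).2.2.2 x hfx.vertex_mem
  have hinc : C.incidenceSet x = insert f (C.loopSet x) := by
    ext e
    constructor
    · intro he
      rcases hi e (Inc.mono hle he) with h | h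
      · exact Or.inl h
      · exact Or.inr ((hle.isLoopAt_congr (Inc.edge_mem he)).2 h)
    · rintro (rfl | h)
      · exact hfx
      · exact IsLoopAt.inc h
  have hfl : f ∉ C.loopSet x := fun h => hf.not_isLoopAt x (IsLoopAt.mono hle h)
  rw [degree, hinc, Set.encard_insert_of_notMem hfl] at hd
  generalize (C.loopSet x).encard = L at hd
  cases L with
  | top => exact absurd hd (by simp)
  | coe n =>
    norm_cast at hd
    omega

/-! ### Two involutions -/

section Involutions

open Function

variable {X : Type*} {σ τ : X → X} {f : X}

theorem linked_iterate_comp (f : X) (n : ℕ) : Linked σ τ f ((σ ∘ τ)^[n] f) := by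
  induction n with
  | zero => exact Linked.refl f
  | succ n ih =>
    rw [iterate_succ_apply']
    exact ih.trans ((Linked.snd _).trans (Linked.fst _))

variable (hσ : Involutive σ) (hτ : Involutive τ)
include hσ hτ

theorem iterate_comp_apply_iterate_comp (n : ℕ) (x : X) :
    (σ ∘ τ)^[n] (σ ((σ ∘ τ)^[n] x)) = σ x := by
  induction n generalizing x with
  | zero => rfl
  | succ n ih =>
    have hcancel : (σ ∘ τ) (σ ((σ ∘ τ) ((σ ∘ τ)^[n] x))) = σ ((σ ∘ τ)^[n] x) := by
      simp only [comp_apply, hσ _, hτ _]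
    rw [iterate_succ_apply, iterate_succ_apply' _ n x, hcancel, ih]

variable (hf : σ f = f)
include hf

theorem apply_iterate_comp_eq_iff (n m : ℕ) :
    σ ((σ ∘ τ)^[n] f) = (σ ∘ τ)^[m] f ↔ minimalPeriod (σ ∘ τ) f ∣ n + m := by
  have hinj : Injective (σ ∘ τ) := hσ.injective.comp hτ.injective
  rw [← (hinj.iterate n).eq_iff, iterate_comp_apply_iterate_comp hσ hτ, hf, ← iterate_add_apply,
    ← isPeriodicPt_iff_minimalPeriod_dvd, IsPeriodicPt, IsFixedPt, eq_comm]

variable [Finite X]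

theorem exists_eq_iterate_comp_of_linked {g : X} (hg : Linked σ τ f g) :
    ∃ n, g = (σ ∘ τ)^[n] f := by
  have hpos : 0 < minimalPeriod (σ ∘ τ) f := minimalPeriod_pos_of_mem_periodicPts
    ((hσ.injective.comp hτ.injective).mem_periodicPts f)
  have hσ_mem : ∀ x, (∃ n, x = (σ ∘ τ)^[n] f) → ∃ n, σ x = (σ ∘ τ)^[n] f := by
    rintro _ ⟨n, rfl⟩
    refine ⟨minimalPeriod (σ ∘ τ) f * n - n, (apply_iterate_comp_eq_iff hσ hτ hf _ _).2 ?_⟩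
    rw [Nat.add_sub_cancel' (Nat.le_mul_of_pos_left n hpos)]
    exact dvd_mul_right _ n
  have hτ_mem : ∀ x, (∃ n, x = (σ ∘ τ)^[n] f) → ∃ n, τ x = (σ ∘ τ)^[n] f := by
    rintro _ ⟨n, rfl⟩
    obtain ⟨m, hm⟩ := hσ_mem _ ⟨n + 1, rfl⟩
    exact ⟨m, by rw [← hm, iterate_succ_apply', comp_apply, hσ]⟩
  refine (Linked.rel_of_equivalence
    (r := fun x y => (∃ n, x = (σ ∘ τ)^[n] f) ↔ ∃ n, y = (σ ∘ τ)^[n] f)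
    ⟨fun _ => Iff.rfl, Iff.symm, Iff.trans⟩ (fun x => ⟨hσ_mem x, fun hx => ?_⟩)
    (fun x => ⟨hτ_mem x, fun hx => ?_⟩) hg).1 ⟨0, rfl⟩
  · exact hσ x ▸ hσ_mem _ hx
  · exact hτ x ▸ hτ_mem _ hx

/-- The walk that starts at `f` is the orbit of `f` under `σ ∘ τ`, and `σ` reflects this orbit. An
odd period would yield a fixed point of `τ`; an even period `2 * k` leaves exactly `f` and
`(σ ∘ τ)^[k] f` fixed by `σ`. -/
theorem exists_unique_other_fixedPoint (hτ_ne : ∀ x, τ x ≠ x) :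
    ∃ g, g ≠ f ∧ σ g = g ∧ Linked σ τ f g ∧ ∀ h, Linked σ τ f h → σ h = h → h = f ∨ h = g := by
  have hfix := apply_iterate_comp_eq_iff hσ hτ hf
  have hpos : 0 < minimalPeriod (σ ∘ τ) f := minimalPeriod_pos_of_mem_periodicPts
    ((hσ.injective.comp hτ.injective).mem_periodicPts f)
  obtain ⟨k, hk | hk⟩ := Nat.even_or_odd' (minimalPeriod (σ ∘ τ) f)
  · refine ⟨(σ ∘ τ)^[k] f, fun h => ?_, (hfix k k).2 (by rw [hk, two_mul]),
      linked_iterate_comp f k, fun h hl hσh => ?_⟩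
    · have hle := (show IsPeriodicPt (σ ∘ τ) k f from h).minimalPeriod_le (by omega)
      omega
    · obtain ⟨n, rfl⟩ := exists_eq_iterate_comp_of_linked hσ hτ hf hl
      have hdvd : k ∣ n := by
        rw [hfix, hk, ← two_mul] at hσh
        exact Nat.dvd_of_mul_dvd_mul_left two_pos hσh
      obtain ⟨c, rfl⟩ := hdvd
      obtain ⟨d, rfl | rfl⟩ := Nat.even_or_odd' c
      · left
        rw [← mul_assoc, mul_comm k 2, ← hk]
        exact (isPeriodicPt_minimalPeriod _ f).mul_const d
      · right
        rw [show k * (2 * d + 1) = k + 2 * k * d by ring, ← hk, iterate_add_apply,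
          (isPeriodicPt_minimalPeriod _ f).mul_const d]
  · have hcomp := (hfix (k + 1) k).2 ⟨1, by omega⟩
    rw [iterate_succ_apply', comp_apply, hσ] at hcomp
    exact absurd hcomp (hτ_ne _)

end Involutions

/-! ### Finite combinatorics of the five spokes -/

/-- The ways to split the list `l` into pairs `(x, y)` with `r x y`; the number `n` bounds the
number of pairs and makes the recursion structural. -/
def perfectMatchings {T : Type*} [BEq T] (r : T → T → Bool) : ℕ → List T → List (List (T × T))
  | 0, _ => [[]]
  | _ + 1, [] => [[]]
  | n + 1, x :: xs =>
    (xs.filter (r x)).flatMap fun y => (perfectMatchings r n (xs.erase y)).map ((x, y) :: ·)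

/-- Gives the entries `l.1` and `l.2` of a list of labels the same label. -/
def mergeLabels (labels : List ℕ) (l : ℕ × ℕ) : List ℕ :=
  labels.map fun z => bif z.beq (labels.getD l.1 0) then labels.getD l.2 0 else z

/-- Labels of the connected components of the graph on `0, …, n - 1` with the given edges. -/
def componentLabels (n : ℕ) (links : List (ℕ × ℕ)) : List ℕ :=
  links.foldl mergeLabels (List.range n)

/-- The subset of `l` on which `f` holds, encoded by the bits of a number. -/
def bitmask {T : Type*} (l : List T) (f : T → Bool) : ℕ :=
  l.foldr (fun x m => Nat.bit (f x) m) 0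

/-- The encodings of all subsets of `l` on which `p` holds. -/
def bitmasksBelow {T : Type*} (l : List T) (p : T → Bool) : List ℕ :=
  l.foldr (fun x ms => ms.flatMap fun m => bif p x then [2 * m, 2 * m + 1] else [2 * m]) [0]

/-- The two sides of each of the five spokes. -/
abbrev Side := Fin 5 × Bool

/-- The list of all sides. -/
def sides : List Side := (List.finRange 5).flatMap fun i => [(i, false), (i, true)]

/-- Exchanges the two sides of every spoke `i` such that the bit `i` of `f` is set. -/
def flipSide (f : ℕ) (s : Side) : Side := (s.1, s.2 ^^ f.testBit s.1)

/-- The path that ends at a given side, where path `i` is the one that ends at `(i, true)`, and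
`(i, false)` is the other end of path `ρ i`. -/
def pathAt (ρ : Fin 5 → Fin 5) (s : Side) : Fin 5 := bif s.2 then s.1 else ρ s.1

/-- The three corners at vertex `i` of the 5-cycle: `0` and `1` lie between the spoke and the rim
edges `i - 1` and `i`, and `2` lies between the two rim edges. The numbers below 5 are left for the
paths. -/
def corner (i : Fin 5) (k : ℕ) : ℕ := 5 + 3 * i + k

/-- How a transition system at the 5-cycle links the paths and the corners of the 5-cycle: bit `i`
of `c.1` tells which of the two corners at spoke `i` is attached to which side, and bit `i` of `c.2`
how the corners at the two ends of rim edge `i` are attached. -/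
def pentagonLinks (ρ : Fin 5 → Fin 5) (c : ℕ × ℕ) : List (ℕ × ℕ) :=
  sides.flatMap fun s => [((pathAt ρ s : ℕ), corner s.1 (flipSide c.1 s).2.toNat),
    (corner s.1 (1 + s.2.toNat), corner (s.1 + 1) (2 * (flipSide c.2 s).2.toNat))]

/-- The ways in which five paths can join the sides of the spokes, up to exchanging the two sides
of spokes. Each of them comes with transition systems at the 5-cycle, encoded as in
`pentagonLinks`, which were found by a computer search. -/
def pathPatterns : List ((Fin 5 → Fin 5) × List (ℕ × ℕ)) := [
  (![1, 0, 3, 4, 2], [(3, 28), (28, 0), (28, 18), (31, 0), (31, 18)]),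
  (![1, 2, 0, 4, 3], [(7, 20), (24, 7), (24, 19), (31, 0), (31, 20)]),
  (![1, 2, 3, 4, 0], [(0, 7), (0, 14), (0, 19), (0, 25), (0, 28), (31, 0)]),
  (![1, 2, 4, 0, 3], [(0, 5), (0, 18), (24, 7), (24, 19), (31, 28)]),
  (![1, 3, 0, 4, 2], [(0, 15), (24, 19), (28, 18), (31, 22)]),
  (![1, 3, 4, 0, 2], [(11, 30), (12, 19), (19, 0), (20, 13), (24, 19), (31, 30)]),
  (![1, 3, 4, 2, 0], [(0, 9), (0, 18), (19, 0), (31, 14)]),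
  (![1, 4, 0, 2, 3], [(0, 19), (28, 14), (28, 28), (31, 10), (31, 20)]),
  (![1, 4, 3, 0, 2], [(0, 29), (19, 10), (28, 18), (31, 26)]),
  (![1, 4, 3, 2, 0], [(12, 25), (19, 0), (19, 10), (31, 0), (31, 10)]),
  (![2, 3, 0, 4, 1], [(5, 11), (6, 28), (25, 0), (26, 23), (28, 0), (31, 23)]),
  (![2, 3, 1, 4, 0], [(0, 9), (0, 20), (25, 0), (31, 7)]),
  (![2, 3, 4, 0, 1], [(21, 15), (22, 29), (26, 23), (31, 31)]),
  (![2, 3, 4, 1, 0], [(10, 22), (12, 25), (19, 0), (21, 15), (25, 0), (31, 15)]),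
  (![2, 4, 1, 0, 3], [(0, 21), (24, 20), (25, 28), (31, 27)]),
  (![2, 4, 3, 0, 1], [(13, 27), (14, 0), (17, 14), (18, 21), (28, 0), (31, 27)]),
  (![2, 4, 3, 1, 0], [(0, 23), (17, 14), (19, 10), (31, 11)]),
  (![3, 2, 1, 4, 0], [(6, 28), (25, 0), (25, 5), (31, 0), (31, 5)]),
  (![3, 2, 4, 0, 1], [(9, 26), (14, 0), (17, 7), (22, 29), (24, 7), (31, 29)]),
  (![3, 2, 4, 1, 0], [(0, 30), (17, 7), (25, 5), (31, 13)]),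
  (![3, 4, 1, 2, 0], [(0, 25), (17, 0), (31, 5), (31, 10)]),
  (![4, 2, 3, 1, 0], [(14, 9), (17, 7), (17, 14), (31, 0), (31, 9)])]

/-- The pairs of paths. -/
def pathPairs : List (Fin 5 × Fin 5) :=
  [(0, 1), (0, 2), (0, 3), (0, 4), (1, 2), (1, 3), (1, 4), (2, 3), (2, 4), (3, 4)]

/-- Whether no spoke is shared by the paths `i` and `j`. -/
def spokeDisjoint (ρ : Fin 5 → Fin 5) (i j : Fin 5) : Bool := ρ i != j && ρ j != i

/-- The set of pairs of paths that carry the same label. -/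
def mergedPairs (labels : List ℕ) : ℕ :=
  bitmask pathPairs fun p => (labels.getD p.1 0).beq (labels.getD p.2 0)

/-- Whether two sides can be joined when a vertex and an edge at the spokes `a`, `b` replace the
5-cycle: they lie on different spokes, both or none of which is in `{a, b}`, and the paths that end
there share no spoke. -/
def joinable (ρ : Fin 5 → Fin 5) (a b : Fin 5) (s s' : Side) : Bool :=
  s.1 != s'.1 && (s.1 == a || s.1 == b) == (s'.1 == a || s'.1 == b) &&
    spokeDisjoint ρ (pathAt ρ s) (pathAt ρ s')

/-- The set of pairs of paths that are merged by a matching of the sides. -/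
def matchingMerges (ρ : Fin 5 → Fin 5) (m : List (Side × Side)) : ℕ :=
  mergedPairs (componentLabels 5 (m.map fun l => ((pathAt ρ l.1 : ℕ), (pathAt ρ l.2 : ℕ))))

/-- The set of pairs of paths that are merged by a transition system at the 5-cycle. -/
def pentagonMerges (ρ : Fin 5 → Fin 5) (c : ℕ × ℕ) : ℕ :=
  mergedPairs (componentLabels 20 (pentagonLinks ρ c))

/-- The number of entries of `l` whose set of merged pairs is contained in `D`. -/
def countBelow {T : Type*} (D : ℕ) (merges : T → ℕ) (l : List T) : ℕ :=
  l.countP fun x => (merges x ||| D).beq D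

/-- The number of matchings by a vertex and an edge at the spokes `a`, `b` that merge only pairs of
paths in `D`. -/
def replacementCount (ρ : Fin 5 → Fin 5) (D : ℕ) (a b : Fin 5) : ℕ :=
  countBelow D (matchingMerges ρ) (perfectMatchings (joinable ρ a b) 5 sides)

theorem perfectMatchings_sides_normalForm :
    ∀ m ∈ perfectMatchings (fun s s' : Side => s.1 != s'.1) 5 sides, ∃ f ∈ List.range 32,
      (m.all fun l => (flipSide f l.1).2 != (flipSide f l.2).2) ∧ ∃ row ∈ pathPatterns,
        m.all fun l => pathAt row.1 (flipSide f l.1) == pathAt row.1 (flipSide f l.2) := by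
  decide +kernel

theorem nodup_corners_pathPatterns : ∀ row ∈ pathPatterns, ∀ c ∈ row.2, ∀ i : Fin 5,
    ([0, 1, 2].map fun k => (componentLabels 20 (pentagonLinks row.1 c)).getD (corner i k) 0).Nodup
    := by
  decide +kernel

theorem weighted_replacementCount_le : ∀ row ∈ pathPatterns,
    ∀ D ∈ bitmasksBelow pathPairs fun p => spokeDisjoint row.1 p.1 p.2,
      2 * ∑ i, replacementCount row.1 D i (i + 1) + ∑ i, replacementCount row.1 D i (i + 2) ≤
        4 * countBelow D (pentagonMerges row.1) row.2 := by
  decide +kernel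

theorem apply_mem_erase_of_involutive {T : Type*} [BEq T] [LawfulBEq T] {p : T → T} {x y : T}
    {xs : List T} (hp : Function.Involutive p) (hl : (x :: xs).Nodup)
    (hpl : ∀ z ∈ x :: xs, p z ∈ x :: xs) (hy : y ∈ xs.erase (p x)) : p y ∈ xs.erase (p x) := by
  obtain ⟨hx, hxs⟩ := List.nodup_cons.1 hl
  obtain ⟨hy_ne, hy⟩ := hxs.mem_erase_iff.1 hy
  refine hxs.mem_erase_iff.2 ⟨fun h => hx (hp.injective h ▸ hy),
    (List.mem_cons.1 (hpl y (List.mem_cons_of_mem x hy))).resolve_left fun h => ?_⟩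
  exact hy_ne (by rw [← h, hp])

theorem exists_mem_perfectMatchings {T : Type*} [BEq T] [LawfulBEq T] {r : T → T → Bool} {p : T → T}
    (hp : Function.Involutive p) (n : ℕ) (l : List T) (hl : l.Nodup) (hn : l.length ≤ 2 * n)
    (hpl : ∀ x ∈ l, p x ∈ l ∧ p x ≠ x ∧ r x (p x)) :
    ∃ m ∈ perfectMatchings r n l, (∀ xy ∈ m, p xy.1 = xy.2) ∧
      ∀ x ∈ l, (x, p x) ∈ m ∨ (p x, x) ∈ m := by
  induction n generalizing l with
  | zero =>
    obtain rfl : l = [] := List.length_eq_zero_iff.1 (by omega)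
    exact ⟨[], by simp [perfectMatchings]⟩
  | succ n ih =>
    cases l with
    | nil => exact ⟨[], by simp [perfectMatchings]⟩
    | cons x xs =>
      obtain ⟨hpx, hpx_ne, hr⟩ := hpl x List.mem_cons_self
      have hxs := (List.nodup_cons.1 hl).2
      have hpxs : p x ∈ xs := (List.mem_cons.1 hpx).resolve_left hpx_ne
      have hlen : (xs.erase (p x)).length ≤ 2 * n := by
        rw [List.length_erase_of_mem hpxs]
        rw [List.length_cons] at hn
        omega
      have hclosed : ∀ y ∈ xs.erase (p x), p y ∈ xs.erase (p x) ∧ p y ≠ y ∧ r y (p y) := fun y hy =>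
        ⟨apply_mem_erase_of_involutive hp hl (fun z hz => (hpl z hz).1) hy,
          (hpl y (List.mem_cons_of_mem x (List.mem_of_mem_erase hy))).2⟩
      obtain ⟨m, hm, hm_snd, hm_mem⟩ := ih _ (hxs.erase _) hlen hclosed
      refine ⟨(x, p x) :: m, ?_, List.forall_mem_cons.2 ⟨rfl, hm_snd⟩, fun y hy => ?_⟩
      · simp only [perfectMatchings, List.mem_flatMap, List.mem_filter, List.mem_map]
        exact ⟨p x, ⟨hpxs, hr⟩, m, hm, rfl⟩
      · rcases List.mem_cons.1 hy with rfl | hy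
        · exact Or.inl List.mem_cons_self
        · by_cases hyp : y = p x
          · exact Or.inr (by rw [hyp, hp]; exact List.mem_cons_self)
          · exact (hm_mem y (hxs.mem_erase_iff.2 ⟨hyp, hy⟩)).imp (List.mem_cons_of_mem _)
              (List.mem_cons_of_mem _)

section Labels

variable {labels : List ℕ} {links : List (ℕ × ℕ)} {n x y : ℕ}

theorem length_mergeLabels (labels : List ℕ) (l : ℕ × ℕ) :
    (mergeLabels labels l).length = labels.length := List.length_map _

theorem getD_mergeLabels (l : ℕ × ℕ) (hx : x < labels.length) :
    (mergeLabels labels l).getD x 0 =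
      if labels.getD x 0 = labels.getD l.1 0 then labels.getD l.2 0 else labels.getD x 0 := by
  simp [mergeLabels, List.getD_eq_getElem?_getD, hx, Bool.cond_eq_ite]

theorem getD_foldl_mergeLabels_congr (hx : x < labels.length) (hy : y < labels.length)
    (h : labels.getD x 0 = labels.getD y 0) :
    (links.foldl mergeLabels labels).getD x 0 = (links.foldl mergeLabels labels).getD y 0 := by
  induction links generalizing labels with
  | nil => exact h
  | cons l _ ih =>
    refine ih (by rwa [length_mergeLabels]) (by rwa [length_mergeLabels]) ?_
    rw [getD_mergeLabels l hx, getD_mergeLabels l hy, h]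

theorem getD_foldl_mergeLabels_of_mem (h : (x, y) ∈ links) (hx : x < labels.length)
    (hy : y < labels.length) :
    (links.foldl mergeLabels labels).getD x 0 = (links.foldl mergeLabels labels).getD y 0 := by
  induction links generalizing labels with
  | nil => exact absurd h List.not_mem_nil
  | cons l links ih =>
    rcases List.mem_cons.1 h with rfl | h
    · rw [List.foldl_cons]
      refine getD_foldl_mergeLabels_congr (by rwa [length_mergeLabels])
        (by rwa [length_mergeLabels]) ?_
      rw [getD_mergeLabels _ hx, getD_mergeLabels _ hy, if_pos rfl]
      split_ifs <;> rfl
    · exact ih h (by rwa [length_mergeLabels]) (by rwa [length_mergeLabels])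

theorem getD_componentLabels_of_mem (h : (x, y) ∈ links) (hx : x < n) (hy : y < n) :
    (componentLabels n links).getD x 0 = (componentLabels n links).getD y 0 :=
  getD_foldl_mergeLabels_of_mem h (by simpa using hx) (by simpa using hy)

variable {r : ℕ → ℕ → Prop} (hr : Equivalence r)
include hr

theorem rel_of_getD_foldl_mergeLabels_eq
    (hlinks : ∀ l ∈ links, r l.1 l.2 ∧ l.1 < labels.length ∧ l.2 < labels.length)
    (hlabels : ∀ x < labels.length, ∀ y < labels.length,
      labels.getD x 0 = labels.getD y 0 → r x y) (hx : x < labels.length) (hy : y < labels.length)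
    (h : (links.foldl mergeLabels labels).getD x 0 = (links.foldl mergeLabels labels).getD y 0) :
    r x y := by
  induction links generalizing labels with
  | nil => exact hlabels x hx y hy h
  | cons l links ih =>
    rw [List.forall_mem_cons] at hlinks
    obtain ⟨⟨hl, hl₁, hl₂⟩, hlinks⟩ := hlinks
    have hlen := length_mergeLabels labels l
    refine ih (by rwa [hlen]) (fun x hx y hy hxy => ?_) (by rwa [hlen]) (by rwa [hlen]) h
    rw [hlen] at hx hy
    rw [getD_mergeLabels l hx, getD_mergeLabels l hy] at hxy
    split_ifs at hxy with hx₁ hy₁ hy₁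
    · exact hlabels x hx y hy (hx₁.trans hy₁.symm)
    · exact hr.trans (hr.trans (hlabels _ hx _ hl₁ hx₁) hl) (hlabels _ hl₂ _ hy hxy)
    · exact hr.trans (hlabels _ hx _ hl₂ hxy) (hr.symm (hr.trans (hlabels _ hy _ hl₁ hy₁) hl))
    · exact hlabels x hx y hy hxy

theorem rel_of_getD_componentLabels_eq (hlinks : ∀ l ∈ links, r l.1 l.2 ∧ l.1 < n ∧ l.2 < n)
    (hx : x < n) (hy : y < n)
    (h : (componentLabels n links).getD x 0 = (componentLabels n links).getD y 0) : r x y := by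
  have hlen : (List.range n).length = n := List.length_range
  refine rel_of_getD_foldl_mergeLabels_eq hr (labels := List.range n) (by rwa [hlen])
    (fun x hx y hy hxy => ?_) (by rwa [hlen]) (by rwa [hlen]) h
  rw [hlen] at hx hy
  obtain rfl : x = y := by simpa [List.getD_eq_getElem?_getD, hx, hy] using hxy
  exact hr.refl x

end Labels

section Bitmask

variable {T : Type*} {l : List T} {f g p : T → Bool}

theorem bitmask_lor_eq_iff :
    bitmask l f ||| bitmask l g = bitmask l g ↔ ∀ x ∈ l, f x → g x := by
  induction l with
  | nil => simp [bitmask]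
  | cons x l ih =>
    simp only [bitmask, List.foldr_cons] at ih ⊢
    rw [Nat.lor_bit, List.forall_mem_cons, ← ih]
    cases f x <;> cases g x <;> simp [Nat.bit]
    omega

theorem bitmask_mem_bitmasksBelow (h : ∀ x ∈ l, f x → p x) :
    bitmask l f ∈ bitmasksBelow l p := by
  induction l with
  | nil => exact List.mem_singleton_self 0
  | cons x l ih =>
    rw [List.forall_mem_cons] at h
    refine List.mem_flatMap.2 ⟨_, ih h.2, ?_⟩
    cases hf : f x
    · cases p x <;> simp [bitmask, hf]
    · simp [h.1 hf, bitmask, hf]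

end Bitmask

/-! ### Transition systems with five loose spokes -/

theorem flipSide_flipSide (f : ℕ) (s : Side) : flipSide f (flipSide f s) = s := by
  simp [flipSide]

theorem nodup_sides : sides.Nodup := by decide

theorem mem_sides : ∀ s, s ∈ sides := by decide

theorem injective_of_mem_pathPatterns :
    ∀ row ∈ pathPatterns, ∀ i j, row.1 i = row.1 j → i = j := by
  decide +kernel

theorem eq_of_pathAt_eq {ρ : Fin 5 → Fin 5} (hρ : Function.Injective ρ) {s s' : Side}
    (h : pathAt ρ s = pathAt ρ s') (hb : s.2 = s'.2) : s = s' := by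
  obtain ⟨i, k⟩ := s
  obtain ⟨j, k'⟩ := s'
  obtain rfl : k = k' := hb
  cases k
  · exact Prod.ext (hρ h) rfl
  · exact Prod.ext h rfl

/-- Two walks meet if they pass through a common vertex along different pairs of edges. -/
def Meets {X : Type*} (τ : X → X) (vt : X → α) (σ : X → X) (x y : X) : Prop :=
  ∃ x' y', Linked σ τ x x' ∧ Linked σ τ y y' ∧ vt x' = vt y' ∧ y' ≠ x' ∧ y' ≠ τ x'

/-- A transition system `σ` on the flags of a graph with five loose spokes: the flags `t s` at the
sides of the spokes, which cannot be continued, are its fixed points, and its walks pass through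
every vertex at most once. -/
structure OuterSystem {X : Type*} (τ : X → X) (vt : X → α) (t : Side → X) (σ : X → X) : Prop where
  swap_swap : ∀ x, τ (τ x) = x
  swap_ne : ∀ x, τ x ≠ x
  side_injective : Function.Injective t
  vtx_side : ∀ i, vt (t (i, false)) = vt (t (i, true))
  side_ne_swap : ∀ i, t (i, true) ≠ τ (t (i, false))
  involutive : ∀ x, σ (σ x) = x
  fixed_iff : ∀ x, σ x = x ↔ ∃ s, t s = x
  simple : ∀ x y, Linked σ τ x y → vt x = vt y → y = x ∨ y = τ x

/-- An equivalence relation that unites some of the walks of `σ`, such that the united walks still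
pass through every vertex at most once. -/
structure IsSimpleExtension {X : Type*} (τ : X → X) (vt : X → α) (σ : X → X) (r : X → X → Prop) :
    Prop where
  equivalence : Equivalence r
  of_linked : ∀ x y, Linked σ τ x y → r x y
  simple : ∀ x y, r x y → vt x = vt y → y = x ∨ y = τ x

/-- A pairing of the sides by a vertex and an edge at the spokes `a`, `b` that unites the walks to
closed walks which pass through every vertex at most once. -/
structure IsSimpleJoining {X : Type*} (τ : X → X) (vt : X → α) (t : Side → X) (σ : X → X)
    (a b : Fin 5) (γ : Side → Side) : Prop where
  involutive : Function.Involutive γ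
  spoke_ne : ∀ s, s.1 ≠ (γ s).1
  spoke_iff : ∀ s, s.1 = a ∨ s.1 = b ↔ (γ s).1 = a ∨ (γ s).1 = b
  exists_extension : ∃ r, IsSimpleExtension τ vt σ r ∧ ∀ s, r (t s) (t (γ s))

open Classical in
/-- The set of pairs of paths that do not meet. -/
noncomputable def disjointPairs {X : Type*} (τ : X → X) (vt : X → α) (t : Side → X) (σ : X → X) :
    ℕ :=
  bitmask pathPairs fun p => ¬ Meets τ vt σ (t (p.1, true)) (t (p.2, true))

section OuterSystem

variable {X : Type*} {τ : X → X} {vt : X → α} {t : Side → X} {σ : X → X} {ρ : Fin 5 → Fin 5}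
  {a b : Fin 5} {γ γ' : Side → Side}

theorem Meets.congr {x x' y y' : X} (h : Meets τ vt σ x y) (hx : Linked σ τ x x')
    (hy : Linked σ τ y y') : Meets τ vt σ x' y' := by
  obtain ⟨z, w, hz, hw, hzw⟩ := h
  exact ⟨z, w, hx.symm.trans hz, hy.symm.trans hw, hzw⟩

theorem IsSimpleExtension.not_meets {r : X → X → Prop} (hr : IsSimpleExtension τ vt σ r) {x y : X}
    (h : r x y) : ¬ Meets τ vt σ x y := by
  rintro ⟨x', y', hx, hy, hv, hne, hne_swap⟩
  have hr' : r x' y' := hr.equivalence.trans (hr.equivalence.symm (hr.of_linked _ _ hx))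
    (hr.equivalence.trans h (hr.of_linked _ _ hy))
  exact (hr.simple x' y' hr' hv).elim hne hne_swap

namespace OuterSystem

variable (h : OuterSystem τ vt t σ)
include h

theorem meets_symm {x y : X} (hm : Meets τ vt σ x y) : Meets τ vt σ y x := by
  obtain ⟨z, w, hz, hw, hzw, hne, hne_swap⟩ := hm
  exact ⟨w, z, hw, hz, hzw.symm, hne.symm, fun heq => hne_swap (by rw [heq, h.swap_swap])⟩

theorem meets_spoke (i : Fin 5) : Meets τ vt σ (t (i, false)) (t (i, true)) :=
  ⟨_, _, Linked.refl _, Linked.refl _, h.vtx_side i,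
    fun heq => absurd (h.side_injective heq) (by simp), h.side_ne_swap i⟩

theorem fst_ne_of_linked {s s' : Side} (hl : Linked σ τ (t s) (t s')) (hne : s' ≠ s) :
    s'.1 ≠ s.1 := by
  have not_linked (i : Fin 5) : ¬ Linked σ τ (t (i, false)) (t (i, true)) := fun hl =>
    (h.simple _ _ hl (h.vtx_side i)).elim
      (fun heq => absurd (h.side_injective heq) (by simp)) (h.side_ne_swap i)
  obtain ⟨i, k⟩ := s
  obtain ⟨j, k'⟩ := s'
  rintro rfl
  cases k <;> cases k'
  · exact hne rfl
  · exact not_linked _ hl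
  · exact not_linked _ hl.symm
  · exact hne rfl

theorem exists_partner [Finite X] :
    ∃ p : Side → Side, Function.Involutive p ∧ (∀ s, (p s).1 ≠ s.1) ∧
      ∀ s s', Linked σ τ (t s) (t s') ↔ s' = s ∨ s' = p s := by
  have exists_other (s : Side) : ∃ s', s' ≠ s ∧ Linked σ τ (t s) (t s') ∧
      ∀ s'', Linked σ τ (t s) (t s'') → s'' = s ∨ s'' = s' := by
    obtain ⟨g, hg, hfix, hl, hu⟩ := exists_unique_other_fixedPoint h.involutive h.swap_swap
      ((h.fixed_iff (t s)).2 ⟨s, rfl⟩) h.swap_ne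
    obtain ⟨s', rfl⟩ := (h.fixed_iff g).1 hfix
    exact ⟨s', fun hs => hg (congrArg t hs), hl, fun s'' hs'' =>
      (hu _ hs'' ((h.fixed_iff _).2 ⟨s'', rfl⟩)).imp (@h.side_injective _ _)
        (@h.side_injective _ _)⟩
  choose p hp hpl hpu using exists_other
  refine ⟨p, fun s => ?_, fun s => h.fst_ne_of_linked (hpl s) (hp s), fun s s' => ⟨hpu s s', ?_⟩⟩
  · exact ((hpu (p s) s (hpl s).symm).resolve_left (hp s).symm).symm
  · rintro (rfl | rfl)
    exacts [Linked.refl _, hpl s]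

theorem exists_normalForm [Finite X] :
    ∃ f, ∃ row ∈ pathPatterns, ∀ s s', Linked σ τ (t (flipSide f s)) (t (flipSide f s')) ↔
      pathAt row.1 s = pathAt row.1 s' := by
  obtain ⟨p, hp, hp_ne, hpl⟩ := h.exists_partner
  obtain ⟨m, hm, -, hmem⟩ := exists_mem_perfectMatchings (r := fun s s' : Side => s.1 != s'.1) hp 5
    sides nodup_sides (by decide) fun s _ =>
      ⟨mem_sides _, fun hs => hp_ne s (by rw [hs]), bne_iff_ne.2 (hp_ne s).symm⟩
  obtain ⟨f, -, hside, row, hrow, hpath⟩ := perfectMatchings_sides_normalForm m hm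
  simp only [List.all_eq_true, bne_iff_ne, beq_iff_eq] at hside hpath
  have hside' (s : Side) : (flipSide f s).2 ≠ (flipSide f (p s)).2 :=
    (hmem s (mem_sides s)).elim (hside _) fun hs => (hside _ hs).symm
  have hpath' (s : Side) : pathAt row.1 (flipSide f s) = pathAt row.1 (flipSide f (p s)) :=
    (hmem s (mem_sides s)).elim (hpath _) fun hs => (hpath _ hs).symm
  suffices hiff : ∀ s s', s' = s ∨ s' = p s ↔
      pathAt row.1 (flipSide f s) = pathAt row.1 (flipSide f s') from
    ⟨f, row, hrow, fun s s' => by rw [hpl, hiff, flipSide_flipSide, flipSide_flipSide]⟩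
  refine fun s s' => ⟨?_, fun heq => ?_⟩
  · rintro (rfl | rfl)
    exacts [rfl, hpath' s]
  · have hinj : Function.Injective row.1 := fun i j => injective_of_mem_pathPatterns row hrow i j
    have hflip : Function.Injective (flipSide f) :=
      Function.LeftInverse.injective (flipSide_flipSide f)
    by_cases hb : (flipSide f s').2 = (flipSide f s).2
    · exact Or.inl (hflip (eq_of_pathAt_eq hinj heq.symm hb))
    · have hb' : (flipSide f s').2 = (flipSide f (p s)).2 := by
        rw [Bool.eq_not_of_ne hb, Bool.eq_not_of_ne (hside' s), Bool.not_not]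
      exact Or.inr (hflip (eq_of_pathAt_eq hinj (heq.symm.trans (hpath' s)) hb'))

variable (hρ : ∀ s s', Linked σ τ (t s) (t s') ↔ pathAt ρ s = pathAt ρ s')
include hρ

theorem spokeDisjoint_of_not_meets {s s' : Side} (hm : ¬ Meets τ vt σ (t s) (t s')) :
    spokeDisjoint ρ (pathAt ρ s) (pathAt ρ s') := by
  simp only [spokeDisjoint, Bool.and_eq_true, bne_iff_ne]
  refine ⟨fun heq => hm ?_, fun heq => hm ?_⟩
  · exact (h.meets_symm (h.meets_spoke (pathAt ρ s))).congr ((hρ _ _).2 rfl) ((hρ _ _).2 heq)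
  · exact (h.meets_spoke (pathAt ρ s')).congr ((hρ _ _).2 heq) ((hρ _ _).2 rfl)

theorem disjointPairs_mem_bitmasksBelow :
    disjointPairs τ vt t σ ∈ bitmasksBelow pathPairs fun p => spokeDisjoint ρ p.1 p.2 :=
  bitmask_mem_bitmasksBelow fun p _ hm =>
    h.spokeDisjoint_of_not_meets hρ (s := (p.1, true)) (s' := (p.2, true))
      (by simpa only [decide_eq_true_eq] using hm)

end OuterSystem

theorem mergedPairs_lor_disjointPairs_eq_iff {labels : List ℕ} :
    mergedPairs labels ||| disjointPairs τ vt t σ = disjointPairs τ vt t σ ↔ ∀ p ∈ pathPairs,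
      labels.getD p.1 0 = labels.getD p.2 0 → ¬ Meets τ vt σ (t (p.1, true)) (t (p.2, true)) := by
  rw [mergedPairs, disjointPairs, bitmask_lor_eq_iff]
  simp only [Nat.beq_eq, decide_eq_true_eq]

namespace IsSimpleJoining

variable (hρ : ∀ s s', Linked σ τ (t s) (t s') ↔ pathAt ρ s = pathAt ρ s')
include hρ

theorem joinable (hγ : IsSimpleJoining τ vt t σ a b γ) (h : OuterSystem τ vt t σ) (s : Side) :
    joinable ρ a b s (γ s) := by
  obtain ⟨r, hr, hrγ⟩ := hγ.exists_extension
  have hspoke := hγ.spoke_iff s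
  simp only [CircuitDoubleCover.joinable, Bool.and_eq_true, bne_iff_ne, beq_iff_eq]
  refine ⟨⟨hγ.spoke_ne s, ?_⟩, h.spokeDisjoint_of_not_meets hρ (hr.not_meets (hrγ s))⟩
  rw [Bool.eq_iff_iff]
  simpa only [Bool.or_eq_true, beq_iff_eq] using hspoke

theorem matchingMerges_lor_disjointPairs (hγ : IsSimpleJoining τ vt t σ a b γ)
    {m : List (Side × Side)} (hm : ∀ l ∈ m, γ l.1 = l.2) :
    matchingMerges ρ m ||| disjointPairs τ vt t σ = disjointPairs τ vt t σ := by
  obtain ⟨r, hr, hrγ⟩ := hγ.exists_extension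
  have hpath (s : Side) : r (t (pathAt ρ s, true)) (t s) := hr.of_linked _ _ ((hρ _ _).2 rfl)
  have hlinks (l : ℕ × ℕ) (hl : l ∈ m.map fun l => ((pathAt ρ l.1 : ℕ), (pathAt ρ l.2 : ℕ))) :
      r (t (Fin.ofNat 5 l.1, true)) (t (Fin.ofNat 5 l.2, true)) ∧ l.1 < 5 ∧ l.2 < 5 := by
    obtain ⟨⟨s, s'⟩, hs, rfl⟩ := List.mem_map.1 hl
    have heq : γ s = s' := hm _ hs
    refine ⟨?_, Fin.is_lt _, Fin.is_lt _⟩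
    simp only [Fin.ofNat_val_eq_self]
    exact hr.equivalence.trans (hpath s)
      (hr.equivalence.trans (heq ▸ hrγ s) (hr.equivalence.symm (hpath s')))
  have hequiv : Equivalence fun i j => r (t (Fin.ofNat 5 i, true)) (t (Fin.ofNat 5 j, true)) :=
    hr.equivalence.comap _
  refine mergedPairs_lor_disjointPairs_eq_iff.2 fun p _ heq => hr.not_meets ?_
  have hrel := rel_of_getD_componentLabels_eq hequiv hlinks (Fin.is_lt p.1) (Fin.is_lt p.2) heq
  simpa only [Fin.ofNat_val_eq_self] using hrel

end IsSimpleJoining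

theorem eq_of_forall_mem {m : List (Side × Side)} (hγ' : Function.Involutive γ')
    (hm : ∀ s, (s, γ s) ∈ m ∨ (γ s, s) ∈ m) (hm' : ∀ l ∈ m, γ' l.1 = l.2) : γ = γ' := by
  funext s
  rcases hm s with hs | hs
  · exact (hm' _ hs).symm
  · exact hγ'.injective ((hm' _ hs).trans (hγ' s).symm)

theorem OuterSystem.ncard_le_replacementCount (h : OuterSystem τ vt t σ)
    (hρ : ∀ s s', Linked σ τ (t s) (t s') ↔ pathAt ρ s = pathAt ρ s') {K : Type*} {S : Set K}
    {γ : K → Side → Side} (hinj : Set.InjOn γ S)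
    (hγ : ∀ k ∈ S, IsSimpleJoining τ vt t σ a b (γ k)) :
    S.ncard ≤ replacementCount ρ (disjointPairs τ vt t σ) a b := by
  classical
  set L := (perfectMatchings (joinable ρ a b) 5 sides).filter fun m =>
    (matchingMerges ρ m ||| disjointPairs τ vt t σ).beq (disjointPairs τ vt t σ)
  have exists_matching : ∀ k ∈ S, ∃ m ∈ L, (∀ l ∈ m, γ k l.1 = l.2) ∧
      ∀ s, (s, γ k s) ∈ m ∨ (γ k s, s) ∈ m := fun k hk => by
    obtain ⟨m, hm, hm_eq, hm_mem⟩ := exists_mem_perfectMatchings (hγ k hk).involutive 5 sides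
      nodup_sides (by decide) fun s _ => ⟨mem_sides _,
        fun hs => (hγ k hk).spoke_ne s (by rw [hs]), (hγ k hk).joinable hρ h s⟩
    exact ⟨m, List.mem_filter.2 ⟨hm, Nat.beq_eq.symm ▸
      (hγ k hk).matchingMerges_lor_disjointPairs hρ hm_eq⟩, hm_eq, fun s => hm_mem s (mem_sides s)⟩
  choose! M hML hM_eq hM_mem using exists_matching
  have hM : Set.InjOn M S := fun k hk k' hk' heq => hinj hk hk' <|
    eq_of_forall_mem (hγ k' hk').involutive (heq ▸ hM_mem k hk) (hM_eq k' hk')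
  calc S.ncard = (M '' S).ncard := hM.ncard_image.symm
    _ ≤ (L.toFinset : Set (List (Side × Side))).ncard :=
      Set.ncard_le_ncard (by rintro _ ⟨k, hk, rfl⟩; simpa using hML k hk) (Finset.finite_toSet _)
    _ ≤ L.length := by
      rw [Set.ncard_coe_finset]
      exact List.toFinset_card_le _
    _ = replacementCount ρ (disjointPairs τ vt t σ) a b := List.countP_eq_length_filter.symm

end OuterSystem

/-! ### The part of a transition system off the 5-cycle -/

section FiveCycle

variable {P : FiveCycle G} {i : Fin 5} {x : α}

theorem rim_injective (P : FiveCycle G) : Function.Injective P.rim := by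
  intro i j h
  have hlink := P.rim_isLink i
  rw [h] at hlink
  rcases hlink.eq_and_eq_or_eq_and_eq (P.rim_isLink j) with ⟨hij, -⟩ | ⟨hij, hji⟩
  · exact P.vert_injective hij
  · obtain rfl := P.vert_injective hij
    exact absurd (P.vert_injective hji) ((by decide : ∀ j : Fin 5, j + 1 + 1 ≠ j) j)

theorem inc_rim : G.Inc (P.rim i) x ↔ x = P.vert i ∨ x = P.vert (i + 1) := by
  refine ⟨fun h => h.eq_or_eq_of_isLink (P.rim_isLink i), ?_⟩
  rintro (rfl | rfl)
  exacts [(P.rim_isLink i).inc_left, (P.rim_isLink i).inc_right]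

theorem inc_spoke : G.Inc (P.spoke i) x ↔ x = P.vert i ∨ x = P.outer i := by
  refine ⟨fun h => h.eq_or_eq_of_isLink (P.spoke_isLink i), ?_⟩
  rintro (rfl | rfl)
  exacts [(P.spoke_isLink i).inc_left, (P.spoke_isLink i).inc_right]

theorem inc_rim_self (P : FiveCycle G) (i : Fin 5) : G.Inc (P.rim i) (P.vert i) :=
  (P.rim_isLink i).inc_left

theorem inc_rim_sub_one (P : FiveCycle G) (i : Fin 5) : G.Inc (P.rim (i - 1)) (P.vert i) :=
  inc_rim.2 (Or.inr (by rw [sub_add_cancel]))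

theorem inc_spoke_self (P : FiveCycle G) (i : Fin 5) : G.Inc (P.spoke i) (P.vert i) :=
  (P.spoke_isLink i).inc_left

theorem rim_sub_one_ne (P : FiveCycle G) (i : Fin 5) : P.rim (i - 1) ≠ P.rim i := fun h =>
  absurd (rim_injective P h) ((by decide : ∀ i : Fin 5, i - 1 ≠ i) i)

theorem incidenceSet_vert_of_encard (h : (G.incidenceSet (P.vert i)).encard = 3) :
    G.incidenceSet (P.vert i) = {P.rim (i - 1), P.rim i, P.spoke i} := by
  symm
  refine Set.Finite.eq_of_subset_of_encard_le (Set.toFinite _) ?_ ?_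
  · rintro e (rfl | rfl | rfl)
    exacts [inc_rim_sub_one P i, inc_rim_self P i, inc_spoke_self P i]
  · rw [h, Set.encard_eq_three.2
      ⟨_, _, _, rim_sub_one_ne P i, (P.spoke_ne_rim _ _).symm, (P.spoke_ne_rim _ _).symm, rfl⟩]

/-- The graph is loopless and cubic, and the 5-cycle has no chord. -/
structure IsProper (P : FiveCycle G) : Prop where
  cubic : IsLooplessCubic G
  outer_ne_vert : ∀ i j, P.outer i ≠ P.vert j

namespace IsProper

theorem spoke_injective (hP : IsProper P) : Function.Injective P.spoke := fun i j h =>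
  (inc_spoke.1 (h ▸ inc_spoke_self P i)).elim (@P.vert_injective i j)
    fun hv => absurd hv.symm (hP.outer_ne_vert j i)

theorem incidenceSet_vert (hP : IsProper P) (i : Fin 5) :
    G.incidenceSet (P.vert i) = {P.rim (i - 1), P.rim i, P.spoke i} :=
  incidenceSet_vert_of_encard (hP.cubic.encard_incidenceSet _ (P.rim_isLink i).left_mem)

end IsProper

/-- The flags at vertices off the 5-cycle. -/
def OuterFlag (P : FiveCycle G) : Type _ := {φ : Flag G // φ.vtx ∉ Set.range P.vert}

namespace OuterFlag

/-- The outer flag with its two edges exchanged. -/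
def swap (x : OuterFlag P) : OuterFlag P := ⟨x.1.swap, x.2⟩

theorem finite (hV : G.vertexSet.Finite) (hE : G.edgeSet.Finite) : Finite (OuterFlag P) := by
  have := Flag.finite hV hE
  exact Subtype.finite

theorem edge_ne_rim (x : OuterFlag P) (i : Fin 5) : x.1.edge ≠ P.rim i := fun h =>
  (inc_rim.1 (h ▸ x.1.inc_edge)).elim (fun hv => x.2 ⟨_, hv.symm⟩) (fun hv => x.2 ⟨_, hv.symm⟩)

theorem vtx_of_edge_eq_spoke {x : OuterFlag P} (h : x.1.edge = P.spoke i) :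
    x.1.vtx = P.outer i :=
  (inc_spoke.1 (h ▸ x.1.inc_edge)).resolve_left fun hv => x.2 ⟨_, hv.symm⟩

end OuterFlag

/-- A labelling of the outer flags whose first edge is a spoke by the sides of the spokes. -/
structure IsSideLabelling (t : Side → OuterFlag P) : Prop where
  injective : Function.Injective t
  edge_eq : ∀ s, (t s).1.edge = P.spoke s.1
  exists_of_edge : ∀ x i, x.1.edge = P.spoke i → ∃ k, t (i, k) = x

theorem IsSideLabelling.vtx_eq {t : Side → OuterFlag P} (ht : IsSideLabelling t) (s : Side) :
    (t s).1.vtx = P.outer s.1 :=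
  OuterFlag.vtx_of_edge_eq_spoke (ht.edge_eq s)

theorem IsSideLabelling.comp_flipSide {t : Side → OuterFlag P} (ht : IsSideLabelling t) (f : ℕ) :
    IsSideLabelling fun s => t (flipSide f s) where
  injective := ht.injective.comp (Function.LeftInverse.injective (flipSide_flipSide f))
  edge_eq s := ht.edge_eq (flipSide f s)
  exists_of_edge x i hi := by
    obtain ⟨k, hk⟩ := ht.exists_of_edge x i hi
    exact ⟨(flipSide f (i, k)).2, (congrArg t (flipSide_flipSide f (i, k))).trans hk⟩

theorem IsProper.exists_outerFlag_spoke (hP : IsProper P) (i : Fin 5) :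
    ∃ x y : OuterFlag P, x ≠ y ∧ x.1.edge = P.spoke i ∧ y.1.edge = P.spoke i ∧
      ∀ z : OuterFlag P, z.1.edge = P.spoke i → z = x ∨ z = y := by
  have hout : P.outer i ∉ Set.range P.vert := fun ⟨j, hj⟩ => hP.outer_ne_vert i j hj.symm
  have hs : G.Inc (P.spoke i) (P.outer i) := (P.spoke_isLink i).inc_right
  obtain ⟨f, hfs, hf⟩ := hP.cubic.exists_ne_inc hs
  let φ : Flag G := ⟨P.outer i, P.spoke i, f, hs, hf, hfs.symm⟩
  obtain ⟨g, hgs, hgf, hi⟩ := hP.cubic.exists_third φ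
  have hg : G.Inc g (P.outer i) := show g ∈ G.incidenceSet φ.vtx by simp [hi]
  refine ⟨⟨φ, hout⟩, ⟨⟨P.outer i, P.spoke i, g, hs, hg, hgs.symm⟩, hout⟩, fun h => ?_, rfl, rfl,
    fun z hz => ?_⟩
  · exact hgf (congrArg (fun x : OuterFlag P => x.1.other) h).symm
  · have hv := OuterFlag.vtx_of_edge_eq_spoke hz
    have ho : z.1.other ∈ G.incidenceSet φ.vtx :=
      show G.Inc z.1.other (P.outer i) from hv ▸ z.1.inc_other
    rw [hi] at ho
    rcases ho with ho | ho | ho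
    · exact absurd (hz.trans ho.symm) z.1.edge_ne_other
    · exact Or.inl (Subtype.ext (Flag.ext hv hz ho))
    · exact Or.inr (Subtype.ext (Flag.ext hv hz ho))

theorem IsProper.exists_isSideLabelling (hP : IsProper P) :
    ∃ t : Side → OuterFlag P, IsSideLabelling t := by
  choose x y hxy hx hy hz using hP.exists_outerFlag_spoke
  have hedge (s : Side) : (cond s.2 (y s.1) (x s.1)).1.edge = P.spoke s.1 := by
    obtain ⟨i, k⟩ := s
    cases k
    exacts [hx i, hy i]
  refine ⟨fun s => cond s.2 (y s.1) (x s.1), ?_, hedge, fun z i hzi => ?_⟩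
  · rintro ⟨i, k⟩ ⟨j, k'⟩ h
    obtain rfl : i = j := hP.spoke_injective <|
      (hedge (i, k)).symm.trans ((congrArg (fun x : OuterFlag P => x.1.edge) h).trans (hedge _))
    cases k <;> cases k'
    · rfl
    · exact absurd h (hxy i)
    · exact absurd h.symm (hxy i)
    · rfl
  · rcases hz i z hzi with rfl | rfl
    exacts [⟨false, rfl⟩, ⟨true, rfl⟩]

/-- A transition system on the outer flags that is loose at the spokes and whose walks pass through
every vertex at most once. -/
structure IsOuterTransition (σ : OuterFlag P → OuterFlag P) : Prop where
  involutive : ∀ x, σ (σ x) = x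
  fixed_iff : ∀ x, σ x = x ↔ x.1.edge ∈ Set.range P.spoke
  edge_eq : ∀ x, (σ x).1.edge = x.1.edge
  vtx_ne : ∀ x, x.1.edge ∉ Set.range P.spoke → (σ x).1.vtx ≠ x.1.vtx
  simple : ∀ x y, Linked σ OuterFlag.swap x y → x.1.vtx = y.1.vtx → y = x ∨ y = x.swap

theorem IsOuterTransition.outerSystem {σ : OuterFlag P → OuterFlag P} (hσ : IsOuterTransition σ)
    {t : Side → OuterFlag P} (ht : IsSideLabelling t) :
    OuterSystem OuterFlag.swap (fun x => x.1.vtx) t σ where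
  swap_swap _ := rfl
  swap_ne x h := x.1.swap_ne (congrArg Subtype.val h)
  side_injective := ht.injective
  vtx_side i := (ht.vtx_eq (i, false)).trans (ht.vtx_eq (i, true)).symm
  side_ne_swap i h := (t (i, false)).1.edge_ne_other <| (ht.edge_eq _).trans <|
    (ht.edge_eq (i, true)).symm.trans (congrArg (fun x : OuterFlag P => x.1.edge) h)
  involutive := hσ.involutive
  fixed_iff x := by
    rw [hσ.fixed_iff]
    constructor
    · rintro ⟨i, hi⟩
      obtain ⟨k, hk⟩ := ht.exists_of_edge x i hi.symm
      exact ⟨_, hk⟩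
    · rintro ⟨s, rfl⟩
      exact ⟨s.1, (ht.edge_eq s).symm⟩
  simple := hσ.simple

/-- The outer transition systems of a 5-cycle. -/
noncomputable def outerTransitions (P : FiveCycle G) [Finite (OuterFlag P)] :
    Finset (OuterFlag P → OuterFlag P) :=
  (Set.toFinite {ς | IsOuterTransition ς}).toFinset

theorem mem_outerTransitions [Finite (OuterFlag P)] {ς : OuterFlag P → OuterFlag P} :
    ς ∈ outerTransitions P ↔ IsOuterTransition ς := by
  simp [outerTransitions]

/-- The map `j` identifies the outer flags with flags of `Γ` such that every transition system of
`Γ` continues an outer flag along the same edge to an outer flag exactly if that edge is not a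
spoke. -/
structure IsOuterEmbedding {α' β' : Type*} {Γ : Graph α' β'} (j : OuterFlag P → Flag Γ) : Prop where
  injective : Function.Injective j
  map_swap : ∀ x, j x.swap = (j x).swap
  map_vtx : ∀ x y, x.1.vtx = y.1.vtx → (j x).vtx = (j y).vtx
  exists_next : ∀ σ : Flag Γ → Flag Γ, IsTransition σ → ∀ x, x.1.edge ∉ Set.range P.spoke →
    ∃ y, σ (j x) = j y ∧ y.1.edge = x.1.edge
  not_exists_next : ∀ σ : Flag Γ → Flag Γ, IsTransition σ → ∀ x, x.1.edge ∈ Set.range P.spoke →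
    ¬ ∃ y, σ (j x) = j y ∧ y.1.edge = x.1.edge

section OuterPart

variable {α' β' : Type*} {Γ : Graph α' β'} {j : OuterFlag P → Flag Γ} {σ : Flag Γ → Flag Γ}

open Classical in
/-- The restriction of a transition system to the outer flags. -/
noncomputable def outerPart (j : OuterFlag P → Flag Γ) (σ : Flag Γ → Flag Γ) (x : OuterFlag P) :
    OuterFlag P :=
  if h : ∃ y, σ (j x) = j y ∧ y.1.edge = x.1.edge then h.choose else x

namespace IsOuterEmbedding

variable (hj : IsOuterEmbedding j)
include hj

theorem outerPart_of_mem (hσ : IsTransition σ) {x : OuterFlag P}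
    (hx : x.1.edge ∈ Set.range P.spoke) : outerPart j σ x = x :=
  dif_neg (hj.not_exists_next σ hσ x hx)

theorem outerPart_of_notMem (hσ : IsTransition σ) {x : OuterFlag P}
    (hx : x.1.edge ∉ Set.range P.spoke) :
    j (outerPart j σ x) = σ (j x) ∧ (outerPart j σ x).1.edge = x.1.edge := by
  have h := hj.exists_next σ hσ x hx
  rw [outerPart, dif_pos h]
  exact ⟨h.choose_spec.1.symm, h.choose_spec.2⟩

theorem linked_map (hσ : IsTransition σ) {x y : OuterFlag P}
    (h : Linked (outerPart j σ) OuterFlag.swap x y) : Linked σ Flag.swap (j x) (j y) := by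
  refine Linked.rel_of_equivalence (r := fun x y => Linked σ Flag.swap (j x) (j y))
    (Linked.equivalence.comap j) (fun x => ?_) (fun x => ?_) h
  · by_cases hx : x.1.edge ∈ Set.range P.spoke
    · rw [hj.outerPart_of_mem hσ hx]
      exact Linked.refl _
    · rw [(hj.outerPart_of_notMem hσ hx).1]
      exact Linked.fst _
  · rw [hj.map_swap]
    exact Linked.snd _

theorem isSimpleExtension (hσ : σ ∈ circuitTransitions Γ) :
    IsSimpleExtension OuterFlag.swap (fun x => x.1.vtx) (outerPart j σ) fun x y =>
      Linked σ Flag.swap (j x) (j y) where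
  equivalence := Linked.equivalence.comap j
  of_linked _ _ h := hj.linked_map hσ.1 h
  simple x _ h hv := (hσ.2 _ _ h (hj.map_vtx _ _ hv)).imp (@hj.injective _ _)
    fun heq => hj.injective (heq.trans (hj.map_swap x).symm)

theorem isOuterTransition (hσ : σ ∈ circuitTransitions Γ) : IsOuterTransition (outerPart j σ) where
  involutive x := by
    by_cases hx : x.1.edge ∈ Set.range P.spoke
    · rw [hj.outerPart_of_mem hσ.1 hx, hj.outerPart_of_mem hσ.1 hx]
    · obtain ⟨hjx, he⟩ := hj.outerPart_of_notMem hσ.1 hx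
      refine hj.injective ?_
      rw [(hj.outerPart_of_notMem hσ.1 (by rwa [he])).1, hjx, hσ.1.involutive]
  fixed_iff x := by
    refine ⟨fun h => by_contra fun hx => ?_, hj.outerPart_of_mem hσ.1⟩
    have hjx := (hj.outerPart_of_notMem hσ.1 hx).1
    rw [h] at hjx
    exact hσ.1.vtx_ne (j x) (by rw [← hjx])
  edge_eq x := by
    by_cases hx : x.1.edge ∈ Set.range P.spoke
    · rw [hj.outerPart_of_mem hσ.1 hx]
    · exact (hj.outerPart_of_notMem hσ.1 hx).2
  vtx_ne x hx h :=
    hσ.1.vtx_ne (j x) ((hj.outerPart_of_notMem hσ.1 hx).1 ▸ hj.map_vtx _ _ h)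
  simple x y h := (hj.isSimpleExtension hσ).simple x y (hj.linked_map hσ.1 h)

theorem ncard_eq_sum [Finite (Flag Γ)] [Finite (OuterFlag P)] :
    (circuitTransitions Γ).ncard =
      ∑ ς ∈ outerTransitions P, {σ ∈ circuitTransitions Γ | outerPart j σ = ς}.ncard := by
  classical
  have hfin : (circuitTransitions Γ).Finite := Set.toFinite _
  rw [Set.ncard_eq_toFinset_card _ hfin, Finset.card_eq_sum_card_fiberwise fun σ hσ =>
    mem_outerTransitions.2 (hj.isOuterTransition (hfin.mem_toFinset.1 hσ))]
  refine Finset.sum_congr rfl fun ς _ => ?_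
  rw [← Set.ncard_coe_finset]
  congr 1
  ext σ
  simp

end IsOuterEmbedding

end OuterPart

end FiveCycle

/-! ### Gluing a transition system at the 5-cycle to an outer one -/

theorem OuterSystem.not_meets_of_getD_eq {X : Type*} {τ : X → X} {vt : X → α} {t : Side → X}
    {σ : X → X} {ρ : Fin 5 → Fin 5} (h : OuterSystem τ vt t σ)
    (hρ : ∀ s s', Linked σ τ (t s) (t s') ↔ pathAt ρ s = pathAt ρ s') {labels : List ℕ}
    (hD : mergedPairs labels ||| disjointPairs τ vt t σ = disjointPairs τ vt t σ) {s s' : Side}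
    (heq : labels.getD (pathAt ρ s) 0 = labels.getD (pathAt ρ s') 0)
    (hne : pathAt ρ s ≠ pathAt ρ s') : ¬ Meets τ vt σ (t s) (t s') := by
  rw [mergedPairs_lor_disjointPairs_eq_iff] at hD
  have mem_pathPairs : ∀ i j : Fin 5, i ≠ j → (i, j) ∈ pathPairs ∨ (j, i) ∈ pathPairs := by decide
  intro hm
  have hm' : Meets τ vt σ (t (pathAt ρ s, true)) (t (pathAt ρ s', true)) :=
    hm.congr ((hρ _ _).2 rfl) ((hρ _ _).2 rfl)
  rcases mem_pathPairs _ _ hne with hp | hp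
  · exact hD _ hp heq hm'
  · exact hD _ hp heq.symm (h.meets_symm hm')

theorem pathPatterns_codes :
    ∀ row ∈ pathPatterns, row.2.Nodup ∧ ∀ c ∈ row.2, c.1 < 2 ^ 5 ∧ c.2 < 2 ^ 5 := by
  decide +kernel

theorem eq_of_testBit_eq_of_lt_two_pow {k m n : ℕ} (hm : m < 2 ^ k) (hn : n < 2 ^ k)
    (h : ∀ i < k, m.testBit i = n.testBit i) : m = n :=
  Nat.eq_of_testBit_eq fun i => (lt_or_ge i k).elim (h i) fun hi => by
    have hpow : 2 ^ k ≤ 2 ^ i := Nat.pow_le_pow_right two_pos hi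
    rw [Nat.testBit_lt_two_pow (hm.trans_le hpow), Nat.testBit_lt_two_pow (hn.trans_le hpow)]

theorem countBelow_le_ncard {T K : Type*} {D : ℕ} {merges : T → ℕ} {l : List T} (hl : l.Nodup)
    {S : Set K} (hS : S.Finite) {f : T → K} (hf : ∀ x ∈ l, merges x ||| D = D → f x ∈ S)
    (hinj : ∀ x ∈ l, ∀ y ∈ l, f x = f y → x = y) : countBelow D merges l ≤ S.ncard := by
  classical
  set L := l.filter fun x => (merges x ||| D).beq D
  have mem_of_mem {x : T} (hx : x ∈ L) : x ∈ l := List.mem_of_mem_filter hx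
  calc countBelow D merges l = (L.toFinset : Set T).ncard := by
        rw [Set.ncard_coe_finset, List.toFinset_card_of_nodup (hl.filter _),
          ← List.countP_eq_length_filter, countBelow]
    _ ≤ S.ncard := Set.ncard_le_ncard_of_injOn f
        (fun x hx => hf x (mem_of_mem (List.mem_toFinset.1 hx))
          (Nat.beq_eq ▸ (List.mem_filter.1 (List.mem_toFinset.1 hx)).2))
        (fun x hx y hy => hinj x (mem_of_mem (List.mem_toFinset.1 hx)) y
          (mem_of_mem (List.mem_toFinset.1 hy))) hS

/-- Labels of the five paths and the corners of the 5-cycle that are constant along the walks of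
the transition system with code `c`, and distinguish the three corners at every vertex. -/
structure WalkLabelling (ρ : Fin 5 → Fin 5) (c : ℕ × ℕ) (lab : ℕ → ℕ) : Prop where
  spoke : ∀ s, lab (pathAt ρ s) = lab (corner s.1 (flipSide c.1 s).2.toNat)
  rim : ∀ s, lab (corner s.1 (1 + s.2.toNat)) =
    lab (corner (s.1 + 1) (2 * (flipSide c.2 s).2.toNat))
  corner_injective : ∀ i (k k' : Fin 3), lab (corner i k) = lab (corner i k') → k = k'

theorem walkLabelling_componentLabels {row : (Fin 5 → Fin 5) × List (ℕ × ℕ)}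
    (hrow : row ∈ pathPatterns) {c : ℕ × ℕ} (hc : c ∈ row.2) :
    WalkLabelling row.1 c fun k => (componentLabels 20 (pentagonLinks row.1 c)).getD k 0 := by
  have corner_lt (i : Fin 5) {k : ℕ} (hk : k ≤ 2) : corner i k < 20 := by
    rw [corner]
    omega
  have toNat_le (b : Bool) : b.toNat ≤ 1 := Bool.toNat_le b
  refine ⟨fun s => ?_, fun s => ?_, fun i k k' h => ?_⟩
  · exact getD_componentLabels_of_mem (List.mem_flatMap.2 ⟨s, mem_sides s, by simp⟩) (by omega)
      (corner_lt _ ((toNat_le _).trans one_le_two))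
  · have hrim := toNat_le (flipSide c.2 s).2
    exact getD_componentLabels_of_mem (List.mem_flatMap.2 ⟨s, mem_sides s, by simp⟩)
      (corner_lt _ (Nat.add_le_add_left (toNat_le _) 1)) (corner_lt _ (by omega))
  · have hnodup := nodup_corners_pathPatterns row hrow c hc i
    fin_cases k <;> fin_cases k' <;> simp_all

section Glue

variable {P : FiveCycle G}

theorem IsProper.isOuterEmbedding_val (hP : IsProper P) :
    IsOuterEmbedding (P := P) (Γ := G) Subtype.val where
  injective := Subtype.val_injective
  map_swap _ := rfl
  map_vtx _ _ h := h
  exists_next σ hσ x hx := by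
    refine ⟨⟨σ x.1, ?_⟩, rfl, hσ.edge_eq x.1⟩
    rintro ⟨i, hi⟩
    have hmem : x.1.edge ∈ G.incidenceSet (P.vert i) := by
      rw [hi]
      exact (hσ.isLink x.1).inc_right
    rw [hP.incidenceSet_vert] at hmem
    rcases hmem with he | he | he
    exacts [x.edge_ne_rim _ he, x.edge_ne_rim _ he, hx ⟨i, he.symm⟩]
  not_exists_next σ hσ x hx := by
    rintro ⟨y, hxy, he⟩
    obtain ⟨i, hi⟩ := hx
    refine hσ.vtx_ne x.1 ?_
    rw [hxy, OuterFlag.vtx_of_edge_eq_spoke hi.symm,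
      OuterFlag.vtx_of_edge_eq_spoke (he.trans hi.symm)]

/-- The flags of the graph by their position relative to the 5-cycle. The first edge of a flag at
vertex `i` of the 5-cycle is the spoke, the rim edge `i`, or the rim edge `i - 1`; the Boolean tells
which of the other two edges comes second. -/
inductive SortedFlag (P : FiveCycle G)
  | out (x : OuterFlag P)
  | spoke (s : Side)
  | rimOut (s : Side)
  | rimIn (s : Side)

namespace SortedFlag

/-- The flag at a given position. -/
def toFlag : SortedFlag P → Flag G
  | out x => x.1
  | spoke (i, false) => ⟨P.vert i, P.spoke i, P.rim (i - 1), inc_spoke_self P i,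
      inc_rim_sub_one P i, P.spoke_ne_rim _ _⟩
  | spoke (i, true) => ⟨P.vert i, P.spoke i, P.rim i, inc_spoke_self P i, inc_rim_self P i,
      P.spoke_ne_rim _ _⟩
  | rimOut (i, false) => ⟨P.vert i, P.rim i, P.spoke i, inc_rim_self P i, inc_spoke_self P i,
      (P.spoke_ne_rim _ _).symm⟩
  | rimOut (i, true) => ⟨P.vert i, P.rim i, P.rim (i - 1), inc_rim_self P i, inc_rim_sub_one P i,
      (rim_sub_one_ne P i).symm⟩
  | rimIn (i, false) => ⟨P.vert i, P.rim (i - 1), P.spoke i, inc_rim_sub_one P i,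
      inc_spoke_self P i, (P.spoke_ne_rim _ _).symm⟩
  | rimIn (i, true) => ⟨P.vert i, P.rim (i - 1), P.rim i, inc_rim_sub_one P i, inc_rim_self P i,
      rim_sub_one_ne P i⟩

theorem vtx_spoke (s : Side) : (toFlag (spoke s : SortedFlag P)).vtx = P.vert s.1 := by
  obtain ⟨i, _ | _⟩ := s <;> rfl

theorem vtx_rimOut (s : Side) : (toFlag (rimOut s : SortedFlag P)).vtx = P.vert s.1 := by
  obtain ⟨i, _ | _⟩ := s <;> rfl

theorem vtx_rimIn (s : Side) : (toFlag (rimIn s : SortedFlag P)).vtx = P.vert s.1 := by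
  obtain ⟨i, _ | _⟩ := s <;> rfl

theorem edge_spoke (s : Side) : (toFlag (spoke s : SortedFlag P)).edge = P.spoke s.1 := by
  obtain ⟨i, _ | _⟩ := s <;> rfl

theorem edge_rimOut (s : Side) : (toFlag (rimOut s : SortedFlag P)).edge = P.rim s.1 := by
  obtain ⟨i, _ | _⟩ := s <;> rfl

theorem edge_rimIn (s : Side) : (toFlag (rimIn s : SortedFlag P)).edge = P.rim (s.1 - 1) := by
  obtain ⟨i, _ | _⟩ := s <;> rfl

/-- Exchanges the two edges of a flag. -/
def swap : SortedFlag P → SortedFlag P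
  | out x => out x.swap
  | spoke (i, false) => rimIn (i, false)
  | spoke (i, true) => rimOut (i, false)
  | rimOut (i, false) => spoke (i, true)
  | rimOut (i, true) => rimIn (i, true)
  | rimIn (i, false) => spoke (i, false)
  | rimIn (i, true) => rimOut (i, true)

theorem toFlag_swap (a : SortedFlag P) : toFlag a.swap = (toFlag a).swap := by
  rcases a with x | ⟨i, _ | _⟩ | ⟨i, _ | _⟩ | ⟨i, _ | _⟩ <;> rfl

theorem swap_swap (a : SortedFlag P) : a.swap.swap = a := by
  rcases a with x | ⟨i, _ | _⟩ | ⟨i, _ | _⟩ | ⟨i, _ | _⟩ <;> rfl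

/-- A flag at the corner `k` of vertex `i` of the 5-cycle. -/
def atCorner (i : Fin 5) : Fin 3 → SortedFlag P
  | 0 => spoke (i, false)
  | 1 => spoke (i, true)
  | 2 => rimOut (i, true)

theorem exists_eq_out_or_eq_atCorner (a : SortedFlag P) :
    (∃ x, a = out x) ∨ ∃ i k, a = atCorner i k ∨ a = (atCorner i k).swap := by
  rcases a with x | ⟨i, _ | _⟩ | ⟨i, _ | _⟩ | ⟨i, _ | _⟩
  · exact Or.inl ⟨x, rfl⟩
  · exact Or.inr ⟨i, 0, Or.inl rfl⟩
  · exact Or.inr ⟨i, 1, Or.inl rfl⟩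
  · exact Or.inr ⟨i, 1, Or.inr rfl⟩
  · exact Or.inr ⟨i, 2, Or.inl rfl⟩
  · exact Or.inr ⟨i, 0, Or.inr rfl⟩
  · exact Or.inr ⟨i, 2, Or.inr rfl⟩

theorem toFlag_injective : Function.Injective (toFlag (P := P)) := by
  have hspoke := P.spoke_ne_rim
  have hrim := rim_sub_one_ne P
  have hvert {i j : Fin 5} (h : P.vert i = P.vert j) : i = j := P.vert_injective h
  rintro (⟨x, hx⟩ | ⟨i, _ | _⟩ | ⟨i, _ | _⟩ | ⟨i, _ | _⟩)
    (⟨y, hy⟩ | ⟨j, _ | _⟩ | ⟨j, _ | _⟩ | ⟨j, _ | _⟩) h <;>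
  simp only [toFlag, Flag.mk.injEq] at h <;> grind

theorem toFlag_surjective (hP : IsProper P) : Function.Surjective (toFlag (P := P)) := by
  intro φ
  by_cases hφ : φ.vtx ∈ Set.range P.vert
  · obtain ⟨i, hi⟩ := hφ
    have he : φ.edge ∈ G.incidenceSet (P.vert i) := hi ▸ φ.inc_edge
    have ho : φ.other ∈ G.incidenceSet (P.vert i) := hi ▸ φ.inc_other
    have hne := φ.edge_ne_other
    rw [hP.incidenceSet_vert] at he ho
    rcases he with he | he | he <;> rcases ho with ho | ho | ho
    · exact absurd (he.trans ho.symm) hne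
    · exact ⟨rimIn (i, true), Flag.ext hi he.symm ho.symm⟩
    · exact ⟨rimIn (i, false), Flag.ext hi he.symm ho.symm⟩
    · exact ⟨rimOut (i, true), Flag.ext hi he.symm ho.symm⟩
    · exact absurd (he.trans ho.symm) hne
    · exact ⟨rimOut (i, false), Flag.ext hi he.symm ho.symm⟩
    · exact ⟨spoke (i, false), Flag.ext hi he.symm ho.symm⟩
    · exact ⟨spoke (i, true), Flag.ext hi he.symm ho.symm⟩
    · exact absurd (he.trans ho.symm) hne
  · exact ⟨out ⟨φ, hφ⟩, rfl⟩

open Classical in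
/-- The transition system with outer part `σ` and code `c` at the 5-cycle, as in `pentagonLinks`,
where `t` labels the loose flags of the outer part. -/
noncomputable def next (σ : OuterFlag P → OuterFlag P) (t : Side → OuterFlag P) (c : ℕ × ℕ) :
    SortedFlag P → SortedFlag P
  | out x => if h : ∃ s, t s = x then spoke (flipSide c.1 h.choose) else out (σ x)
  | spoke s => out (t (flipSide c.1 s))
  | rimOut s => rimIn (s.1 + 1, (flipSide c.2 s).2)
  | rimIn s => rimOut (flipSide c.2 (s.1 - 1, s.2))

variable {σ : OuterFlag P → OuterFlag P} {t : Side → OuterFlag P} {c : ℕ × ℕ}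

theorem next_side (ht : Function.Injective t) (s : Side) :
    next σ t c (out (t s)) = spoke (flipSide c.1 s) := by
  have h : ∃ s', t s' = t s := ⟨s, rfl⟩
  rw [next, dif_pos h, ht h.choose_spec]

theorem next_of_ne {x : OuterFlag P} (h : ¬ ∃ s, t s = x) : next σ t c (out x) = out (σ x) := by
  rw [next, dif_neg h]

theorem next_next (hσ : IsOuterTransition σ) (ht : IsSideLabelling t) (a : SortedFlag P) :
    next σ t c (next σ t c a) = a := by
  rcases a with x | s | s | s
  · by_cases h : ∃ s, t s = x
    · obtain ⟨s, rfl⟩ := h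
      rw [next_side ht.injective, next, flipSide_flipSide]
    · have h' : ¬ ∃ s, t s = σ x := by
        rw [← (hσ.outerSystem ht).fixed_iff] at h ⊢
        rw [hσ.involutive]
        exact fun h' => h h'.symm
      rw [next_of_ne h, next_of_ne h', hσ.involutive]
  · rw [next, next_side ht.injective, flipSide_flipSide]
  · simp [next, flipSide]
  · simp [next, flipSide]

theorem edge_next (hσ : IsOuterTransition σ) (ht : IsSideLabelling t) (a : SortedFlag P) :
    (toFlag (next σ t c a)).edge = (toFlag a).edge := by
  rcases a with x | s | s | s
  · by_cases h : ∃ s, t s = x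
    · obtain ⟨s, rfl⟩ := h
      rw [next_side ht.injective, edge_spoke]
      exact (ht.edge_eq s).symm
    · rw [next_of_ne h]
      exact hσ.edge_eq x
  · rw [edge_spoke]
    exact ht.edge_eq _
  · rw [next, edge_rimIn, edge_rimOut, add_sub_cancel_right]
  · rw [next, edge_rimOut, edge_rimIn, flipSide]

theorem vtx_next_ne (hσ : IsOuterTransition σ) (ht : IsSideLabelling t) (a : SortedFlag P) :
    (toFlag (next σ t c a)).vtx ≠ (toFlag a).vtx := by
  rcases a with x | s | s | s
  · by_cases h : ∃ s, t s = x
    · obtain ⟨s, rfl⟩ := h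
      rw [next_side ht.injective, vtx_spoke]
      exact fun h => (t s).2 ⟨_, h⟩
    · rw [next_of_ne h]
      refine hσ.vtx_ne x ?_
      rwa [← hσ.fixed_iff, (hσ.outerSystem ht).fixed_iff]
  · rw [vtx_spoke, next]
    exact fun h => (t (flipSide c.1 s)).2 ⟨_, h.symm⟩
  · rw [next, vtx_rimIn, vtx_rimOut]
    exact fun h => (by decide : ∀ i : Fin 5, i + 1 ≠ i) _ (P.vert_injective h)
  · rw [next, vtx_rimOut, vtx_rimIn]
    exact fun h => (by decide : ∀ i : Fin 5, i - 1 ≠ i) _ (P.vert_injective h)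

theorem eq_of_next_eq {c' : ℕ × ℕ} (ht : Function.Injective t) (hc : c.1 < 2 ^ 5 ∧ c.2 < 2 ^ 5)
    (hc' : c'.1 < 2 ^ 5 ∧ c'.2 < 2 ^ 5) (h : next σ t c = next σ t c') : c = c' := by
  refine Prod.ext (eq_of_testBit_eq_of_lt_two_pow hc.1 hc'.1 fun i hi => ?_)
    (eq_of_testBit_eq_of_lt_two_pow hc.2 hc'.2 fun i hi => ?_)
  · have hspoke := congrFun h (spoke (⟨i, hi⟩, false))
    simp only [next, SortedFlag.out.injEq] at hspoke
    simpa [flipSide] using congrArg Prod.snd (ht hspoke)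
  · simpa [next, flipSide] using congrFun h (rimOut (⟨i, hi⟩, false))

open Classical in
/-- A label of the walk through a flag: the label of the path for a path that ends at a spoke and
the walk itself for the other walks off the 5-cycle. -/
noncomputable def walkLabel (σ : OuterFlag P → OuterFlag P) (t : Side → OuterFlag P)
    (ρ : Fin 5 → Fin 5) (lab : ℕ → ℕ) : SortedFlag P → ℕ ⊕ Set (OuterFlag P)
  | out x => if h : ∃ s, Linked σ OuterFlag.swap x (t s) then .inl (lab (pathAt ρ h.choose))
      else .inr {y | Linked σ OuterFlag.swap x y}
  | spoke s => .inl (lab (corner s.1 s.2.toNat))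
  | rimOut s => .inl (lab (corner s.1 (1 + s.2.toNat)))
  | rimIn s => .inl (lab (corner s.1 (2 * s.2.toNat)))

section WalkLabel

variable {ρ : Fin 5 → Fin 5} {lab : ℕ → ℕ}
  (hρ : ∀ s s', Linked σ OuterFlag.swap (t s) (t s') ↔ pathAt ρ s = pathAt ρ s')

theorem walkLabel_of_not_exists {x : OuterFlag P} (h : ¬ ∃ s, Linked σ OuterFlag.swap x (t s)) :
    walkLabel σ t ρ lab (out x) = .inr {y | Linked σ OuterFlag.swap x y} := by
  rw [walkLabel, dif_neg h]

theorem vtx_atCorner (i : Fin 5) (k : Fin 3) :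
    (toFlag (atCorner i k : SortedFlag P)).vtx = P.vert i := by
  fin_cases k <;> rfl

theorem walkLabel_atCorner (i : Fin 5) (k : Fin 3) :
    walkLabel σ t ρ lab (atCorner i k) = .inl (lab (corner i k)) := by
  fin_cases k <;> rfl

include hρ

theorem walkLabel_of_linked {x : OuterFlag P} {s : Side} (h : Linked σ OuterFlag.swap x (t s)) :
    walkLabel σ t ρ lab (out x) = .inl (lab (pathAt ρ s)) := by
  have h' : ∃ s, Linked σ OuterFlag.swap x (t s) := ⟨s, h⟩
  rw [walkLabel, dif_pos h', (hρ _ _).1 (h'.choose_spec.symm.trans h)]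

theorem walkLabel_congr {x y : OuterFlag P} (h : Linked σ OuterFlag.swap x y) :
    walkLabel σ t ρ lab (out x) = walkLabel σ t ρ lab (out y) := by
  by_cases hx : ∃ s, Linked σ OuterFlag.swap x (t s)
  · obtain ⟨s, hs⟩ := hx
    rw [walkLabel_of_linked hρ hs, walkLabel_of_linked hρ (h.symm.trans hs)]
  · have hy : ¬ ∃ s, Linked σ OuterFlag.swap y (t s) := fun ⟨s, hs⟩ => hx ⟨s, h.trans hs⟩
    rw [walkLabel_of_not_exists hx, walkLabel_of_not_exists hy]
    congr 1
    ext z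
    exact ⟨h.symm.trans, h.trans⟩

theorem walkLabel_swap (a : SortedFlag P) : walkLabel σ t ρ lab a.swap = walkLabel σ t ρ lab a := by
  rcases a with x | ⟨i, _ | _⟩ | ⟨i, _ | _⟩ | ⟨i, _ | _⟩
  · exact (walkLabel_congr hρ (Linked.snd x)).symm
  all_goals rfl

theorem walkLabel_next (ht : IsSideLabelling t) (hlab : WalkLabelling ρ c lab)
    (a : SortedFlag P) : walkLabel σ t ρ lab (next σ t c a) = walkLabel σ t ρ lab a := by
  rcases a with x | s | s | s
  · by_cases h : ∃ s, t s = x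
    · obtain ⟨s, rfl⟩ := h
      rw [next_side ht.injective, walkLabel_of_linked hρ (Linked.refl _), hlab.spoke]
      rfl
    · rw [next_of_ne h]
      exact (walkLabel_congr hρ (Linked.fst x)).symm
  · rw [next, walkLabel_of_linked hρ (Linked.refl _), hlab.spoke, flipSide_flipSide]
    rfl
  · exact congrArg Sum.inl (hlab.rim s).symm
  · have hrim := hlab.rim (flipSide c.2 (s.1 - 1, s.2))
    rw [flipSide_flipSide] at hrim
    simp only [flipSide, sub_add_cancel] at hrim
    exact congrArg Sum.inl hrim

theorem linked_or_exists_of_walkLabel_eq {x y : OuterFlag P}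
    (h : walkLabel σ t ρ lab (out x) = walkLabel σ t ρ lab (out y)) :
    Linked σ OuterFlag.swap x y ∨ ∃ s s', Linked σ OuterFlag.swap x (t s) ∧
      Linked σ OuterFlag.swap y (t s') ∧ lab (pathAt ρ s) = lab (pathAt ρ s') := by
  by_cases hx : ∃ s, Linked σ OuterFlag.swap x (t s) <;>
  by_cases hy : ∃ s, Linked σ OuterFlag.swap y (t s)
  · obtain ⟨s, hs⟩ := hx
    obtain ⟨s', hs'⟩ := hy
    rw [walkLabel_of_linked hρ hs, walkLabel_of_linked hρ hs'] at h
    exact Or.inr ⟨s, s', hs, hs', Sum.inl_injective h⟩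
  · obtain ⟨s, hs⟩ := hx
    rw [walkLabel_of_linked hρ hs, walkLabel_of_not_exists hy] at h
    exact absurd h Sum.inl_ne_inr
  · obtain ⟨s, hs⟩ := hy
    rw [walkLabel_of_linked hρ hs, walkLabel_of_not_exists hx] at h
    exact absurd h Sum.inr_ne_inl
  · rw [walkLabel_of_not_exists hx, walkLabel_of_not_exists hy] at h
    have hmem : y ∈ {z | Linked σ OuterFlag.swap x z} :=
      Sum.inr_injective h ▸ Linked.refl y
    exact Or.inl hmem

variable (hm : ∀ s s', lab (pathAt ρ s) = lab (pathAt ρ s') → pathAt ρ s ≠ pathAt ρ s' →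
  ¬ Meets OuterFlag.swap (fun x => x.1.vtx) σ (t s) (t s'))
include hm

theorem eq_or_eq_swap_of_walkLabel_out_eq (hσ : IsOuterTransition σ) {x y : OuterFlag P}
    (hxy : walkLabel σ t ρ lab (out x) = walkLabel σ t ρ lab (out y)) (hv : x.1.vtx = y.1.vtx) :
    y = x ∨ y = x.swap := by
  by_cases hl : Linked σ OuterFlag.swap x y
  · exact hσ.simple x y hl hv
  · obtain ⟨s, s', hs, hs', hlab⟩ := (linked_or_exists_of_walkLabel_eq hρ hxy).resolve_left hl
    have hne : pathAt ρ s ≠ pathAt ρ s' := fun h =>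
      hl (hs.trans (((hρ _ _).2 h).trans hs'.symm))
    by_contra hcon
    rw [not_or] at hcon
    exact hm s s' hlab hne ⟨x, y, hs.symm, hs'.symm, hv, hcon⟩

theorem eq_or_eq_swap_of_walkLabel_eq (hσ : IsOuterTransition σ) (hlab : WalkLabelling ρ c lab)
    {a b : SortedFlag P} (hab : walkLabel σ t ρ lab a = walkLabel σ t ρ lab b)
    (hv : (toFlag a).vtx = (toFlag b).vtx) : b = a ∨ b = a.swap := by
  have at_corner {a : SortedFlag P} {i k} (h : a = atCorner i k ∨ a = (atCorner i k).swap) :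
      (toFlag a).vtx = P.vert i ∧ walkLabel σ t ρ lab a = .inl (lab (corner i k)) := by
    rcases h with rfl | rfl
    · exact ⟨vtx_atCorner i k, walkLabel_atCorner i k⟩
    · rw [toFlag_swap, walkLabel_swap hρ]
      exact ⟨vtx_atCorner i k, walkLabel_atCorner i k⟩
  rcases exists_eq_out_or_eq_atCorner a with ⟨x, rfl⟩ | ⟨i, k, hik⟩ <;>
  rcases exists_eq_out_or_eq_atCorner b with ⟨y, rfl⟩ | ⟨j, l, hjl⟩
  · exact (eq_or_eq_swap_of_walkLabel_out_eq hρ hm hσ hab hv).imp (congrArg out) (congrArg out)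
  · exact absurd ⟨j, (hv.trans (at_corner hjl).1).symm⟩ x.2
  · exact absurd ⟨i, (hv.symm.trans (at_corner hik).1).symm⟩ y.2
  · obtain rfl : i = j :=
      P.vert_injective ((at_corner hik).1.symm.trans (hv.trans (at_corner hjl).1))
    obtain rfl : k = l := hlab.corner_injective i k l <| Sum.inl_injective <|
      (at_corner hik).2.symm.trans (hab.trans (at_corner hjl).2)
    rcases hik with rfl | rfl <;> rcases hjl with rfl | rfl <;> simp [swap_swap]

end WalkLabel

end SortedFlag

open SortedFlag

/-- The bijection from the sorted flags to the flags. -/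
noncomputable def IsProper.flagEquiv (hP : IsProper P) : SortedFlag P ≃ Flag G :=
  Equiv.ofBijective toFlag ⟨toFlag_injective, toFlag_surjective hP⟩

/-- The transition system of the whole graph glued from an outer part and a code at the 5-cycle. -/
noncomputable def glue (hP : IsProper P) (σ : OuterFlag P → OuterFlag P) (t : Side → OuterFlag P)
    (c : ℕ × ℕ) : Flag G → Flag G :=
  hP.flagEquiv.conj (next σ t c)

section GluedTransition

variable {σ : OuterFlag P → OuterFlag P} {t : Side → OuterFlag P} {c : ℕ × ℕ} (hP : IsProper P)

theorem glue_toFlag (a : SortedFlag P) : glue hP σ t c (toFlag a) = toFlag (next σ t c a) :=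
  congrArg (fun a => toFlag (next σ t c a)) (hP.flagEquiv.symm_apply_apply a)

variable (hσ : IsOuterTransition σ) (ht : IsSideLabelling t)
include hP hσ ht

theorem isTransition_glue : IsTransition (glue hP σ t c) where
  involutive φ := by
    obtain ⟨a, rfl⟩ := toFlag_surjective hP φ
    rw [glue_toFlag, glue_toFlag, next_next hσ ht]
  edge_eq φ := by
    obtain ⟨a, rfl⟩ := toFlag_surjective hP φ
    rw [glue_toFlag, edge_next hσ ht]
  vtx_ne φ := by
    obtain ⟨a, rfl⟩ := toFlag_surjective hP φ
    rw [glue_toFlag]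
    exact vtx_next_ne hσ ht a

theorem outerPart_glue : outerPart Subtype.val (glue hP σ t c) = σ := by
  have hj := hP.isOuterEmbedding_val
  have hT := isTransition_glue (c := c) hP hσ ht
  funext x
  by_cases hx : x.1.edge ∈ Set.range P.spoke
  · rw [hj.outerPart_of_mem hT hx, (hσ.fixed_iff x).2 hx]
  · have hside : ¬ ∃ s, t s = x := by
      rwa [← hσ.fixed_iff, (hσ.outerSystem ht).fixed_iff] at hx
    refine Subtype.val_injective ((hj.outerPart_of_notMem hT hx).1.trans ?_)
    exact (glue_toFlag hP (out x)).trans (congrArg toFlag (next_of_ne hside))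

variable {ρ : Fin 5 → Fin 5} {lab : ℕ → ℕ}

theorem isSimpleTransition_glue
    (hρ : ∀ s s', Linked σ OuterFlag.swap (t s) (t s') ↔ pathAt ρ s = pathAt ρ s')
    (hlab : WalkLabelling ρ c lab)
    (hm : ∀ s s', lab (pathAt ρ s) = lab (pathAt ρ s') → pathAt ρ s ≠ pathAt ρ s' →
      ¬ Meets OuterFlag.swap (fun x => x.1.vtx) σ (t s) (t s')) :
    IsSimpleTransition (glue hP σ t c) := by
  intro φ ψ hl hv
  have hlabel := Linked.map_eq (fun φ => walkLabel σ t ρ lab (hP.flagEquiv.symm φ))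
    (fun φ => (congrArg _ (hP.flagEquiv.symm_apply_apply _)).trans (walkLabel_next hρ ht hlab _))
    (fun φ => by
      obtain ⟨a, rfl⟩ := hP.flagEquiv.surjective φ
      have hswap : (hP.flagEquiv a).swap = hP.flagEquiv a.swap := (toFlag_swap a).symm
      rw [hswap, Equiv.symm_apply_apply, Equiv.symm_apply_apply, walkLabel_swap hρ]) hl
  obtain ⟨a, rfl⟩ := hP.flagEquiv.surjective φ
  obtain ⟨b, rfl⟩ := hP.flagEquiv.surjective ψ
  rw [Equiv.symm_apply_apply, Equiv.symm_apply_apply] at hlabel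
  exact (eq_or_eq_swap_of_walkLabel_eq hρ hm hσ hlab hlabel hv).imp (congrArg toFlag)
    fun h => (congrArg toFlag h).trans (toFlag_swap a)

theorem countBelow_pentagonMerges_le_ncard [Finite (Flag G)]
    {row : (Fin 5 → Fin 5) × List (ℕ × ℕ)} (hrow : row ∈ pathPatterns)
    (hρ : ∀ s s', Linked σ OuterFlag.swap (t s) (t s') ↔ pathAt row.1 s = pathAt row.1 s') :
    countBelow (disjointPairs OuterFlag.swap (fun x => x.1.vtx) t σ) (pentagonMerges row.1) row.2 ≤
      {σ' ∈ circuitTransitions G | outerPart (P := P) Subtype.val σ' = σ}.ncard := by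
  obtain ⟨hnodup, hlt⟩ := pathPatterns_codes row hrow
  refine countBelow_le_ncard hnodup (Set.toFinite _) (f := glue hP σ t) (fun c hc hD => ?_)
    fun c hc c' hc' h => eq_of_next_eq ht.injective (hlt c hc) (hlt c' hc')
      (hP.flagEquiv.conj.injective h)
  exact ⟨⟨isTransition_glue hP hσ ht, isSimpleTransition_glue hP hσ ht hρ
    (walkLabelling_componentLabels hrow hc) fun s s' =>
      (hσ.outerSystem ht).not_meets_of_getD_eq hρ hD⟩, outerPart_glue hP hσ ht⟩

end GluedTransition

end Glue

/-! ### The replacements of the 5-cycle -/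

section Replace

variable {P : FiveCycle G} {a b c i : Fin 5} {e e' : β} {x y : α} {z w : Option α}

theorem collapse_of_notMem (h : x ∉ Set.range P.vert) : P.collapse x = some x := if_neg h

theorem collapse_vert (P : FiveCycle G) (i : Fin 5) : P.collapse (P.vert i) = none :=
  if_pos ⟨i, rfl⟩

theorem collapse_eq_none : P.collapse x = none ↔ x ∈ Set.range P.vert := by
  rw [FiveCycle.collapse]
  split_ifs with h <;> simp [h]

theorem collapse_eq_some : P.collapse x = some y ↔ x = y ∧ y ∉ Set.range P.vert := by
  rw [FiveCycle.collapse]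
  split_ifs with h
  · exact ⟨nofun, fun ⟨hxy, hy⟩ => absurd (hxy ▸ h) hy⟩
  · exact ⟨fun hxy => ⟨Option.some.inj hxy, Option.some.inj hxy ▸ h⟩, fun hxy => congrArg _ hxy.1⟩

theorem replace_isLink_some : (P.replace a b).IsLink (some e) z w ↔
    (e ∉ Set.range P.rim ∧ e ≠ P.spoke a ∧ e ≠ P.spoke b) ∧
      ∃ u v, G.IsLink e u v ∧ P.collapse u = z ∧ P.collapse v = w := by
  have hdel (u v : α) : (G.deleteEdges (Set.range P.rim ∪ {P.spoke a, P.spoke b})).IsLink e u v ↔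
      G.IsLink e u v ∧ e ∉ Set.range P.rim ∧ e ≠ P.spoke a ∧ e ≠ P.spoke b := by
    simp only [deleteEdges_isLink, Set.mem_union, Set.mem_insert_iff, Set.mem_singleton_iff, not_or]
  constructor
  · rintro (⟨_, he, u, v, h, hu, hv⟩ | ⟨h, -⟩)
    · obtain rfl := Option.some.inj he
      obtain ⟨huv, hkept⟩ := (hdel u v).1 h
      exact ⟨hkept, u, v, huv, hu, hv⟩
    · cases h
  · rintro ⟨hkept, u, v, huv, hu, hv⟩
    exact Or.inl ⟨e, rfl, u, v, (hdel u v).2 ⟨huv, hkept⟩, hu, hv⟩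

theorem replace_isLink_none : (P.replace a b).IsLink none z w ↔
    s(z, w) = s(P.collapse (P.outer a), P.collapse (P.outer b)) :=
  ⟨fun h => h.elim (fun ⟨_, he, _⟩ => nomatch he) And.right, fun h => Or.inr ⟨rfl, h⟩⟩

theorem replace_comm (P : FiveCycle G) (a b : Fin 5) : P.replace a b = P.replace b a := by
  refine Graph.ext rfl fun f z w => ?_
  cases f with
  | none =>
    rw [replace_isLink_none, replace_isLink_none, Sym2.eq_swap (a := P.collapse (P.outer a))]
  | some e => rw [replace_isLink_some, replace_isLink_some, and_comm (a := e ≠ P.spoke a)]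

theorem finite_vertexSet_replace (hV : G.vertexSet.Finite) : (P.replace a b).vertexSet.Finite :=
  hV.image _

theorem finite_edgeSet_replace (hE : G.edgeSet.Finite) : (P.replace a b).edgeSet.Finite := by
  refine ((hE.image some).insert none).subset fun f hf => ?_
  obtain ⟨z, w, h⟩ := exists_isLink_of_mem_edgeSet hf
  cases f with
  | none => exact Or.inl rfl
  | some e =>
    obtain ⟨-, u, v, h, -⟩ := replace_isLink_some.1 h
    exact Or.inr ⟨e, h.edge_mem, rfl⟩

theorem replace_inc_some : (P.replace a b).Inc (some e) z ↔
    (e ∉ Set.range P.rim ∧ e ≠ P.spoke a ∧ e ≠ P.spoke b) ∧ ∃ u, G.Inc e u ∧ P.collapse u = z := by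
  constructor
  · rintro ⟨w, h⟩
    obtain ⟨he, u, v, huv, hu, -⟩ := replace_isLink_some.1 h
    exact ⟨he, u, ⟨v, huv⟩, hu⟩
  · rintro ⟨he, u, ⟨v, huv⟩, hu⟩
    exact ⟨_, replace_isLink_some.2 ⟨he, u, v, huv, hu, rfl⟩⟩

theorem replace_inc_none : (P.replace a b).Inc none z ↔
    z = P.collapse (P.outer a) ∨ z = P.collapse (P.outer b) := by
  constructor
  · rintro ⟨w, h⟩
    rw [replace_isLink_none, Sym2.eq_iff] at h
    exact h.imp And.left And.left
  · rintro (rfl | rfl)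
    · exact ⟨_, replace_isLink_none.2 rfl⟩
    · exact ⟨_, replace_isLink_none.2 Sym2.eq_swap⟩

theorem eq_spoke_of_inc_vert (hi : (G.incidenceSet (P.vert i)).encard = 3)
    (he : e ∉ Set.range P.rim) (h : G.Inc e (P.vert i)) : e = P.spoke i := by
  have hmem : e ∈ G.incidenceSet (P.vert i) := h
  rw [incidenceSet_vert_of_encard hi] at hmem
  rcases hmem with rfl | rfl | hs
  exacts [absurd ⟨_, rfl⟩ he, absurd ⟨_, rfl⟩ he, hs]

open Classical in
/-- The edge of the graph `P.replace a b` that takes the place of an edge off the 5-cycle. -/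
noncomputable def replacedEdge (P : FiveCycle G) (a b : Fin 5) (e : β) : Option β :=
  if e = P.spoke a ∨ e = P.spoke b then none else some e

theorem replacedEdge_eq_none : replacedEdge P a b e = none ↔ e = P.spoke a ∨ e = P.spoke b := by
  rw [replacedEdge]
  split_ifs with h <;> simp [h]

theorem replacedEdge_eq_some :
    replacedEdge P a b e = some e' ↔ e = e' ∧ e' ≠ P.spoke a ∧ e' ≠ P.spoke b := by
  rw [replacedEdge]
  split_ifs with h
  · exact ⟨nofun, fun ⟨he, ha, hb⟩ => absurd (he ▸ h) (not_or.2 ⟨ha, hb⟩)⟩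
  · exact ⟨fun he => ⟨Option.some.inj he, not_or.1 (Option.some.inj he ▸ h)⟩,
      fun he => congrArg _ he.1⟩

theorem eq_outer_of_inc_spoke (hx : x ∉ Set.range P.vert) (h : G.Inc (P.spoke i) x) :
    x = P.outer i :=
  (inc_spoke.1 h).resolve_left fun hv => hx ⟨i, hv.symm⟩

theorem injOn_replacedEdge (hab : P.outer a ≠ P.outer b) (hx : x ∉ Set.range P.vert) :
    Set.InjOn (replacedEdge P a b) (G.incidenceSet x) := by
  intro e he e' he' h
  cases hd : replacedEdge P a b e with
  | some d =>
    rw [(replacedEdge_eq_some.1 hd).1, (replacedEdge_eq_some.1 (h.symm.trans hd)).1]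
  | none =>
    rcases replacedEdge_eq_none.1 hd with rfl | rfl <;>
      rcases replacedEdge_eq_none.1 (h.symm.trans hd) with rfl | rfl
    · rfl
    · exact absurd ((eq_outer_of_inc_spoke hx he).symm.trans (eq_outer_of_inc_spoke hx he')) hab
    · exact absurd ((eq_outer_of_inc_spoke hx he').symm.trans (eq_outer_of_inc_spoke hx he)) hab
    · rfl

theorem encard_compl_pair (hab : a ≠ b) : ({a, b}ᶜ : Set (Fin 5)).encard = 3 := by
  have hcard : ∀ a b : Fin 5, a ≠ b → ({a, b}ᶜ : Finset (Fin 5)).card = 3 := by decide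
  have hcoe : (({a, b}ᶜ : Finset (Fin 5)) : Set (Fin 5)) = {a, b}ᶜ := by
    rw [Finset.coe_compl, Finset.coe_pair]
  rw [← hcoe, Set.encard_coe_eq_coe_finsetCard, hcard a b hab]
  rfl

namespace IsProper

variable (hP : IsProper P)
include hP

theorem collapse_outer (i : Fin 5) : P.collapse (P.outer i) = some (P.outer i) :=
  collapse_of_notMem fun ⟨j, hj⟩ => hP.outer_ne_vert i j hj.symm

theorem eq_spoke_of_inc_vert (he : e ∉ Set.range P.rim) (h : G.Inc e (P.vert i)) :
    e = P.spoke i :=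
  CircuitDoubleCover.eq_spoke_of_inc_vert (hP.cubic.encard_incidenceSet _ h.vertex_mem) he h

theorem incidenceSet_replace_some (hx : x ∉ Set.range P.vert) :
    (P.replace a b).incidenceSet (some x) = replacedEdge P a b '' G.incidenceSet x := by
  ext f
  rw [mem_incidenceSet]
  constructor
  · intro hf
    cases f with
    | none =>
      rw [replace_inc_none, hP.collapse_outer, hP.collapse_outer] at hf
      rcases hf with hf | hf
      · exact ⟨P.spoke a, inc_spoke.2 (Or.inr (Option.some.inj hf)),
          replacedEdge_eq_none.2 (Or.inl rfl)⟩
      · exact ⟨P.spoke b, inc_spoke.2 (Or.inr (Option.some.inj hf)),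
          replacedEdge_eq_none.2 (Or.inr rfl)⟩
    | some e =>
      obtain ⟨he, u, hu, hux⟩ := replace_inc_some.1 hf
      obtain ⟨rfl, -⟩ := collapse_eq_some.1 hux
      exact ⟨e, hu, replacedEdge_eq_some.2 ⟨rfl, he.2⟩⟩
  · rintro ⟨e, he, rfl⟩
    by_cases hs : e = P.spoke a ∨ e = P.spoke b
    · rw [replacedEdge_eq_none.2 hs, replace_inc_none, hP.collapse_outer, hP.collapse_outer]
      refine hs.imp ?_ ?_ <;> rintro rfl <;> exact congrArg some (eq_outer_of_inc_spoke hx he)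
    · rw [replacedEdge_eq_some.2 ⟨rfl, not_or.1 hs⟩, replace_inc_some]
      refine ⟨⟨?_, not_or.1 hs⟩, x, he, collapse_of_notMem hx⟩
      rintro ⟨i, rfl⟩
      rcases inc_rim.1 he with rfl | rfl <;> exact hx ⟨_, rfl⟩

theorem incidenceSet_replace_none :
    (P.replace a b).incidenceSet none = some ∘ P.spoke '' {a, b}ᶜ := by
  ext f
  rw [mem_incidenceSet]
  constructor
  · intro hf
    cases f with
    | none =>
      rw [replace_inc_none, hP.collapse_outer, hP.collapse_outer] at hf
      rcases hf with hf | hf <;> cases hf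
    | some e =>
      obtain ⟨⟨hrim, hea, heb⟩, u, hu, hux⟩ := replace_inc_some.1 hf
      obtain ⟨c, rfl⟩ := collapse_eq_none.1 hux
      obtain rfl := hP.eq_spoke_of_inc_vert hrim hu
      refine ⟨c, ?_, rfl⟩
      rintro (rfl | rfl)
      exacts [hea rfl, heb rfl]
  · rintro ⟨c, hc, rfl⟩
    rw [Set.mem_compl_iff, Set.mem_insert_iff, Set.mem_singleton_iff, not_or] at hc
    exact replace_inc_some.2 ⟨⟨fun ⟨i, hi⟩ => P.spoke_ne_rim _ _ hi.symm,
      hP.spoke_injective.ne hc.1, hP.spoke_injective.ne hc.2⟩,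
      P.vert c, inc_spoke_self P c, collapse_vert P c⟩

theorem isLooplessCubic_replace (hab : P.outer a ≠ P.outer b) :
    IsLooplessCubic (P.replace a b) where
  not_isLoopAt f z hf := by
    rw [← isLink_self_iff] at hf
    cases f with
    | none =>
      rw [replace_isLink_none, hP.collapse_outer, hP.collapse_outer, Sym2.eq_iff] at hf
      refine hab (Option.some.inj ?_)
      rcases hf with ⟨ha, hb⟩ | ⟨hb, ha⟩ <;> exact ha.symm.trans hb
    | some e =>
      obtain ⟨he, u, v, huv, hu, hv⟩ := replace_isLink_some.1 hf
      cases z with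
      | some x =>
        obtain ⟨rfl, -⟩ := collapse_eq_some.1 hu
        obtain ⟨rfl, -⟩ := collapse_eq_some.1 hv
        exact hP.cubic.not_isLoopAt _ _ huv
      | none =>
        obtain ⟨i, rfl⟩ := collapse_eq_none.1 hu
        obtain ⟨j, rfl⟩ := collapse_eq_none.1 hv
        obtain rfl := hP.eq_spoke_of_inc_vert he.1 huv.inc_left
        exact hP.outer_ne_vert i j ((P.spoke_isLink i).right_unique huv)
  encard_incidenceSet z hz := by
    obtain ⟨u, hu, rfl⟩ := hz
    by_cases hr : u ∈ Set.range P.vert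
    · rw [collapse_eq_none.2 hr, hP.incidenceSet_replace_none,
        ((Option.some_injective β).comp hP.spoke_injective).encard_image,
        encard_compl_pair fun h => hab (congrArg P.outer h)]
    · rw [collapse_of_notMem hr, hP.incidenceSet_replace_some hr,
        (injOn_replacedEdge hab hr).encard_image, hP.cubic.encard_incidenceSet u hu]

/-- An outer flag as a flag of the graph `P.replace a b`. -/
noncomputable def replacedFlag (hab : P.outer a ≠ P.outer b) (x : OuterFlag P) :
    Flag (P.replace a b) where
  vtx := some x.1.vtx
  edge := replacedEdge P a b x.1.edge
  other := replacedEdge P a b x.1.other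
  inc_edge := by
    rw [← mem_incidenceSet, hP.incidenceSet_replace_some x.2]
    exact ⟨_, x.1.inc_edge, rfl⟩
  inc_other := by
    rw [← mem_incidenceSet, hP.incidenceSet_replace_some x.2]
    exact ⟨_, x.1.inc_other, rfl⟩
  edge_ne_other h := x.1.edge_ne_other
    (injOn_replacedEdge hab x.2 x.1.inc_edge x.1.inc_other h)

theorem exists_replacedFlag_eq (hab : P.outer a ≠ P.outer b) {φ : Flag (P.replace a b)}
    (hφ : φ.vtx ≠ none) : ∃ x, hP.replacedFlag hab x = φ := by
  obtain ⟨v, hφ⟩ := Option.ne_none_iff_exists'.1 hφ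
  have hv : v ∉ Set.range P.vert := by
    obtain ⟨u, -, hu⟩ := φ.inc_edge.vertex_mem
    exact (collapse_eq_some.1 (hu.trans hφ)).2
  have hedge : φ.edge ∈ (P.replace a b).incidenceSet (some v) := hφ ▸ φ.inc_edge
  have hother : φ.other ∈ (P.replace a b).incidenceSet (some v) := hφ ▸ φ.inc_other
  rw [hP.incidenceSet_replace_some hv] at hedge hother
  obtain ⟨e, he, hφe⟩ := hedge
  obtain ⟨f, hf, hφf⟩ := hother
  refine ⟨⟨⟨v, e, f, he, hf, fun h => φ.edge_ne_other ?_⟩, hv⟩, Flag.ext hφ.symm hφe hφf⟩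
  rw [← hφe, ← hφf, h]

theorem replacedFlag_injective (hab : P.outer a ≠ P.outer b) :
    Function.Injective (hP.replacedFlag hab) := by
  intro x y h
  have hv : y.1.vtx = x.1.vtx := Option.some.inj (congrArg Flag.vtx h.symm)
  exact Subtype.ext (Flag.ext hv.symm
    (injOn_replacedEdge hab x.2 x.1.inc_edge (hv ▸ y.1.inc_edge) (congrArg Flag.edge h))
    (injOn_replacedEdge hab x.2 x.1.inc_other (hv ▸ y.1.inc_other) (congrArg Flag.other h)))

theorem isOuterEmbedding_replacedFlag (hab : P.outer a ≠ P.outer b) :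
    IsOuterEmbedding (hP.replacedFlag hab) where
  injective := hP.replacedFlag_injective hab
  map_swap _ := rfl
  map_vtx _ _ h := congrArg some h
  exists_next σ hσ x hx := by
    have hedge : (hP.replacedFlag hab x).edge = some x.1.edge :=
      replacedEdge_eq_some.2 ⟨rfl, fun h => hx ⟨a, h.symm⟩, fun h => hx ⟨b, h.symm⟩⟩
    have hlink := hσ.isLink (hP.replacedFlag hab x)
    rw [hedge] at hlink
    obtain ⟨he, u, v, huv, _, hv⟩ := replace_isLink_some.1 hlink
    have hv_none : (σ (hP.replacedFlag hab x)).vtx ≠ none := by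
      rw [← hv, Ne, collapse_eq_none]
      rintro ⟨i, rfl⟩
      exact hx ⟨i, (hP.eq_spoke_of_inc_vert he.1 huv.inc_right).symm⟩
    obtain ⟨y, hy⟩ := hP.exists_replacedFlag_eq hab hv_none
    refine ⟨y, hy.symm, (replacedEdge_eq_some (P := P) (a := a) (b := b).1 ?_).1⟩
    exact (congrArg Flag.edge hy).trans ((hσ.edge_eq _).trans hedge)
  not_exists_next σ hσ x hx := by
    rintro ⟨y, hy, hedge⟩
    obtain ⟨i, hi⟩ := hx
    refine hσ.vtx_ne (hP.replacedFlag hab x) (hy ▸ congrArg some ?_)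
    rw [OuterFlag.vtx_of_edge_eq_spoke hi.symm,
      OuterFlag.vtx_of_edge_eq_spoke (hedge.trans hi.symm)]

end IsProper

end Replace

section Joins

variable {P : FiveCycle G} {a b : Fin 5}

/-- The transition system `σ` of `P.replace a b` joins the outer flags `x` and `y` along the new
edge or across the new vertex. Here `j` is the embedding of the outer flags. -/
def Joins (j : OuterFlag P → Flag (P.replace a b)) (σ : Flag (P.replace a b) → Flag (P.replace a b))
    (x y : OuterFlag P) : Prop :=
  σ (j x) = j y ∨ (σ (j x)).vtx = none ∧ σ (σ (j x)).swap = j y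

namespace Joins

variable {j : OuterFlag P → Flag (P.replace a b)}
  {σ σ' : Flag (P.replace a b) → Flag (P.replace a b)} {x y z : OuterFlag P}

theorem symm (hσ : IsTransition σ) (h : Joins j σ x y) : Joins j σ y x := by
  rcases h with h | ⟨hv, h⟩
  · exact Or.inl (by rw [← h, hσ.involutive])
  · refine Or.inr ?_
    rw [← h, hσ.involutive, Flag.swap_swap, hσ.involutive]
    exact ⟨hv, rfl⟩

theorem linked (h : Joins j σ x y) : Linked σ Flag.swap (j x) (j y) := by
  rcases h with h | ⟨-, h⟩ <;> rw [← h]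
  exacts [Linked.fst _, (Linked.fst _).trans ((Linked.snd _).trans (Linked.fst _))]

theorem unique (hj : Function.Injective j) (hj_vtx : ∀ x, (j x).vtx ≠ none) (h : Joins j σ x y)
    (h' : Joins j σ x z) : y = z := by
  rcases h with h | ⟨hv, h⟩ <;> rcases h' with h' | ⟨hv', h'⟩
  · exact hj (h.symm.trans h')
  · exact absurd (h ▸ hv') (hj_vtx y)
  · exact absurd (h' ▸ hv) (hj_vtx z)
  · exact hj (h.symm.trans h')

theorem apply_eq_apply (hj_vtx : ∀ x, (j x).vtx ≠ none) (hσ : IsTransition σ)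
    (hσ' : IsTransition σ') (h : Joins j σ x y) (h' : Joins j σ' x y) : σ (j x) = σ' (j x) := by
  have hv : (σ (j x)).vtx = (σ' (j x)).vtx := (hσ.isLink _).right_unique (hσ'.isLink _)
  rcases h with h | ⟨hnone, h⟩ <;> rcases h' with h' | ⟨hnone', h'⟩
  · exact h.trans h'.symm
  · exact absurd (h ▸ hv.trans hnone') (hj_vtx y)
  · exact absurd (h' ▸ hv.symm.trans hnone) (hj_vtx y)
  · refine Flag.ext hv ((hσ.edge_eq _).trans (hσ'.edge_eq _).symm) ?_
    rw [← Flag.swap_edge, ← hσ.edge_eq, h, ← h', hσ'.edge_eq, Flag.swap_edge]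

end Joins

namespace IsProper

variable (hP : IsProper P) (hab : P.outer a ≠ P.outer b)
  {σ σ' : Flag (P.replace a b) → Flag (P.replace a b)} {t : Side → OuterFlag P} {s : Side}

theorem replacedFlag_vtx_ne_none (x : OuterFlag P) : (hP.replacedFlag hab x).vtx ≠ none := nofun

theorem exists_joins_newEdge (hσ : IsTransition σ) (ht : IsSideLabelling t)
    (hs : s.1 = a ∨ s.1 = b) : ∃ s', s.1 ≠ s'.1 ∧ (s'.1 = a ∨ s'.1 = b) ∧
      Joins (hP.replacedFlag hab) σ (t s) (t s') := by
  have hnone : (hP.replacedFlag hab (t s)).edge = none :=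
    replacedEdge_eq_none.2 (ht.edge_eq s ▸ hs.imp (congrArg P.spoke) (congrArg P.spoke))
  have hvtx : (hP.replacedFlag hab (t s)).vtx = some (P.outer s.1) := congrArg some (ht.vtx_eq s)
  have hlink := hσ.isLink (hP.replacedFlag hab (t s))
  have hv_ne := hσ.vtx_ne (hP.replacedFlag hab (t s))
  rw [hvtx] at hv_ne
  rw [hnone, replace_isLink_none, hP.collapse_outer, hP.collapse_outer] at hlink
  have hv : (σ (hP.replacedFlag hab (t s))).vtx ≠ none := by
    rcases Sym2.eq_iff.1 hlink with ⟨-, h⟩ | ⟨-, h⟩ <;> simp [h]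
  obtain ⟨y, hy⟩ := hP.exists_replacedFlag_eq hab hv
  have hy_vtx : some y.1.vtx = (σ (hP.replacedFlag hab (t s))).vtx := congrArg Flag.vtx hy
  have hy_edge : replacedEdge P a b y.1.edge = none :=
    (congrArg Flag.edge hy).trans ((hσ.edge_eq _).trans hnone)
  obtain ⟨c, hc, hyc⟩ : ∃ c, (c = a ∨ c = b) ∧ y.1.edge = P.spoke c :=
    (replacedEdge_eq_none.1 hy_edge).elim (fun h => ⟨a, Or.inl rfl, h⟩) fun h => ⟨b, Or.inr rfl, h⟩
  obtain ⟨k, hk⟩ := ht.exists_of_edge y c hyc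
  refine ⟨(c, k), fun hsc => hv_ne ?_, hc, Or.inl (by rw [hk, hy])⟩
  rw [← hy_vtx, OuterFlag.vtx_of_edge_eq_spoke hyc, hsc]

theorem exists_joins_newVertex (hσ : IsTransition σ) (ht : IsSideLabelling t)
    (hs : ¬ (s.1 = a ∨ s.1 = b)) : ∃ s', s.1 ≠ s'.1 ∧ ¬ (s'.1 = a ∨ s'.1 = b) ∧
      Joins (hP.replacedFlag hab) σ (t s) (t s') := by
  have hedge : (hP.replacedFlag hab (t s)).edge = some (P.spoke s.1) :=
    replacedEdge_eq_some.2 ⟨ht.edge_eq s, hP.spoke_injective.ne (not_or.1 hs).1,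
      hP.spoke_injective.ne (not_or.1 hs).2⟩
  have hlink := hσ.isLink (hP.replacedFlag hab (t s))
  rw [hedge] at hlink
  obtain ⟨-, u, v, huv, hu, hv⟩ := replace_isLink_some.1 hlink
  have hψ : (σ (hP.replacedFlag hab (t s))).vtx = none := by
    rcases (P.spoke_isLink s.1).left_eq_or_eq huv with rfl | rfl
    · exact absurd (hu.symm.trans (collapse_vert P _)) (hP.replacedFlag_vtx_ne_none hab _)
    · exact hv.symm.trans (collapse_vert P _)
  set ψ := σ (hP.replacedFlag hab (t s))
  obtain ⟨c, hc, hψc⟩ : ψ.other ∈ some ∘ P.spoke '' {a, b}ᶜ :=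
    hP.incidenceSet_replace_none (a := a) ▸ hψ ▸ ψ.inc_other
  obtain ⟨y, hy⟩ := hP.exists_replacedFlag_eq hab (φ := σ ψ.swap)
    fun h => hσ.vtx_ne ψ.swap (h.trans hψ.symm)
  have hy_edge : replacedEdge P a b y.1.edge = some (P.spoke c) :=
    (congrArg Flag.edge hy).trans ((hσ.edge_eq _).trans hψc.symm)
  obtain ⟨k, hk⟩ := ht.exists_of_edge y c (replacedEdge_eq_some.1 hy_edge).1
  refine ⟨(c, k), fun hsc => ψ.edge_ne_other ?_, hc, Or.inr ⟨hψ, by rw [hk, hy]⟩⟩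
  exact (hσ.edge_eq _).trans (hedge.trans ((congrArg (some ∘ P.spoke) hsc).trans hψc))

theorem exists_joins (hσ : IsTransition σ) (ht : IsSideLabelling t) (s : Side) :
    ∃ s', s.1 ≠ s'.1 ∧ (s.1 = a ∨ s.1 = b ↔ s'.1 = a ∨ s'.1 = b) ∧
      Joins (hP.replacedFlag hab) σ (t s) (t s') := by
  by_cases hs : s.1 = a ∨ s.1 = b
  · obtain ⟨s', hne, hs', hjoin⟩ := hP.exists_joins_newEdge hab hσ ht hs
    exact ⟨s', hne, iff_of_true hs hs', hjoin⟩
  · obtain ⟨s', hne, hs', hjoin⟩ := hP.exists_joins_newVertex hab hσ ht hs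
    exact ⟨s', hne, iff_of_false hs hs', hjoin⟩

theorem eq_of_joins (ht : IsSideLabelling t) (hσ : IsTransition σ) (hσ' : IsTransition σ')
    (hout : outerPart (hP.replacedFlag hab) σ = outerPart (hP.replacedFlag hab) σ')
    (hjoin : ∀ s, ∃ y, Joins (hP.replacedFlag hab) σ (t s) y ∧
      Joins (hP.replacedFlag hab) σ' (t s) y) : σ = σ' := by
  have hj := hP.isOuterEmbedding_replacedFlag hab
  have houter (x : OuterFlag P) : σ (hP.replacedFlag hab x) = σ' (hP.replacedFlag hab x) := by
    by_cases hx : x.1.edge ∈ Set.range P.spoke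
    · obtain ⟨i, hi⟩ := hx
      obtain ⟨k, rfl⟩ := ht.exists_of_edge x i hi.symm
      obtain ⟨y, h, h'⟩ := hjoin (i, k)
      exact h.apply_eq_apply (hP.replacedFlag_vtx_ne_none hab) hσ hσ' h'
    · rw [← (hj.outerPart_of_notMem hσ hx).1, ← (hj.outerPart_of_notMem hσ' hx).1, hout]
  funext φ
  by_cases hv : φ.vtx = none
  · obtain ⟨x, hx⟩ := hP.exists_replacedFlag_eq hab (φ := σ φ)
      fun h => hσ.vtx_ne φ (h.trans hv.symm)
    have hx' := houter x
    rw [hx, hσ.involutive, ← hx] at hx'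
    rw [← hx, hx', hσ'.involutive]
  · obtain ⟨x, rfl⟩ := hP.exists_replacedFlag_eq hab hv
    exact houter x

theorem ncard_le_replacementCount {ς : OuterFlag P → OuterFlag P} (hς : IsOuterTransition ς)
    (ht : IsSideLabelling t) {ρ : Fin 5 → Fin 5}
    (hρ : ∀ s s', Linked ς OuterFlag.swap (t s) (t s') ↔ pathAt ρ s = pathAt ρ s') :
    {σ ∈ circuitTransitions (P.replace a b) | outerPart (hP.replacedFlag hab) σ = ς}.ncard ≤
      replacementCount ρ (disjointPairs OuterFlag.swap (fun x => x.1.vtx) t ς) a b := by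
  have hj := hP.isOuterEmbedding_replacedFlag hab
  have hex (σ : Flag (P.replace a b) → Flag (P.replace a b)) (hσ : IsTransition σ) (s : Side) :=
    hP.exists_joins hab hσ ht s
  choose! γ hγ_ne hγ_iff hγ using hex
  refine (hς.outerSystem ht).ncard_le_replacementCount hρ (γ := γ) ?_ ?_
  · rintro σ ⟨hσ, ho⟩ σ' ⟨hσ', ho'⟩ h
    exact hP.eq_of_joins hab ht hσ.1 hσ'.1 (ho.trans ho'.symm) fun s =>
      ⟨t (γ σ s), hγ σ hσ.1 s, h ▸ hγ σ' hσ'.1 s⟩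
  · rintro σ ⟨hσ, rfl⟩
    exact {
      involutive := fun s => ht.injective <| (hγ σ hσ.1 (γ σ s)).unique
        (hP.replacedFlag_injective hab) (hP.replacedFlag_vtx_ne_none hab)
        ((hγ σ hσ.1 s).symm hσ.1)
      spoke_ne := hγ_ne σ hσ.1
      spoke_iff := hγ_iff σ hσ.1
      exists_extension := ⟨_, hj.isSimpleExtension hσ, fun s => (hγ σ hσ.1 s).linked⟩ }

end IsProper

end Joins

section WeightedSum

variable {P : FiveCycle G} {a b : Fin 5}

theorem isNonloopAt_replace {x : α} {f : β} (hx : x ∉ Set.range P.vert)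
    (hf : G.IsNonloopAt f x) (ha : f ≠ P.spoke a) (hb : f ≠ P.spoke b) :
    (P.replace a b).IsNonloopAt (some f) (some x) := by
  obtain ⟨y, hyx, hlink⟩ := hf
  refine ⟨P.collapse y, fun h => hyx (collapse_eq_some.1 h).1, replace_isLink_some.2
    ⟨⟨?_, ha, hb⟩, x, y, hlink, collapse_of_notMem hx, rfl⟩⟩
  rintro ⟨i, rfl⟩
  rcases inc_rim.1 hlink.inc_left with rfl | rfl <;> exact hx ⟨_, rfl⟩

namespace IsProper

variable (hP : IsProper P)
include hP

theorem numCircuitDoubleCovers_replace_of_outer_eq (hab : a ≠ b) (h : P.outer a = P.outer b) :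
    (P.replace a b).numCircuitDoubleCovers = 0 := by
  have hout : P.outer a ∉ Set.range P.vert := fun ⟨j, hj⟩ => hP.outer_ne_vert a j hj.symm
  obtain ⟨g, hga, hgb, hi⟩ := hP.cubic.exists_third ⟨P.outer a, P.spoke a, P.spoke b,
    inc_spoke.2 (Or.inr rfl), inc_spoke.2 (Or.inr h), hP.spoke_injective.ne hab⟩
  have hinc : G.incidenceSet (P.outer a) = {P.spoke a, P.spoke b, g} := hi
  have hg : G.IsNonloopAt g (P.outer a) := isNonloopAt_iff_inc_not_isLoopAt.2
    ⟨show g ∈ G.incidenceSet (P.outer a) by simp [hinc], hP.cubic.not_isLoopAt _ _⟩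
  refine numCircuitDoubleCovers_eq_zero_of_isNonloopAt (isNonloopAt_replace hout hg hga hgb)
    fun f hf => ?_
  cases f with
  | none =>
    right
    rw [← isLink_self_iff, replace_isLink_none, ← h, hP.collapse_outer]
  | some e =>
    obtain ⟨⟨-, hea, heb⟩, u, hu, hua⟩ := replace_inc_some.1 hf
    obtain ⟨rfl, -⟩ := collapse_eq_some.1 hua
    have he : e ∈ G.incidenceSet (P.outer a) := hu
    rw [hinc] at he
    exact Or.inl (congrArg some ((he.resolve_left hea).resolve_left heb))

theorem exists_bound_of_isOuterTransition [Finite (OuterFlag P)] [Finite (Flag G)]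
    {ς : OuterFlag P → OuterFlag P} (hς : IsOuterTransition ς) :
    ∃ N : Fin 5 → Fin 5 → ℕ,
      (∀ a b (hab : P.outer a ≠ P.outer b), {σ ∈ circuitTransitions (P.replace a b) |
        outerPart (hP.replacedFlag hab) σ = ς}.ncard ≤ N a b) ∧
      2 * ∑ i, N i (i + 1) + ∑ i, N i (i + 2) ≤
        4 * {σ ∈ circuitTransitions G | outerPart (P := P) Subtype.val σ = ς}.ncard := by
  obtain ⟨t₀, ht₀⟩ := hP.exists_isSideLabelling
  obtain ⟨f, row, hrow, hρ⟩ := (hς.outerSystem ht₀).exists_normalForm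
  have ht := ht₀.comp_flipSide f
  refine ⟨replacementCount row.1
    (disjointPairs OuterFlag.swap (fun x => x.1.vtx) (fun s => t₀ (flipSide f s)) ς),
    fun a b hab => hP.ncard_le_replacementCount hab hς ht hρ, ?_⟩
  calc _ ≤ 4 * countBelow _ (pentagonMerges row.1) row.2 :=
        weighted_replacementCount_le row hrow _
          ((hς.outerSystem ht).disjointPairs_mem_bitmasksBelow hρ)
    _ ≤ _ := Nat.mul_le_mul_left 4 (countBelow_pentagonMerges_le_ncard hP hς ht hrow hρ)

theorem numCircuitDoubleCovers_replace_le (hV : G.vertexSet.Finite) (hE : G.edgeSet.Finite)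
    [Finite (OuterFlag P)] (hab : a ≠ b) {N : (OuterFlag P → OuterFlag P) → ℕ}
    (hN : ∀ ς ∈ outerTransitions P, ∀ h : P.outer a ≠ P.outer b,
      {σ ∈ circuitTransitions (P.replace a b) | outerPart (hP.replacedFlag h) σ = ς}.ncard ≤ N ς) :
    (P.replace a b).numCircuitDoubleCovers ≤ ∑ ς ∈ outerTransitions P, N ς := by
  by_cases h : P.outer a = P.outer b
  · rw [hP.numCircuitDoubleCovers_replace_of_outer_eq hab h]
    exact Nat.zero_le _
  · have hV' := finite_vertexSet_replace (P := P) (a := a) (b := b) hV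
    have hE' := finite_edgeSet_replace (P := P) (a := a) (b := b) hE
    have := Flag.finite hV' hE'
    rw [(hP.isLooplessCubic_replace h).numCircuitDoubleCovers_eq hV' hE',
      (hP.isOuterEmbedding_replacedFlag h).ncard_eq_sum]
    exact Finset.sum_le_sum fun ς hς => hN ς hς h

theorem weighted_sum_le (hV : G.vertexSet.Finite) (hE : G.edgeSet.Finite) :
    2 * ∑ i, (P.replace i (i + 1)).numCircuitDoubleCovers +
        ∑ i, (P.replace i (i + 2)).numCircuitDoubleCovers ≤ 4 * G.numCircuitDoubleCovers := by
  have := Flag.finite hV hE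
  have := OuterFlag.finite (P := P) hV hE
  have hex (ς : OuterFlag P → OuterFlag P) (hς : ς ∈ outerTransitions P) :=
    hP.exists_bound_of_isOuterTransition (mem_outerTransitions.1 hς)
  choose! N hN hsum using hex
  have hle (a b : Fin 5) (hab : a ≠ b) :
      (P.replace a b).numCircuitDoubleCovers ≤ ∑ ς ∈ outerTransitions P, N ς a b :=
    hP.numCircuitDoubleCovers_replace_le hV hE hab fun ς hς => hN ς hς a b
  have hne₁ : ∀ i : Fin 5, i ≠ i + 1 := by decide
  have hne₂ : ∀ i : Fin 5, i ≠ i + 2 := by decide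
  calc _ ≤ 2 * ∑ i, ∑ ς ∈ outerTransitions P, N ς i (i + 1) +
        ∑ i, ∑ ς ∈ outerTransitions P, N ς i (i + 2) := by
        gcongr with i _ i _
        exacts [hle i (i + 1) (hne₁ i), hle i (i + 2) (hne₂ i)]
    _ = ∑ ς ∈ outerTransitions P, (2 * ∑ i, N ς i (i + 1) + ∑ i, N ς i (i + 2)) := by
        rw [Finset.sum_comm, Finset.sum_comm (s := Finset.univ), Finset.mul_sum,
          Finset.sum_add_distrib]
    _ ≤ ∑ ς ∈ outerTransitions P,
        4 * {σ ∈ circuitTransitions G | outerPart (P := P) Subtype.val σ = ς}.ncard :=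
        Finset.sum_le_sum hsum
    _ = 4 * G.numCircuitDoubleCovers := by
        rw [← Finset.mul_sum, ← hP.isOuterEmbedding_val.ncard_eq_sum,
          hP.cubic.numCircuitDoubleCovers_eq hV hE]

end IsProper

end WeightedSum

/-! ### Loops and chords -/

section Degenerate

theorem eq_one_of_add_add_self_eq_three {m n : ℕ∞} (h : m + n + n = 3) (hn : 1 ≤ n) : m = 1 := by
  cases m <;> cases n
  case coe.coe =>
    norm_cast at *
    omega
  all_goals simp at h

theorem exists_isNonloopAt_of_degree_eq_three {e : β} {x : α} (hd : G.degree x = 3)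
    (he : G.IsLoopAt e x) :
    ∃ f, G.IsNonloopAt f x ∧ ∀ e, G.Inc e x → e = f ∨ G.IsLoopAt e x := by
  have hpos : 1 ≤ (G.loopSet x).encard := Set.one_le_encard_iff_nonempty.2 ⟨e, he⟩
  rw [degree, ← Set.encard_sdiff_add_encard_of_subset (G.loopSet_subset_incidenceSet x)] at hd
  obtain ⟨f, hf⟩ := Set.encard_eq_one.1 (eq_one_of_add_add_self_eq_three hd hpos)
  have hmem (e : β) : G.Inc e x ∧ ¬ G.IsLoopAt e x ↔ e = f := Set.ext_iff.1 hf e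
  exact ⟨f, isNonloopAt_iff_inc_not_isLoopAt.2 ((hmem f).2 rfl), fun e he =>
    or_iff_not_imp_right.2 fun hl => (hmem e).1 ⟨he, hl⟩⟩

variable {P : FiveCycle G} {c d k : Fin 5} {e : β} {x : α}

theorem encard_incidenceSet_vert (hcubic : G.IsCubic) (P : FiveCycle G) (i : Fin 5) :
    (G.incidenceSet (P.vert i)).encard = 3 ∧ G.loopSet (P.vert i) = ∅ := by
  have hd := hcubic (P.vert i) (P.rim_isLink i).left_mem
  have hsub : ({P.rim (i - 1), P.rim i, P.spoke i} : Set β) ⊆ G.incidenceSet (P.vert i) := by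
    rintro e (rfl | rfl | rfl)
    exacts [inc_rim_sub_one P i, inc_rim_self P i, inc_spoke_self P i]
  have hle := Set.encard_le_encard hsub
  rw [Set.encard_eq_three.2
    ⟨_, _, _, rim_sub_one_ne P i, (P.spoke_ne_rim _ _).symm, (P.spoke_ne_rim _ _).symm, rfl⟩] at hle
  have hcard : (G.incidenceSet (P.vert i)).encard = 3 := le_antisymm (hd ▸ le_self_add) hle
  refine ⟨hcard, Set.encard_eq_zero.1 ?_⟩
  rw [degree, hcard] at hd
  exact WithTop.add_left_cancel (ENat.ofNat_ne_top 3) (hd.trans (add_zero 3).symm)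

theorem spoke_ne_spoke_of_outer_ne_vert (hcd : c ≠ d) (h : P.outer c ≠ P.vert d) :
    P.spoke c ≠ P.spoke d := fun heq =>
  (inc_spoke.1 (heq ▸ inc_spoke_self P d)).elim (fun hv => hcd (P.vert_injective hv).symm)
    fun hv => h hv.symm

theorem exists_numCircuitDoubleCovers_replace_eq_zero_of_isLoopAt (hcubic : G.IsCubic)
    (P : FiveCycle G) (he : G.IsLoopAt e x) :
    ∃ i, (P.replace i (i + 1)).numCircuitDoubleCovers = 0 := by
  have hx : x ∉ Set.range P.vert := by
    rintro ⟨i, rfl⟩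
    exact (Set.ext_iff.1 (encard_incidenceSet_vert hcubic P i).2 e).1 he
  obtain ⟨f, hf, hloop⟩ := exists_isNonloopAt_of_degree_eq_three (hcubic x he.vertex_mem) he
  have hspoke (c : Fin 5) : ¬ G.IsLoopAt (P.spoke c) x := fun hc =>
    hx ⟨c, (hc.eq_of_inc (inc_spoke_self P c)).symm⟩
  obtain ⟨i, hi, hi'⟩ : ∃ i, f ≠ P.spoke i ∧ f ≠ P.spoke (i + 1) := by
    by_cases hs : ∃ c, f = P.spoke c
    · obtain ⟨c, rfl⟩ := hs
      have hout (d : Fin 5) : P.outer c ≠ P.vert d := fun h =>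
        hx ⟨d, h.symm.trans (eq_outer_of_inc_spoke hx hf.inc).symm⟩
      have hne : ∀ c : Fin 5, c ≠ c + 1 ∧ c ≠ c + 1 + 1 := by decide
      exact ⟨c + 1, spoke_ne_spoke_of_outer_ne_vert (hne c).1 (hout _),
        spoke_ne_spoke_of_outer_ne_vert (hne c).2 (hout _)⟩
    · exact ⟨0, not_exists.1 hs _, not_exists.1 hs _⟩
  have hnone (c : Fin 5) (hc : f ≠ P.spoke c) : some x ≠ P.collapse (P.outer c) := fun h =>
    hc ((hloop _ (inc_spoke.2 (Or.inr (collapse_eq_some.1 h.symm).1.symm))).resolve_right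
      (hspoke c)).symm
  refine ⟨i, numCircuitDoubleCovers_eq_zero_of_isNonloopAt (isNonloopAt_replace hx hf hi hi')
    fun g hg => ?_⟩
  cases g with
  | none => exact absurd (replace_inc_none.1 hg) (not_or.2 ⟨hnone i hi, hnone _ hi'⟩)
  | some g =>
    obtain ⟨hkept, u, hu, hux⟩ := replace_inc_some.1 hg
    obtain ⟨rfl, -⟩ := collapse_eq_some.1 hux
    refine (hloop g hu).imp (congrArg some) fun hl => ?_
    exact replace_isLink_some.2 ⟨hkept, u, u, hl, collapse_of_notMem hx, collapse_of_notMem hx⟩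

theorem spoke_eq_spoke_of_outer_eq_vert (hcubic : G.IsCubic) (h : P.outer c = P.vert d) :
    P.spoke c = P.spoke d :=
  eq_spoke_of_inc_vert (encard_incidenceSet_vert hcubic P d).1
    (fun ⟨_, hr⟩ => P.spoke_ne_rim _ _ hr.symm) (inc_spoke.2 (Or.inr h.symm))

theorem outer_eq_vert_symm (hcubic : G.IsCubic) (h : P.outer c = P.vert d) :
    P.outer d = P.vert c := by
  have hlink := P.spoke_isLink c
  rw [h, spoke_eq_spoke_of_outer_eq_vert hcubic h] at hlink
  exact (P.spoke_isLink d).right_unique hlink.symm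

theorem eq_of_outer_eq_vert (hcubic : G.IsCubic) (hc : P.outer c = P.vert k)
    (hd : P.outer d = P.vert k) : c = d :=
  P.vert_injective ((outer_eq_vert_symm hcubic hc).symm.trans (outer_eq_vert_symm hcubic hd))

theorem outer_ne_vert_self (hcubic : G.IsCubic) (P : FiveCycle G) (c : Fin 5) :
    P.outer c ≠ P.vert c := fun h =>
  (Set.ext_iff.1 (encard_incidenceSet_vert hcubic P c).2 (P.spoke c)).1
    (show G.IsLink _ _ _ from h ▸ P.spoke_isLink c)

theorem isLoopAt_replace_of_outer_eq_vert {a b : Fin 5} (h : P.outer c = P.vert d)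
    (ha : P.spoke c ≠ P.spoke a) (hb : P.spoke c ≠ P.spoke b) :
    (P.replace a b).IsLoopAt (some (P.spoke c)) none :=
  replace_isLink_some.2 ⟨⟨fun ⟨_, hr⟩ => P.spoke_ne_rim _ _ hr.symm, ha, hb⟩, _, _,
    P.spoke_isLink c, collapse_vert P c, h ▸ collapse_vert P d⟩

section Chord

-- The chord joins the vertices `π 0` and `π 1`; the new edge replaces the spokes `π 3` and `π 4`.
variable (hcubic : G.IsCubic) {π : Fin 5 → Fin 5} (hπ : Function.Bijective π)
  (h : P.outer (π 0) = P.vert (π 1))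
include hcubic hπ h

theorem inc_none_replace_chord (he : (P.replace (π 3) (π 4)).Inc (some e) none) :
    (e = P.spoke (π 2) ∧ e ≠ P.spoke (π 3) ∧ e ≠ P.spoke (π 4)) ∨
      (P.replace (π 3) (π 4)).IsLoopAt (some e) none := by
  obtain ⟨⟨hrim, he₃, he₄⟩, u, hu, hun⟩ := replace_inc_some.1 he
  obtain ⟨c, rfl⟩ := collapse_eq_none.1 hun
  obtain ⟨k, rfl⟩ := hπ.2 c
  obtain rfl := eq_spoke_of_inc_vert (encard_incidenceSet_vert hcubic P _).1 hrim hu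
  fin_cases k
  · exact Or.inr (isLoopAt_replace_of_outer_eq_vert h he₃ he₄)
  · exact Or.inr (isLoopAt_replace_of_outer_eq_vert (outer_eq_vert_symm hcubic h) he₃ he₄)
  · exact Or.inl ⟨rfl, he₃, he₄⟩
  · exact absurd rfl he₃
  · exact absurd rfl he₄

theorem exists_eq_of_outer_eq_vert {k : Fin 5} (hk : 2 ≤ k) (hc : P.outer (π k) = P.vert c) :
    ∃ l, 2 ≤ l ∧ l ≠ k ∧ c = π l := by
  obtain ⟨l, rfl⟩ := hπ.2 c
  refine ⟨l, ?_, ?_, rfl⟩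
  · by_contra! hl
    have hl : l = 0 ∨ l = 1 := by omega
    have hk : k ≠ 0 ∧ k ≠ 1 := by omega
    rcases hl with rfl | rfl
    · exact hk.2 (hπ.1 (P.vert_injective ((outer_eq_vert_symm hcubic hc).symm.trans h)))
    · exact hk.1 (hπ.1 (eq_of_outer_eq_vert hcubic hc h))
  · rintro rfl
    exact outer_ne_vert_self hcubic P _ hc

theorem numCircuitDoubleCovers_replace_of_chord_of_outer_notMem
    (h₂ : P.outer (π 2) ∉ Set.range P.vert) :
    (P.replace (π 3) (π 4)).numCircuitDoubleCovers = 0 := by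
  have hspoke {k : Fin 5} (hk : k ≠ 2) : P.spoke (π 2) ≠ P.spoke (π k) :=
    spoke_ne_spoke_of_outer_ne_vert (hπ.1.ne hk.symm) fun hv => h₂ ⟨_, hv.symm⟩
  have hmate {k l : Fin 5} (hk : 2 < k) (hl : 2 < l) (hkl : k ≠ l)
      (hn : P.outer (π k) ∈ Set.range P.vert) : P.outer (π l) ∈ Set.range P.vert := by
    obtain ⟨c, hc⟩ := hn
    obtain ⟨m, hm, hmk, rfl⟩ := exists_eq_of_outer_eq_vert hcubic hπ h hk.le hc.symm
    have hc' := outer_eq_vert_symm hcubic hc.symm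
    obtain rfl | rfl : m = 2 ∨ m = l := by omega
    exacts [absurd ⟨_, hc'.symm⟩ h₂, ⟨_, hc'.symm⟩]
  refine numCircuitDoubleCovers_eq_zero_of_isNonloopAt (f := some (P.spoke (π 2))) (x := none)
    ⟨some (P.outer (π 2)), nofun, replace_isLink_some.2 ⟨⟨fun ⟨_, hr⟩ => P.spoke_ne_rim _ _ hr.symm,
      hspoke (by decide), hspoke (by decide)⟩, _, _, P.spoke_isLink _, collapse_vert P _,
      collapse_of_notMem h₂⟩⟩ fun f hf => ?_
  cases f with
  | some e => exact (inc_none_replace_chord hcubic hπ h hf).imp_left fun he => congrArg some he.1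
  | none =>
    right
    have hmem : P.outer (π 3) ∈ Set.range P.vert ∧ P.outer (π 4) ∈ Set.range P.vert := by
      rcases replace_inc_none.1 hf with hn | hn
      · have hn := collapse_eq_none.1 hn.symm
        exact ⟨hn, hmate (by decide) (by decide) (by decide) hn⟩
      · have hn := collapse_eq_none.1 hn.symm
        exact ⟨hmate (by decide) (by decide) (by decide) hn, hn⟩
    rw [← isLink_self_iff, replace_isLink_none, collapse_eq_none.2 hmem.1,
      collapse_eq_none.2 hmem.2]

theorem numCircuitDoubleCovers_replace_of_chord_of_chord (h₂ : P.outer (π 2) = P.vert (π 3)) :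
    (P.replace (π 3) (π 4)).numCircuitDoubleCovers = 0 := by
  have h₃ := outer_eq_vert_symm hcubic h₂
  have h₄ : P.outer (π 4) ∉ Set.range P.vert := by
    rintro ⟨c, hc⟩
    obtain ⟨l, hl, hl₄, rfl⟩ := exists_eq_of_outer_eq_vert hcubic hπ h (by decide) hc.symm
    obtain rfl | rfl : l = 2 ∨ l = 3 := by omega
    · exact absurd (hπ.1 (eq_of_outer_eq_vert hcubic hc.symm h₃)) (by decide)
    · exact absurd (hπ.1 (eq_of_outer_eq_vert hcubic hc.symm h₂)) (by decide)
  refine numCircuitDoubleCovers_eq_zero_of_isNonloopAt (f := none) (x := none)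
    ⟨some (P.outer (π 4)), nofun, ?_⟩ fun f hf => ?_
  · rw [replace_isLink_none, h₃, collapse_vert, collapse_of_notMem h₄]
  · cases f with
    | none => exact Or.inl rfl
    | some e =>
      refine Or.inr ((inc_none_replace_chord hcubic hπ h hf).resolve_left ?_)
      rintro ⟨rfl, hne, -⟩
      exact hne (spoke_eq_spoke_of_outer_eq_vert hcubic h₂)

theorem numCircuitDoubleCovers_replace_of_chord :
    (P.replace (π 3) (π 4)).numCircuitDoubleCovers = 0 := by
  by_cases h₂ : P.outer (π 2) ∈ Set.range P.vert
  · obtain ⟨c, hc⟩ := h₂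
    obtain ⟨l, hl, hl₂, rfl⟩ := exists_eq_of_outer_eq_vert hcubic hπ h le_rfl hc.symm
    obtain rfl | rfl : l = 3 ∨ l = 4 := by omega
    · exact numCircuitDoubleCovers_replace_of_chord_of_chord hcubic hπ h hc.symm
    · rw [replace_comm]
      exact numCircuitDoubleCovers_replace_of_chord_of_chord (π := π ∘ Equiv.swap 3 4) hcubic
        (hπ.comp (Equiv.bijective _)) h hc.symm
  · exact numCircuitDoubleCovers_replace_of_chord_of_outer_notMem hcubic hπ h h₂

end Chord

theorem exists_numCircuitDoubleCovers_replace_eq_zero_of_chord (hcubic : G.IsCubic)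
    (h : P.outer c = P.vert d) : ∃ i, (P.replace i (i + 1)).numCircuitDoubleCovers = 0 := by
  have hcases : ∀ c d : Fin 5, d = c ∨ d = c + 1 ∨ c = d + 1 ∨ d = c + 2 ∨ c = d + 2 := by decide
  have hadj (c : Fin 5) (h : P.outer c = P.vert (c + 1)) :=
    numCircuitDoubleCovers_replace_of_chord (π := ![c, c + 1, c + 2, c + 3, c + 3 + 1]) hcubic
      ((by decide : ∀ c : Fin 5, Function.Bijective ![c, c + 1, c + 2, c + 3, c + 3 + 1]) c) h
  have hopp (c : Fin 5) (h : P.outer c = P.vert (c + 2)) :=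
    numCircuitDoubleCovers_replace_of_chord (π := ![c, c + 2, c + 1, c + 3, c + 3 + 1]) hcubic
      ((by decide : ∀ c : Fin 5, Function.Bijective ![c, c + 2, c + 1, c + 3, c + 3 + 1]) c) h
  rcases hcases c d with rfl | rfl | rfl | rfl | rfl
  · exact absurd h (outer_ne_vert_self hcubic P _)
  · exact ⟨_, hadj _ h⟩
  · exact ⟨_, hadj _ (outer_eq_vert_symm hcubic h)⟩
  · exact ⟨_, hopp _ h⟩
  · exact ⟨_, hopp _ (outer_eq_vert_symm hcubic h)⟩

theorem isProper_or_exists_numCircuitDoubleCovers_replace_eq_zero (hcubic : G.IsCubic)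
    (P : FiveCycle G) :
    IsProper P ∨ ∃ i, (P.replace i (i + 1)).numCircuitDoubleCovers = 0 := by
  rw [or_iff_not_imp_right]
  intro hν
  have hloop (e : β) (x : α) : ¬ G.IsLoopAt e x := fun he =>
    hν (exists_numCircuitDoubleCovers_replace_eq_zero_of_isLoopAt hcubic P he)
  refine ⟨⟨hloop, fun x hx => ?_⟩, fun i j h =>
    hν (exists_numCircuitDoubleCovers_replace_eq_zero_of_chord hcubic h)⟩
  have hempty : G.loopSet x = ∅ := Set.eq_empty_iff_forall_notMem.2 fun e => hloop e x
  simpa only [degree, hempty, Set.encard_empty, add_zero] using hcubic x hx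

end Degenerate

section Minimum

theorem ten_mul_add_five_mul_le (hV : G.vertexSet.Finite) (hE : G.edgeSet.Finite)
    (hcubic : G.IsCubic) (P : FiveCycle G) {m n : ℝ} (hnm : n ≤ m)
    (hm : ∀ i, m ≤ (P.replace i (i + 1)).numCircuitDoubleCovers)
    (hn : ∀ i, n ≤ (P.replace i (i + 2)).numCircuitDoubleCovers) :
    10 * m + 5 * n ≤ 4 * G.numCircuitDoubleCovers := by
  rcases isProper_or_exists_numCircuitDoubleCovers_replace_eq_zero hcubic P with hP | ⟨i, hi⟩
  · have hsum : (2 : ℝ) * ∑ i, ((P.replace i (i + 1)).numCircuitDoubleCovers : ℝ) +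
        ∑ i, ((P.replace i (i + 2)).numCircuitDoubleCovers : ℝ) ≤ 4 * G.numCircuitDoubleCovers :=
      mod_cast hP.weighted_sum_le hV hE
    have hm_sum := Finset.card_nsmul_le_sum Finset.univ _ m fun i _ => hm i
    have hn_sum := Finset.card_nsmul_le_sum Finset.univ _ n fun i _ => hn i
    simp only [Finset.card_univ, Fintype.card_fin, nsmul_eq_mul, Nat.cast_ofNat] at hm_sum hn_sum
    linarith
  · have hm_zero : m ≤ 0 := by simpa only [hi, Nat.cast_zero] using hm i
    linarith [(Nat.cast_nonneg _ : (0 : ℝ) ≤ G.numCircuitDoubleCovers)]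

theorem inf'_spokePairs_le (P : FiveCycle G) {a b : Fin 5} (hab : a ≠ b) :
    spokePairs.inf' spokePairs_nonempty
      (fun p => ((P.replace p.1 p.2).numCircuitDoubleCovers : ℝ)) ≤
        (P.replace a b).numCircuitDoubleCovers := by
  have hmem : ∀ a b : Fin 5, a ≠ b → (a, b) ∈ spokePairs ∨ (b, a) ∈ spokePairs := by decide
  rcases hmem a b hab with h | h
  · exact Finset.inf'_le_of_le _ h le_rfl
  · exact Finset.inf'_le_of_le _ h (by rw [replace_comm])

end Minimum

end CircuitDoubleCover

open CircuitDoubleCover in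
theorem theorem6p3_general {α β : Type*} (G : Graph α β)
    (hV : G.vertexSet.Finite) (hE : G.edgeSet.Finite) (hcubic : G.IsCubic) (P : G.FiveCycle) :
    (5 / 2 : ℝ) * (Finset.univ : Finset (Fin 5)).inf' Finset.univ_nonempty
        (fun i => ((P.replace i (i + 1)).numCircuitDoubleCovers : ℝ))
      ≤ (G.numCircuitDoubleCovers : ℝ) ∧
    (3.75 : ℝ) * spokePairs.inf' spokePairs_nonempty
        (fun p => ((P.replace p.1 p.2).numCircuitDoubleCovers : ℝ))
      ≤ (G.numCircuitDoubleCovers : ℝ) := by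
  have hne₁ : ∀ i : Fin 5, i ≠ i + 1 := by decide
  have hne₂ : ∀ i : Fin 5, i ≠ i + 2 := by decide
  have hadjacent := ten_mul_add_five_mul_le hV hE hcubic P (n := 0)
    (Finset.le_inf' Finset.univ_nonempty _ fun i _ => Nat.cast_nonneg _)
    (fun i => Finset.inf'_le (fun i => ((P.replace i (i + 1)).numCircuitDoubleCovers : ℝ))
      (Finset.mem_univ i)) fun i => Nat.cast_nonneg _
  have hall := ten_mul_add_five_mul_le hV hE hcubic P le_rfl
    (fun i => inf'_spokePairs_le P (hne₁ i)) fun i => inf'_spokePairs_le P (hne₂ i)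
  constructor <;> linarith

theorem theorem6p3 {α β : Type*} (G : Graph α β)
    (hV : G.vertexSet.Finite) (hE : G.edgeSet.Finite) (hcubic : G.IsCubic)
    (hconn : G.CyclicallyEdgeConnected 4) (h4 : ¬ G.HasCycleOfLength 4) (P : G.FiveCycle) :
    (5 / 2 : ℝ) * (Finset.univ : Finset (Fin 5)).inf' Finset.univ_nonempty
        (fun i => ((P.replace i (i + 1)).numCircuitDoubleCovers : ℝ))
      ≤ (G.numCircuitDoubleCovers : ℝ) ∧
    (3.75 : ℝ) * spokePairs.inf' spokePairs_nonempty
        (fun p => ((P.replace p.1 p.2).numCircuitDoubleCovers : ℝ))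
      ≤ (G.numCircuitDoubleCovers : ℝ) :=
  theorem6p3_general G hV hE hcubic P
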